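/- Let $k\ge 2$, let $\theta_1\ge\dots\ge\theta_k>0$, let $r_1,\dots,r_k:[0,1]\to\mathbb R$ be Lipschitz functions that are orthonormal in $L^2[0,1]$, and suppose that $$f(x,y)=\sum_{l=1}^k\theta_l r_l(x)r_l(y)\ge 0\quad\text{for all }x,y\in[0,1].$$ Let $(\varepsilon_N)_{N\ge1}$ be real numbers with $0<\varepsilon_N\le\bigl[\sup_{[0,1]^2}f\bigr]^{-1}$ for all $N\ge 1$, and $N^{-2/3}\ll\varepsilon_N\ll1$, that is, $N^{-2/3}/\varepsilon_N\to0$ and $\varepsilon_N\to0$ as $N\to\infty$. For $N\ge1$ let $A=A_N$ be a random symmetric $N\times N$ matrix whose entries $A(a,b)$, $1\le a\le b\le N$, are independent with $A(a,b)\sim\mathrm{Bernoulli}\bigl(\varepsilon_N f(a/N,b/N)\bigr)$. Let $W=A-\mathrm E(A)$ (entrywise expectation), let $e_l=N^{-1/2}\bigl(r_l(1/N),r_l(2/N),\dots,r_l(1)\bigr)'$ for $1\le l\le k$, and let $\lambda_1(A)\ge\dots\ge\lambda_N(A)$ be the eigenvalues of $A$. Fix $i\in\{1,\dots,k\}$ with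 $\theta_{i-1}>\theta_i>\theta_{i+1}$, where $\theta_0=\infty$ and $\theta_{k+1}=-\infty$. For $N\ge i$, whenever $\lambda_i(A)$ is an eigenvalue of $A$ of multiplicity $1$, let $v=v_N$ be a corresponding eigenvector of Euclidean norm $1$, with its sign chosen so that $e_i'v\ge0$; otherwise let $v\in\mathbb R^N$ be arbitrary. Then for every $j\in\{1,\dots,k\}\setminus\{i\}$, as $N\to\infty$, $$e_j'v=\frac1{\theta_i-\theta_j}\left[\theta_i\frac1{\lambda_i(A)}\,e_i'We_j+(N\varepsilon_N)^{-2}\frac1{\theta_i}\,\mathrm E\bigl(e_i'W^2e_j\bigr)\right]+o_p\!\left(\frac1{N\sqrt{\varepsilon_N}}\right),$$ where $Y_N=o_p(Z_N)$ means that $\mathbb P(|Y_N|>\delta|Z_N|)\to0$ as $N\to\infty$ for every $\delta>0$. (The value given to $1/\lambda_i(A)$ when $\lambda_i(A)=0$ is immaterial.) -/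

import Mathlib

open MeasureTheory ProbabilityTheory Filter Asymptotics Matrix
open scoped Topology

namespace InhomER

/-- The standing assumptions on the kernel: `f = ∑ θ_l r_l ⊗ r_l` is non-negative on the unit
square, with `θ_1 ≥ ⋯ ≥ θ_k > 0` and `r_1, …, r_k` orthonormal in `L²[0,1]`.
Indices run over `Fin k`, so the index `l : Fin k` stands for the `(l+1)`-st eigenvalue. Functions
on `[0,1]` are functions on `ℝ` that are only constrained on `[0,1]`. -/
structure IsKernel {k : ℕ} (f : ℝ → ℝ → ℝ) (θ : Fin k → ℝ) (r : Fin k → ℝ → ℝ) : Prop where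
  pos : ∀ l, 0 < θ l
  antitone : Antitone θ
  orthonormal : ∀ j l, ∫ x in (0 : ℝ)..1, r j x * r l x = if j = l then 1 else 0
  decomp : ∀ x ∈ Set.Icc (0 : ℝ) 1, ∀ y ∈ Set.Icc (0 : ℝ) 1,
    f x y = ∑ l, θ l * r l x * r l y
  nonneg : ∀ x ∈ Set.Icc (0 : ℝ) 1, ∀ y ∈ Set.Icc (0 : ℝ) 1, 0 ≤ f x y

/-- Each `r_l` is Lipschitz on `[0,1]`. -/
def AssumptionF2 {k : ℕ} (r : Fin k → ℝ → ℝ) : Prop :=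
  ∀ l, ∃ K : ℝ, ∀ x ∈ Set.Icc (0 : ℝ) 1, ∀ y ∈ Set.Icc (0 : ℝ) 1,
    |r l x - r l y| ≤ K * |x - y|

/-- `0 < ε_N ≤ (sup f)⁻¹` for every `N ≥ 1`, the supremum being over the unit square. -/
def AdmissibleScale (f : ℝ → ℝ → ℝ) (ε : ℕ → ℝ) : Prop :=
  ∀ N, 1 ≤ N → 0 < ε N ∧
    ε N ≤ (sSup {z : ℝ | ∃ x ∈ Set.Icc (0 : ℝ) 1, ∃ y ∈ Set.Icc (0 : ℝ) 1, z = f x y})⁻¹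

/-- `N^{-2/3} ≪ ε_N ≪ 1`. -/
def AssumptionE2 (ε : ℕ → ℝ) : Prop :=
  (fun N : ℕ => (N : ℝ) ^ (-(2 / 3) : ℝ)) =o[atTop] ε ∧ ε =o[atTop] (fun _ : ℕ => (1 : ℝ))

/-- `i ∈ 𝓘`, that is `θ_{i-1} > θ_i > θ_{i+1}`, where a missing neighbour imposes no condition
(the conventions `θ_0 = ∞`, `θ_{k+1} = -∞`). -/
def IsIsolated {k : ℕ} (θ : Fin k → ℝ) (i : Fin k) : Prop :=
  (∀ j : Fin k, (j : ℕ) + 1 = i → θ i < θ j) ∧ (∀ j : Fin k, (i : ℕ) + 1 = j → θ j < θ i)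

/-- The grid point attached to the vertex `a`: vertices `1, …, N` are indexed by `Fin N`, so `a`
is the vertex `a + 1` and its grid point is `(a + 1) / N`. -/
noncomputable def gridPoint (N : ℕ) (a : Fin N) : ℝ := ((a : ℕ) + 1 : ℝ) / N

/-- `A` is the random adjacency matrix of the inhomogeneous Erdős–Rényi graph on `N` vertices
(self-loops allowed): symmetric, with independent Bernoulli(`ε f(a/N, b/N)`) entries on and above
the diagonal. -/
structure IsAdjacency {Ω : Type*} [MeasurableSpace Ω] (P : Measure Ω) (f : ℝ → ℝ → ℝ) (ε : ℝ)
    {N : ℕ} (A : Ω → Matrix (Fin N) (Fin N) ℝ) : Prop where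
  symm : ∀ ω, (A ω).IsSymm
  law : ∀ a b : Fin N, a ≤ b → ∃ p : unitInterval,
    (p : ℝ) = ε * f (gridPoint N a) (gridPoint N b) ∧
      HasLaw (fun ω => A ω a b) (bernoulliMeasure (1 : ℝ) 0 p) P
  indep : iIndepFun (fun (q : {q : Fin N × Fin N // q.1 ≤ q.2}) ω => A ω q.1.1 q.1.2) P

/-- `W = A - E(A)`, with `E(A)` the entrywise expectation. -/
noncomputable def centered {Ω : Type*} [MeasurableSpace Ω] (P : Measure Ω) {N : ℕ}
    (A : Ω → Matrix (Fin N) (Fin N) ℝ) (ω : Ω) : Matrix (Fin N) (Fin N) ℝ :=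
  A ω - Matrix.of fun a b => ∫ ω', A ω' a b ∂P

/-- The discretised eigenfunction `N^{-1/2} (g(1/N), …, g(N/N))`. -/
noncomputable def discretize (N : ℕ) (g : ℝ → ℝ) : Fin N → ℝ :=
  fun a => (Real.sqrt N)⁻¹ * g (gridPoint N a)

open Classical in
/-- The `(i+1)`-st largest eigenvalue, with multiplicity, of a real symmetric matrix of size
`N > i` (and `0` outside of this range). -/
noncomputable def eig {N : ℕ} (M : Matrix (Fin N) (Fin N) ℝ) (i : ℕ) : ℝ :=
  if h : M.IsHermitian ∧ i < N then h.1.eigenvalues₀ ⟨i, by simpa using h.2⟩ else 0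

/-- `x` is an eigenvalue of multiplicity one of the symmetric matrix `M`. -/
def IsSimpleEigenvalue {N : ℕ} (M : Matrix (Fin N) (Fin N) ℝ) (x : ℝ) : Prop :=
  Module.finrank ℝ (Module.End.eigenspace (Matrix.toLin' M) x) = 1

/-- `v` is an eigenvector of `M` for `x` of Euclidean norm `1`, with the sign such that
`e' v ≥ 0`. -/
def IsUnitEigenvector {N : ℕ} (M : Matrix (Fin N) (Fin N) ℝ) (x : ℝ) (e v : Fin N → ℝ) : Prop :=
  M *ᵥ v = x • v ∧ ∑ a, v a ^ 2 = 1 ∧ 0 ≤ e ⬝ᵥ v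

/-- `Y_N = o_p(Z_N)`: for every `δ > 0`, `P(|Y_N| > δ |Z_N|) → 0`. -/
def IsLittleOp {Ω : ℕ → Type*} [∀ N, MeasurableSpace (Ω N)] (P : ∀ N, Measure (Ω N))
    (Y Z : ∀ N, Ω N → ℝ) : Prop :=
  ∀ δ : ℝ, 0 < δ →
    Tendsto (fun N => P N {ω | δ * |Z N ω| < |Y N ω|}) atTop (𝓝 0)

end InhomER

/-! Put L = N ε_N. The entrywise mean of A is exactly L ∑ θ_l e_l e_l', so A is a finite rank matrix
plus the noise W (`IsAdjacency.eq_perturbed`). The e_l are orthonormal up to d = O(1/N), the rate of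
Riemann sums of Lipschitz functions. The theorem then splits into a deterministic perturbation
result and moment bounds for W.

Deterministic half (`exists_eigenvector_expansion`). With u_l = e_l'v, s = 1/L and q = L/λ, the
eigenvalue equation reads v = q ∑ θ_l u_l e_l + q s W v. Substituting it into itself and pairing
with e_j expresses u_j through the forms e_j'W^n e_l and a remainder. Suppose that e_j'We_l = O(1),
that e_j'W²e_l, e_j'W³e_l and |W²e_l| are O(L), and that ‖W‖ ≤ γL/8 for a spectral gap γ. Min-max
places λ_i within γL/4 of θ_i L. Two substitutions give u_j = O(s) for j ≠ i, the normalisation |v|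
= 1 gives u_i = 1 + O(s), and four substitutions determine u_j up to O(s² + d). Simplicity of λ_i
needs no estimate of the other eigenvalues: every unit eigenvector for λ_i has e_i-component bounded
away from zero, so the eigenspace is a line.

Probabilistic half. Both e_j'W^n e_l and tr W⁶ are sums over paths of products of independent
centred edge variables of variance O(ε). A product has non-zero mean only if each edge is repeated,
and a connected walk visits at most one vertex more than it has distinct edges. Counting gives mean
O(L^⌊n/2⌋) and variance O(L^n/N) for the forms (`IsRegime.abs_integral_form_le`,
`IsRegime.integral_sq_form_sub_le`), and E tr W⁶ = O(N L³). As ‖W‖⁶ ≤ tr W⁶, the bound ‖W‖ ≤ γL/8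
fails with probability O(N/L³), which vanishes because ε ≫ N^(-2/3).

The expansion contains e_i'W²e_j, and replacing it by its mean costs L^(-2) · L/√N. Relative to
1/(N√ε), the three errors L^(-2), 1/N and 1/(L√N) are (N/L³)^(1/2), √ε and L^(-1/2), all tending to
0. -/

namespace InhomER

/-! ### Counting maps and words with repeated letters. -/

section Words

variable {α ι T T' : Type*} [Fintype T] [Fintype T']
  [DecidableEq ι] [DecidableEq α]

open Classical in
/-- The bound on the expectation of a product of independent centred variables, indexed by the
letters of a word: it vanishes if some letter occurs only once. -/
noncomputable def wordBound (p : ℝ) (w : T → ι) : ℝ :=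
  if ∀ t, ∃ t', t' ≠ t ∧ w t' = w t then p ^ (Finset.univ.image w).card else 0

theorem wordBound_nonneg {p : ℝ} (hp : 0 ≤ p) (w : T → ι) : 0 ≤ wordBound p w := by
  unfold wordBound; split_ifs <;> positivity

theorem two_mul_card_image_le_of_repeated {w : T → ι}
    (h : ∀ t, ∃ t', t' ≠ t ∧ w t' = w t) :
    2 * (Finset.univ.image w).card ≤ Fintype.card T := by
  rw [mul_comm, ← Finset.card_univ (α := T), mul_comm]
  refine Finset.mul_card_image_le_card (s := (Finset.univ : Finset T)) (f := w) 2 ?_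
  intro a ha
  obtain ⟨t, -, rfl⟩ := Finset.mem_image.1 ha
  obtain ⟨t', h1, h2⟩ := h t
  exact Finset.one_lt_card.2 ⟨t', by simp [h2], t, by simp, h1⟩

/-- The number of maps with a given image size. -/
theorem card_filter_card_image_eq_le [DecidableEq T] [Fintype α] (m : ℕ) :
    (Finset.univ.filter fun u : T → α => (Finset.univ.image u).card = m).card ≤
      m ^ Fintype.card T * Fintype.card α ^ m := by
  have hsub : (Finset.univ.filter fun u : T → α => (Finset.univ.image u).card = m) ⊆
      (Finset.univ : Finset ((T → Fin m) × (Fin m → α))).image (fun q => q.2 ∘ q.1) := by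
    intro u hu
    have hu' : (Finset.univ.image u).card = m := by simpa using hu
    let φ := (Finset.univ.image u).equivFinOfCardEq hu'
    refine Finset.mem_image.2 ⟨(fun t => φ ⟨u t, by simp⟩, fun s => (φ.symm s : α)), by simp, ?_⟩
    ext t
    simp
  refine (Finset.card_le_card hsub).trans (Finset.card_image_le.trans ?_)
  simp

/-- At most m^|T| N^m maps have image of size m, so the weight N^(-m) leaves m^|T| for each of the
|T| + 1 possible sizes. The bound does not depend on N. -/
theorem sum_inv_pow_card_image_le [DecidableEq T] [Fintype α] :
    ∑ u : T → α, ((Fintype.card α : ℝ)⁻¹) ^ (Finset.univ.image u).card ≤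
      (Fintype.card T + 1) * (Fintype.card T : ℝ) ^ Fintype.card T := by
  have hm : ∀ u ∈ (Finset.univ : Finset (T → α)),
      (Finset.univ.image u).card ∈ Finset.range (Fintype.card T + 1) := by
    intro u _
    have := Finset.card_image_le (s := (Finset.univ : Finset T)) (f := u)
    simp at this ⊢
    omega
  rw [← Finset.sum_fiberwise_of_maps_to hm]
  have : ∀ m ∈ Finset.range (Fintype.card T + 1),
      ∑ u : T → α with (Finset.univ.image u).card = m,
        ((Fintype.card α : ℝ)⁻¹) ^ (Finset.univ.image u).card ≤
      (Fintype.card T : ℝ) ^ Fintype.card T := by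
    intro m hmr
    have h1 : ∑ u : T → α with (Finset.univ.image u).card = m,
        ((Fintype.card α : ℝ)⁻¹) ^ (Finset.univ.image u).card =
        (Finset.univ.filter fun u : T → α => (Finset.univ.image u).card = m).card *
          ((Fintype.card α : ℝ)⁻¹) ^ m := by
      rw [← nsmul_eq_mul, ← Finset.sum_const]
      refine Finset.sum_congr rfl fun u hu => ?_
      rw [(Finset.mem_filter.1 hu).2]
    rw [h1]
    have h2 : ((Finset.univ.filter fun u : T → α =>
        (Finset.univ.image u).card = m).card : ℝ) ≤
        (m : ℝ) ^ Fintype.card T * (Fintype.card α : ℝ) ^ m := by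
      exact_mod_cast card_filter_card_image_eq_le m
    have h3 : (Fintype.card α : ℝ) ^ m * ((Fintype.card α : ℝ)⁻¹) ^ m ≤ 1 := by
      rw [← mul_pow]
      exact pow_le_one₀ (by positivity) mul_inv_le_one
    have h4 : (m : ℝ) ≤ Fintype.card T := by
      have := Finset.mem_range.1 hmr
      exact_mod_cast (by omega : m ≤ Fintype.card T)
    calc _ ≤ (m : ℝ) ^ Fintype.card T * (Fintype.card α : ℝ) ^ m *
          ((Fintype.card α : ℝ)⁻¹) ^ m := by gcongr
      _ = (m : ℝ) ^ Fintype.card T *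
          ((Fintype.card α : ℝ) ^ m * ((Fintype.card α : ℝ)⁻¹) ^ m) := by ring
      _ ≤ (m : ℝ) ^ Fintype.card T * 1 := by gcongr
      _ ≤ _ := by rw [mul_one]; gcongr
  refine (Finset.sum_le_sum this).trans ?_
  simp

/-- Weighted counting: a sum over maps `u` of words `ℓ u` of length at most `2m`, all of whose
letters are repeated and which have at least as many letters as the image of `u` minus one. -/
theorem sum_wordBound_le [DecidableEq T] [Fintype α] [Nonempty α] {p : ℝ}
    (hNp : 1 ≤ Fintype.card α * p) (m : ℕ) (hT : Fintype.card T' ≤ 2 * m + 1)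
    (ℓ : (T → α) → T' → ι) (S : Finset (T → α))
    (hS : ∀ u ∈ S, (Finset.univ.image u).card ≤ (Finset.univ.image (ℓ u)).card + 1) :
    ∑ u ∈ S, wordBound p (ℓ u) ≤
      ((Fintype.card T + 1) * (Fintype.card T : ℝ) ^ Fintype.card T) *
        (Fintype.card α * (Fintype.card α * p) ^ m) := by
  set N : ℝ := (Fintype.card α : ℝ) with hN
  have hN1 : 1 ≤ N := by
    rw [hN]; exact_mod_cast Fintype.card_pos
  have key : ∀ u ∈ S, wordBound p (ℓ u) ≤
      N * (N * p) ^ m * N⁻¹ ^ (Finset.univ.image u).card := by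
    intro u hu
    unfold wordBound
    split_ifs with h
    · have h1 := two_mul_card_image_le_of_repeated h
      have h2 := hS u hu
      set e := (Finset.univ.image (ℓ u)).card
      set v := (Finset.univ.image u).card
      -- Repetition gives e ≤ m, and `hS` gives v ≤ e + 1. The exponents can be moved to m and v
      -- because N p ≥ 1 and 1/N ≤ 1; the spare factor N pays for the one extra vertex.
      calc p ^ e = N * (N * p) ^ e * N⁻¹ ^ (e + 1) := by
            rw [mul_pow, inv_pow, pow_succ]; field_simp
        _ ≤ N * (N * p) ^ m * N⁻¹ ^ v := by
            gcongr N * ?_ * ?_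
            · exact pow_le_pow_right₀ hNp (by omega)
            · exact pow_le_pow_of_le_one (by positivity) (inv_le_one_of_one_le₀ hN1) h2
    · positivity
  calc _ ≤ ∑ u ∈ S, N * (N * p) ^ m * N⁻¹ ^ (Finset.univ.image u).card := Finset.sum_le_sum key
    _ ≤ ∑ u : T → α, N * (N * p) ^ m * N⁻¹ ^ (Finset.univ.image u).card :=
        Finset.sum_le_sum_of_subset_of_nonneg (Finset.subset_univ _)
          (fun _ _ _ => by positivity)
    _ = N * (N * p) ^ m * ∑ u : T → α, N⁻¹ ^ (Finset.univ.image u).card := by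
        rw [Finset.mul_sum]
    _ ≤ N * (N * p) ^ m * ((Fintype.card T + 1) * (Fintype.card T : ℝ) ^ Fintype.card T) := by
        gcongr
        exact sum_inv_pow_card_image_le
    _ = _ := by ring

end Words

/-! ### Vertices against distinct edges in connected unions of paths. -/

section Paths

variable {α : Type*} [DecidableEq α]

/-- The edges of the path `w`. -/
def pathEdge {n : ℕ} (w : Fin (n + 1) → α) (t : Fin n) : Sym2 α :=
  s(w t.castSucc, w t.succ)

/-- A finite vertex set and an edge set on it, with at most one vertex more than edges. -/
def TreeLike (V : Finset α) (E : Finset (Sym2 α)) : Prop :=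
  V.card ≤ E.card + 1 ∧ ∀ e ∈ E, ∀ x ∈ e, x ∈ V

/-- A new vertex forces a new edge: all edges in `E` have both ends in `V`, so none of them contains
`y`. -/
theorem TreeLike.insert_edge {V : Finset α} {E : Finset (Sym2 α)} (h : TreeLike V E) {x y : α}
    (hx : x ∈ V) : TreeLike (insert y V) (insert s(x, y) E) := by
  refine ⟨?_, ?_⟩
  · by_cases hy : y ∈ V
    · rw [Finset.insert_eq_of_mem hy]
      exact h.1.trans (by gcongr; exact Finset.subset_insert _ _)
    · have : s(x, y) ∉ E := fun hE => hy (h.2 _ hE y (by simp))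
      rw [Finset.card_insert_of_notMem hy, Finset.card_insert_of_notMem this]
      have := h.1
      omega
  · intro e he z hz
    rcases Finset.mem_insert.1 he with rfl | he
    · rcases Sym2.mem_iff.1 hz with rfl | rfl <;> simp [hx]
    · exact Finset.mem_insert_of_mem (h.2 e he z hz)

omit [DecidableEq α] in
theorem treeLike_singleton (x : α) : TreeLike {x} (∅ : Finset (Sym2 α)) := by
  constructor <;> simp

/-- Adding a path that meets the vertex set. -/
theorem TreeLike.union_path {n : ℕ} {V : Finset α} {E : Finset (Sym2 α)}
    (h : TreeLike V E) (w : Fin (n + 1) → α) (s : Fin (n + 1)) (hs : w s ∈ V) :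
    TreeLike (V ∪ Finset.univ.image w) (E ∪ Finset.univ.image (pathEdge w)) := by
  -- Growth along the path to the right of the meeting point `s`: m + 1 vertices but only m edges,
  -- hence the strict inequality for edges.
  have fwd : ∀ m : ℕ, TreeLike
      (V ∪ (Finset.univ.filter fun t : Fin (n + 1) => (s : ℕ) ≤ t ∧ (t : ℕ) ≤ s + m).image w)
      (E ∪ (Finset.univ.filter fun t : Fin n => (s : ℕ) ≤ t ∧ (t : ℕ) < s + m).image
        (pathEdge w)) := by
    intro m
    induction m with
    | zero =>
      have hF : (Finset.univ.filter fun t : Fin (n + 1) => (s : ℕ) ≤ t ∧ (t : ℕ) ≤ s + 0) =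
          {s} := by
        ext x
        simp [Fin.ext_iff]
        omega
      have hG : (Finset.univ.filter fun t : Fin n => (s : ℕ) ≤ t ∧ (t : ℕ) < s + 0) = ∅ := by
        ext x
        simp
      rw [hF, hG]
      simpa [hs] using h
    | succ m ih =>
      by_cases hm : (s : ℕ) + m < n
      · have hF : (Finset.univ.filter fun t : Fin (n + 1) =>
            (s : ℕ) ≤ t ∧ (t : ℕ) ≤ s + (m + 1)) =
            insert (Fin.succ ⟨s + m, hm⟩) (Finset.univ.filter fun t : Fin (n + 1) =>
              (s : ℕ) ≤ t ∧ (t : ℕ) ≤ s + m) := by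
          ext x
          simp [Fin.ext_iff]
          omega
        have hG : (Finset.univ.filter fun t : Fin n => (s : ℕ) ≤ t ∧ (t : ℕ) < s + (m + 1)) =
            insert ⟨s + m, hm⟩ (Finset.univ.filter fun t : Fin n =>
              (s : ℕ) ≤ t ∧ (t : ℕ) < s + m) := by
          ext x
          simp [Fin.ext_iff]
          omega
        rw [hF, hG, Finset.image_insert, Finset.image_insert, Finset.union_insert,
          Finset.union_insert]
        refine ih.insert_edge (x := w (Fin.castSucc ⟨s + m, hm⟩)) ?_
        refine Finset.mem_union_right _ (Finset.mem_image_of_mem _ ?_)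
        refine Finset.mem_filter.2 ⟨Finset.mem_univ _, ?_, ?_⟩ <;> simp only [Fin.val_castSucc] <;>
          omega
      · have hF : (Finset.univ.filter fun t : Fin (n + 1) =>
            (s : ℕ) ≤ t ∧ (t : ℕ) ≤ s + (m + 1)) =
            Finset.univ.filter fun t : Fin (n + 1) => (s : ℕ) ≤ t ∧ (t : ℕ) ≤ s + m := by
          ext x
          simp
          omega
        have hG : (Finset.univ.filter fun t : Fin n => (s : ℕ) ≤ t ∧ (t : ℕ) < s + (m + 1)) =
            Finset.univ.filter fun t : Fin n => (s : ℕ) ≤ t ∧ (t : ℕ) < s + m := by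
          ext x
          simp
          omega
        rwa [hF, hG]
  -- Growth to the left of `s`, starting from the completed right part; each edge is now traversed
  -- backwards.
  have bwd : ∀ m : ℕ, TreeLike
      (V ∪ (Finset.univ.filter fun t : Fin (n + 1) => (s : ℕ) ≤ t + m).image w)
      (E ∪ (Finset.univ.filter fun t : Fin n => (s : ℕ) ≤ t + m).image (pathEdge w)) := by
    intro m
    induction m with
    | zero =>
      have hF : (Finset.univ.filter fun t : Fin (n + 1) => (s : ℕ) ≤ t + 0) =
          Finset.univ.filter fun t : Fin (n + 1) => (s : ℕ) ≤ t ∧ (t : ℕ) ≤ s + n := by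
        ext x
        simp
        omega
      have hG : (Finset.univ.filter fun t : Fin n => (s : ℕ) ≤ t + 0) =
          Finset.univ.filter fun t : Fin n => (s : ℕ) ≤ t ∧ (t : ℕ) < s + n := by
        ext x
        simp
        omega
      rw [hF, hG]
      exact fwd n
    | succ m ih =>
      by_cases hm : m + 1 ≤ (s : ℕ)
      · have hlt : (s : ℕ) - (m + 1) < n := by omega
        have hF : (Finset.univ.filter fun t : Fin (n + 1) => (s : ℕ) ≤ t + (m + 1)) =
            insert (Fin.castSucc ⟨s - (m + 1), hlt⟩)
              (Finset.univ.filter fun t : Fin (n + 1) => (s : ℕ) ≤ t + m) := by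
          ext x
          simp [Fin.ext_iff]
          omega
        have hG : (Finset.univ.filter fun t : Fin n => (s : ℕ) ≤ t + (m + 1)) =
            insert ⟨s - (m + 1), hlt⟩
              (Finset.univ.filter fun t : Fin n => (s : ℕ) ≤ t + m) := by
          ext x
          simp [Fin.ext_iff]
          omega
        rw [hF, hG, Finset.image_insert, Finset.image_insert, Finset.union_insert,
          Finset.union_insert, pathEdge, Sym2.eq_swap]
        refine ih.insert_edge (x := w (Fin.succ ⟨s - (m + 1), hlt⟩)) ?_
        refine Finset.mem_union_right _ (Finset.mem_image_of_mem _ ?_)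
        simp
        omega
      · have hF : (Finset.univ.filter fun t : Fin (n + 1) => (s : ℕ) ≤ t + (m + 1)) =
            Finset.univ.filter fun t : Fin (n + 1) => (s : ℕ) ≤ t + m := by
          ext x
          simp
          omega
        have hG : (Finset.univ.filter fun t : Fin n => (s : ℕ) ≤ t + (m + 1)) =
            Finset.univ.filter fun t : Fin n => (s : ℕ) ≤ t + m := by
          ext x
          simp
          omega
        rwa [hF, hG]
  convert bwd n using 3
  · symm
    rw [Finset.filter_eq_self]
    intro x _
    omega
  · symm
    rw [Finset.filter_eq_self]
    intro x _
    omega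

theorem treeLike_path {n : ℕ} (w : Fin (n + 1) → α) :
    TreeLike (Finset.univ.image w) (Finset.univ.image (pathEdge w)) := by
  have := (treeLike_singleton (w 0)).union_path w 0 (by simp)
  rwa [Finset.empty_union, Finset.union_eq_right.2] at this
  simp

/-- An end of the shared edge lies on both paths, so the second path can be grown out of the first.
-/
theorem treeLike_two_paths {n : ℕ} (u : Fin (n + 1) ⊕ Fin (n + 1) → α)
    (h : ∃ t t', pathEdge (u ∘ Sum.inl) t = pathEdge (u ∘ Sum.inr) t') :
    TreeLike (Finset.univ.image u)
      (Finset.univ.image (Sum.elim (pathEdge (u ∘ Sum.inl)) (pathEdge (u ∘ Sum.inr)))) := by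
  obtain ⟨t, t', htt⟩ := h
  have hmem : (u ∘ Sum.inr) t'.castSucc ∈ Finset.univ.image (u ∘ Sum.inl) := by
    have h1 : (u ∘ Sum.inr) t'.castSucc ∈ pathEdge (u ∘ Sum.inl) t := by
      rw [htt]; simp [pathEdge]
    exact (treeLike_path (u ∘ Sum.inl)).2 _ (Finset.mem_image_of_mem _ (Finset.mem_univ _)) _ h1
  convert (treeLike_path (u ∘ Sum.inl)).union_path (u ∘ Sum.inr) _ hmem using 1
  · ext x; simp
  · ext x; simp

end Paths

/-! ### Expectations of products of independent centred variables. -/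

section Moments

variable {Ω : Type*} [MeasurableSpace Ω] {P : Measure Ω} [IsProbabilityMeasure P]
  {ι T T' : Type*} [Fintype ι] [DecidableEq ι] [Fintype T] [Fintype T']

/-- Independent centred random variables bounded by `1`, with variances at most `p`. -/
structure IsCenteredFamily (P : Measure Ω) (p : ℝ) (X : ι → Ω → ℝ) : Prop where
  indep : iIndepFun X P
  aemeasurable : ∀ q, AEMeasurable (X q) P
  mean : ∀ q, ∫ ω, X q ω ∂P = 0
  bound : ∀ q, ∀ᵐ ω ∂P, |X q ω| ≤ 1
  var : ∀ q, ∫ ω, X q ω ^ 2 ∂P ≤ p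

variable {p : ℝ} {X : ι → Ω → ℝ}

omit [Fintype ι] [DecidableEq ι] in
theorem IsCenteredFamily.integrable_prod (h : IsCenteredFamily P p X) (w : T → ι) :
    Integrable (fun ω => ∏ t, X (w t) ω) P := by
  refine Integrable.of_bound (C := 1)
    (Finset.aemeasurable_fun_prod _ fun t _ => h.aemeasurable _).aestronglyMeasurable ?_
  have : ∀ᵐ ω ∂P, ∀ t, |X (w t) ω| ≤ 1 := ae_all_iff.2 fun t => h.bound _
  filter_upwards [this] with ω hω
  rw [Real.norm_eq_abs, Finset.abs_prod]
  exact Finset.prod_le_one (fun _ _ => abs_nonneg _) fun t _ => hω t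

omit [Fintype ι] [DecidableEq ι] in
theorem IsCenteredFamily.abs_integral_pow_le (h : IsCenteredFamily P p X) (q : ι) {n : ℕ}
    (hn : 2 ≤ n) : |∫ ω, X q ω ^ n ∂P| ≤ p := by
  have hint : Integrable (fun ω => X q ω ^ 2) P := by
    simpa using h.integrable_prod (fun _ : Fin 2 => q)
  rw [← Real.norm_eq_abs]
  refine (norm_integral_le_of_norm_le (f := fun ω => X q ω ^ n) hint ?_).trans (h.var q)
  filter_upwards [h.bound q] with ω hω
  rw [Real.norm_eq_abs, abs_pow, ← sq_abs (X q ω)]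
  exact pow_le_pow_of_le_one (abs_nonneg _) hω hn

omit [IsProbabilityMeasure P] in
theorem IsCenteredFamily.integral_prod_eq (h : IsCenteredFamily P p X) (w : T → ι) :
    ∫ ω, ∏ t, X (w t) ω ∂P =
      ∏ q, ∫ ω, X q ω ^ (Finset.univ.filter fun t => w t = q).card ∂P := by
  have : ∀ ω, ∏ t, X (w t) ω = ∏ q, X q ω ^ (Finset.univ.filter fun t => w t = q).card := by
    intro ω
    rw [← Finset.prod_fiberwise Finset.univ w]
    refine Finset.prod_congr rfl fun q _ => ?_
    rw [← Finset.prod_const]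
    refine Finset.prod_congr rfl fun t ht => ?_
    rw [(Finset.mem_filter.1 ht).2]
  simp_rw [this]
  exact h.indep.integral_fun_prod_comp
    (f := fun q x => x ^ (Finset.univ.filter fun t => w t = q).card) h.aemeasurable
    (fun q => (continuous_pow _).aestronglyMeasurable)

/-- By independence the expectation factors over distinct letters. A letter occurring once
contributes its mean 0; one occurring at least twice contributes at most p, since |X| ≤ 1 allows
comparison with X². -/
theorem IsCenteredFamily.abs_integral_prod_le (h : IsCenteredFamily P p X) (w : T → ι) :
    |∫ ω, ∏ t, X (w t) ω ∂P| ≤ wordBound p w := by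
  classical
  rw [h.integral_prod_eq]
  unfold wordBound
  split_ifs with hw
  · rw [Finset.abs_prod, ← Finset.prod_const, ← Finset.prod_subset (Finset.subset_univ _)]
    · refine Finset.prod_le_prod (fun _ _ => abs_nonneg _) fun q hq => ?_
      obtain ⟨t, -, rfl⟩ := Finset.mem_image.1 hq
      obtain ⟨t', h1, h2⟩ := hw t
      exact h.abs_integral_pow_le _
        (Finset.one_lt_card.2 ⟨t', by simp [h2], t, by simp, h1⟩)
    · intro q _ hq
      have : (Finset.univ.filter fun t => w t = q) = ∅ := by
        ext t
        simp only [Finset.mem_filter, Finset.mem_univ, true_and, Finset.notMem_empty, iff_false]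
        exact fun ht => hq (Finset.mem_image.2 ⟨t, Finset.mem_univ _, ht⟩)
      simp [this]
  · push Not at hw
    obtain ⟨t, ht⟩ := hw
    have hone : (Finset.univ.filter fun t' => w t' = w t) = {t} := by
      ext t'
      simp only [Finset.mem_filter, Finset.mem_univ, true_and, Finset.mem_singleton]
      exact ⟨fun h1 => by_contra fun h2 => ht t' h2 h1, fun h1 => by rw [h1]⟩
    rw [Finset.prod_eq_zero (Finset.mem_univ (w t))]
    · simp
    · rw [hone]
      simpa using h.mean (w t)

-- The concatenation has at most as many distinct letters as the two words together, and p ≤ 1. This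
-- lets a covariance be bounded by the joint word alone.
omit [Fintype ι] in
theorem wordBound_mul_le (hp : 0 ≤ p) (hp1 : p ≤ 1) (w : T → ι) (w' : T' → ι) :
    wordBound p w * wordBound p w' ≤ wordBound p (Sum.elim w w') := by
  by_cases hw : ∀ t, ∃ t', t' ≠ t ∧ w t' = w t
  · by_cases hw' : ∀ t, ∃ t', t' ≠ t ∧ w' t' = w' t
    · have hs : ∀ t, ∃ t', t' ≠ t ∧ Sum.elim w w' t' = Sum.elim w w' t := by
        rintro (t | t)
        · obtain ⟨t', h1, h2⟩ := hw t
          exact ⟨Sum.inl t', by simpa using h1, by simpa using h2⟩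
        · obtain ⟨t', h1, h2⟩ := hw' t
          exact ⟨Sum.inr t', by simpa using h1, by simpa using h2⟩
      rw [wordBound, wordBound, wordBound, if_pos hw, if_pos hw', if_pos hs, ← pow_add]
      refine pow_le_pow_of_le_one hp hp1 ?_
      have : Finset.univ.image (Sum.elim w w') = Finset.univ.image w ∪ Finset.univ.image w' := by
        ext x; simp
      rw [this]
      exact Finset.card_union_le _ _
    · rw [wordBound, wordBound, if_neg hw', mul_zero]
      exact wordBound_nonneg hp _
  · rw [wordBound, if_neg hw, zero_mul]
    exact wordBound_nonneg hp _

theorem IsCenteredFamily.abs_cov_le (h : IsCenteredFamily P p X) (hp : 0 ≤ p) (hp1 : p ≤ 1)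
    (w : T → ι) (w' : T' → ι) :
    |∫ ω, (∏ t, X (w t) ω) * ∏ t, X (w' t) ω ∂P -
        (∫ ω, ∏ t, X (w t) ω ∂P) * ∫ ω, ∏ t, X (w' t) ω ∂P| ≤
      2 * wordBound p (Sum.elim w w') := by
  have hsum : ∀ ω, (∏ t, X (w t) ω) * ∏ t, X (w' t) ω = ∏ t, X (Sum.elim w w' t) ω := by
    intro ω
    rw [Fintype.prod_sum_type]
    rfl
  simp_rw [hsum]
  have h1 := h.abs_integral_prod_le (Sum.elim w w')
  have h2 : |(∫ ω, ∏ t, X (w t) ω ∂P) * ∫ ω, ∏ t, X (w' t) ω ∂P| ≤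
      wordBound p (Sum.elim w w') := by
    rw [abs_mul]
    exact (mul_le_mul (h.abs_integral_prod_le w) (h.abs_integral_prod_le w') (abs_nonneg _)
      (wordBound_nonneg hp _)).trans (wordBound_mul_le hp hp1 w w')
  exact (norm_sub_le (_ : ℝ) _).trans (by rw [Real.norm_eq_abs, Real.norm_eq_abs]; linarith)

theorem IsCenteredFamily.integral_mul_eq (h : IsCenteredFamily P p X)
    (w : T → ι) (w' : T' → ι) (hd : ∀ t t', w t ≠ w' t') :
    ∫ ω, (∏ t, X (w t) ω) * ∏ t, X (w' t) ω ∂P =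
        (∫ ω, ∏ t, X (w t) ω ∂P) * ∫ ω, ∏ t, X (w' t) ω ∂P := by
  have hsum : ∀ ω, (∏ t, X (w t) ω) * ∏ t, X (w' t) ω = ∏ t, X (Sum.elim w w' t) ω := by
    intro ω
    rw [Fintype.prod_sum_type]
    rfl
  simp_rw [hsum]
  rw [h.integral_prod_eq, h.integral_prod_eq, h.integral_prod_eq, ← Finset.prod_mul_distrib]
  refine Finset.prod_congr rfl fun q _ => ?_
  have hcard : (Finset.univ.filter fun t => Sum.elim w w' t = q).card =
      (Finset.univ.filter fun t => w t = q).card +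
        (Finset.univ.filter fun t => w' t = q).card := by
    simp only [Finset.card_filter, Fintype.sum_sum_type, Sum.elim_inl, Sum.elim_inr]
    rfl
  rw [hcard]
  by_cases hq : ∃ t, w t = q
  · obtain ⟨t, rfl⟩ := hq
    have : (Finset.univ.filter fun t' => w' t' = w t) = ∅ := by
      ext t'
      simpa using (hd t t').symm
    simp [this]
  · push Not at hq
    have : (Finset.univ.filter fun t => w t = q) = ∅ := by
      ext t
      simpa using hq t
    simp [this]

end Moments

/-! ### Mean and variance of path sums. -/

section PathSums

variable {Ω : Type*} [MeasurableSpace Ω] {P : Measure Ω} [IsProbabilityMeasure P]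
  {α : Type*} [Fintype α] [DecidableEq α] [Nonempty α] {p : ℝ} {X : Sym2 α → Ω → ℝ}

/-- The sum over all paths with `n` steps, weighted by `c`, of the product of the variables
attached to the edges. -/
noncomputable def pathSum {n : ℕ} (X : Sym2 α → Ω → ℝ) (c : (Fin (n + 1) → α) → ℝ) (ω : Ω) : ℝ :=
  ∑ w, c w * ∏ t, X (pathEdge w t) ω

omit [Nonempty α] [DecidableEq α] in
theorem integrable_pathSum (h : IsCenteredFamily P p X) {n : ℕ}
    (c : (Fin (n + 1) → α) → ℝ) : Integrable (pathSum X c) P :=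
  integrable_finsetSum _ fun _ _ => (h.integrable_prod _).const_mul _

omit [Nonempty α] [DecidableEq α] in
theorem integral_pathSum (h : IsCenteredFamily P p X) {n : ℕ}
    (c : (Fin (n + 1) → α) → ℝ) :
    ∫ ω, pathSum X c ω ∂P = ∑ w, c w * ∫ ω, ∏ t, X (pathEdge w t) ω ∂P := by
  unfold pathSum
  rw [integral_finsetSum _ fun _ _ => (h.integrable_prod _).const_mul _]
  simp_rw [integral_const_mul]

/-- The constants in the moment bounds for path sums. -/
noncomputable def pathConst (n : ℕ) : ℝ := (n + 1) * (n : ℝ) ^ n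

theorem pathConst_nonneg (n : ℕ) : 0 ≤ pathConst n := by unfold pathConst; positivity

/-- Contributing paths have at most n/2 distinct edges, hence at most n/2 + 1 vertices. This gives
N^(n/2 + 1) choices of weight p^(n/2). -/
theorem abs_integral_pathSum_le (h : IsCenteredFamily P p X)
    (hNp : 1 ≤ Fintype.card α * p) {n : ℕ} (c : (Fin (n + 1) → α) → ℝ) {B : ℝ}
    (hB : 0 ≤ B) (hc : ∀ w, |c w| ≤ B) :
    |∫ ω, pathSum X c ω ∂P| ≤
      B * (pathConst (n + 1) * (Fintype.card α * (Fintype.card α * p) ^ (n / 2))) := by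
  rw [integral_pathSum h]
  calc _ ≤ ∑ w, |c w * ∫ ω, ∏ t, X (pathEdge w t) ω ∂P| := Finset.abs_sum_le_sum_abs _ _
    _ ≤ ∑ w : Fin (n + 1) → α, B * wordBound p (pathEdge w) := by
        refine Finset.sum_le_sum fun w _ => ?_
        rw [abs_mul]
        exact mul_le_mul (hc w) (h.abs_integral_prod_le _) (abs_nonneg _) hB
    _ = B * ∑ w : Fin (n + 1) → α, wordBound p (pathEdge w) := by rw [Finset.mul_sum]
    _ ≤ _ := by
        gcongr
        have := sum_wordBound_le (T := Fin (n + 1)) hNp (n / 2)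
          (by simp; omega) (fun w : Fin (n + 1) → α => pathEdge w) Finset.univ
          (fun u _ => (treeLike_path u).1)
        simpa [pathConst] using this

/-- Paths without a common edge are uncorrelated. The remaining pairs form connected graphs with 2n
edge visits, hence at most n distinct edges and n + 1 vertices: connectedness saves a factor N over
the crude count. -/
theorem integral_sq_pathSum_sub_le (h : IsCenteredFamily P p X) (hp : 0 ≤ p) (hp1 : p ≤ 1)
    (hNp : 1 ≤ Fintype.card α * p) {n : ℕ} (c : (Fin (n + 1) → α) → ℝ) {B : ℝ}
    (hB : 0 ≤ B) (hc : ∀ w, |c w| ≤ B) :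
    ∫ ω, (pathSum X c ω - ∫ ω', pathSum X c ω' ∂P) ^ 2 ∂P ≤
      2 * B ^ 2 * (pathConst (2 * (n + 1)) *
        (Fintype.card α * (Fintype.card α * p) ^ n)) := by
  classical
  set m := fun w : Fin (n + 1) → α => ∫ ω, ∏ t, X (pathEdge w t) ω ∂P with hm
  have hmul : ∀ w w' : Fin (n + 1) → α, Integrable
      (fun ω => (∏ t, X (pathEdge w t) ω) * ∏ t, X (pathEdge w' t) ω) P := by
    intro w w'
    have := h.integrable_prod (Sum.elim (pathEdge w) (pathEdge w'))
    simpa [Fintype.prod_sum_type] using this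
  have h0 : ∀ w w' : Fin (n + 1) → α,
      ∫ ω, (c w * (∏ t, X (pathEdge w t) ω - m w)) *
        (c w' * (∏ t, X (pathEdge w' t) ω - m w')) ∂P =
      c w * c w' * (∫ ω, (∏ t, X (pathEdge w t) ω) * ∏ t, X (pathEdge w' t) ω ∂P -
        m w * m w') := by
    intro w w'
    have : ∀ ω, (c w * (∏ t, X (pathEdge w t) ω - m w)) *
        (c w' * (∏ t, X (pathEdge w' t) ω - m w')) =
        c w * c w' * ((∏ t, X (pathEdge w t) ω) * (∏ t, X (pathEdge w' t) ω) -
          m w' * (∏ t, X (pathEdge w t) ω) - m w * (∏ t, X (pathEdge w' t) ω) + m w * m w') := by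
      intro ω; ring
    simp_rw [this]
    rw [integral_const_mul, integral_add, integral_sub, integral_sub, integral_const_mul,
      integral_const_mul]
    · simp [hm]
      left
      ring
    · exact hmul w w'
    · exact (h.integrable_prod _).const_mul _
    · exact (hmul w w').sub ((h.integrable_prod _).const_mul _)
    · exact (h.integrable_prod _).const_mul _
    · exact ((hmul w w').sub ((h.integrable_prod _).const_mul _)).sub
        ((h.integrable_prod _).const_mul _)
    · exact integrable_const _
  have h1 : ∫ ω, (pathSum X c ω - ∫ ω', pathSum X c ω' ∂P) ^ 2 ∂P =
      ∑ w, ∑ w', c w * c w' *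
        (∫ ω, (∏ t, X (pathEdge w t) ω) * ∏ t, X (pathEdge w' t) ω ∂P - m w * m w') := by
    rw [integral_pathSum h]
    have : ∀ ω, (pathSum X c ω - ∑ w, c w * m w) ^ 2 =
        ∑ w, ∑ w', (c w * (∏ t, X (pathEdge w t) ω - m w)) *
          (c w' * (∏ t, X (pathEdge w' t) ω - m w')) := by
      intro ω
      rw [← Finset.sum_mul_sum, ← sq]
      simp only [mul_sub, Finset.sum_sub_distrib]
      rfl
    have hi : ∀ w w' : Fin (n + 1) → α, Integrable
        (fun ω => (c w * (∏ t, X (pathEdge w t) ω - m w)) *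
          (c w' * (∏ t, X (pathEdge w' t) ω - m w'))) P := by
      intro w w'
      have : ∀ ω, (c w * (∏ t, X (pathEdge w t) ω - m w)) *
        (c w' * (∏ t, X (pathEdge w' t) ω - m w')) =
        c w * c w' * ((∏ t, X (pathEdge w t) ω) * (∏ t, X (pathEdge w' t) ω) -
          m w' * (∏ t, X (pathEdge w t) ω) - m w * (∏ t, X (pathEdge w' t) ω) + m w * m w') := by
        intro ω; ring
      simp_rw [this]
      exact ((((hmul w w').sub ((h.integrable_prod _).const_mul _)).sub
        ((h.integrable_prod _).const_mul _)).add (integrable_const _)).const_mul _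
    simp_rw [hm] at this ⊢
    simp_rw [this]
    rw [integral_finsetSum _ fun w _ => integrable_finsetSum _ fun w' _ => hi w w']
    refine Finset.sum_congr rfl fun w _ => ?_
    rw [integral_finsetSum _ fun w' _ => hi w w']
    exact Finset.sum_congr rfl fun w' _ => h0 w w'
  rw [h1]
  -- Only pairs of paths sharing an edge have a non-zero covariance.
  set S : Finset (Fin (n + 1) ⊕ Fin (n + 1) → α) := Finset.univ.filter fun u =>
    ∃ t t', pathEdge (u ∘ Sum.inl) t = pathEdge (u ∘ Sum.inr) t' with hSdef
  have h2 : ∀ w w' : Fin (n + 1) → α, c w * c w' *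
        (∫ ω, (∏ t, X (pathEdge w t) ω) * ∏ t, X (pathEdge w' t) ω ∂P - m w * m w') ≤
      if Sum.elim w w' ∈ S then
        2 * B ^ 2 * wordBound p (Sum.elim (pathEdge w) (pathEdge w')) else 0 := by
    intro w w'
    split_ifs with hS
    · refine (le_abs_self _).trans ?_
      rw [abs_mul, abs_mul]
      have := h.abs_cov_le hp hp1 (pathEdge w) (pathEdge w')
      calc _ ≤ B * B * (2 * wordBound p (Sum.elim (pathEdge w) (pathEdge w'))) := by
            gcongr
            · exact hc w
            · exact hc w'
        _ = _ := by ring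
    · have hd : ∀ t t', pathEdge w t ≠ pathEdge w' t' := by
        intro t t' htt
        exact hS (Finset.mem_filter.2 ⟨Finset.mem_univ _, t, t', by simpa using htt⟩)
      rw [h.integral_mul_eq _ _ hd]
      simp [hm]
  have h3 := sum_wordBound_le (T := Fin (n + 1) ⊕ Fin (n + 1)) hNp n
    (by simp; omega) (fun u => Sum.elim (pathEdge (u ∘ Sum.inl)) (pathEdge (u ∘ Sum.inr))) S
    (fun u hu => (treeLike_two_paths u (Finset.mem_filter.1 hu).2).1)
  calc _ ≤ ∑ w, ∑ w', if Sum.elim w w' ∈ S then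
        2 * B ^ 2 * wordBound p (Sum.elim (pathEdge w) (pathEdge w')) else 0 :=
        Finset.sum_le_sum fun w _ => Finset.sum_le_sum fun w' _ => h2 w w'
    _ = ∑ u ∈ S, 2 * B ^ 2 *
          wordBound p (Sum.elim (pathEdge (u ∘ Sum.inl)) (pathEdge (u ∘ Sum.inr))) := by
        rw [← Fintype.sum_prod_type', ← (Equiv.sumArrowEquivProdArrow _ _ _).sum_comp,
          ← Finset.sum_filter]
        refine Finset.sum_congr ?_ fun u _ => rfl
        ext u
        simp [Equiv.sumArrowEquivProdArrow]
    _ = 2 * B ^ 2 * ∑ u ∈ S,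
          wordBound p (Sum.elim (pathEdge (u ∘ Sum.inl)) (pathEdge (u ∘ Sum.inr))) := by
        rw [Finset.mul_sum]
    _ ≤ _ := by
        gcongr
        refine h3.trans (le_of_eq ?_)
        have hcard : Fintype.card (Fin (n + 1) ⊕ Fin (n + 1)) = 2 * (n + 1) := by
          simp; ring
        rw [hcard, pathConst]

end PathSums

/-! ### Matrix powers as sums over paths. -/

section PathExpansion

variable {α : Type*} [Fintype α] [DecidableEq α]

/-- The induction generalises over `x`: writing x'M^(n+1)y = (x'M)M^n y absorbs the first vertex of
the path into the left vector. -/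
theorem dotProduct_pow_mulVec_eq_sum (M : Matrix α α ℝ) (n : ℕ) (x y : α → ℝ) :
    x ⬝ᵥ (M ^ n *ᵥ y) =
      ∑ w : Fin (n + 1) → α, x (w 0) * y (w (Fin.last n)) *
        ∏ t : Fin n, M (w t.castSucc) (w t.succ) := by
  induction n generalizing x with
  | zero =>
    rw [← (Equiv.funUnique (Fin 1) α).symm.sum_comp]
    simp [dotProduct]
  | succ n ih =>
    rw [pow_succ', ← mulVec_mulVec, dotProduct_mulVec, ih,
      ← (Fin.consEquiv (fun _ : Fin (n + 2) => α)).sum_comp, Fintype.sum_prod_type,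
      Finset.sum_comm]
    refine Finset.sum_congr rfl fun w _ => ?_
    simp only [vecMul, dotProduct, Finset.sum_mul]
    refine Finset.sum_congr rfl fun a _ => ?_
    rw [Fin.prod_univ_succ]
    simp [Fin.consEquiv, ← Fin.succ_last]
    ring

theorem trace_pow_eq_sum (M : Matrix α α ℝ) (n : ℕ) :
    (M ^ n).trace = ∑ w : Fin (n + 1) → α, (if w 0 = w (Fin.last n) then 1 else 0) *
        ∏ t : Fin n, M (w t.castSucc) (w t.succ) := by
  have h : (M ^ n).trace = ∑ a, Pi.single a (1 : ℝ) ⬝ᵥ (M ^ n *ᵥ Pi.single a 1) := by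
    simp [trace]
  simp_rw [h, dotProduct_pow_mulVec_eq_sum]
  rw [Finset.sum_comm]
  refine Finset.sum_congr rfl fun w _ => ?_
  rw [← Finset.sum_mul]
  congr 1
  simp [Pi.single_apply, eq_comm]

end PathExpansion

/-! ### Path sums for random symmetric matrices. -/

section SymmetricFamily

variable {Ω : Type*} {α : Type*} [Fintype α] [DecidableEq α]

/-- The random variables attached to unordered pairs by a random symmetric matrix. -/
def edgeVar [LinearOrder α] (W : Ω → Matrix α α ℝ) (s : Sym2 α) (ω : Ω) : ℝ := W ω s.inf s.sup

omit [Fintype α] [DecidableEq α] in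
theorem edgeVar_mk [LinearOrder α] {W : Ω → Matrix α α ℝ} {ω : Ω} (hW : (W ω).IsSymm) (a b : α) :
    edgeVar W s(a, b) ω = W ω a b := by
  rcases le_total a b with h | h
  · simp [edgeVar, h]
  · simp [edgeVar, h, hW.apply]

theorem dotProduct_pow_mulVec_eq_pathSum [LinearOrder α] {W : Ω → Matrix α α ℝ} {ω : Ω}
    (hW : (W ω).IsSymm) (n : ℕ) (x y : α → ℝ) :
    x ⬝ᵥ (W ω ^ n *ᵥ y) = pathSum (edgeVar W)
      (fun w : Fin (n + 1) → α => x (w 0) * y (w (Fin.last n))) ω := by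
  rw [dotProduct_pow_mulVec_eq_sum, pathSum]
  simp only [pathEdge, edgeVar_mk hW]

theorem trace_pow_eq_pathSum [LinearOrder α] {W : Ω → Matrix α α ℝ} {ω : Ω}
    (hW : (W ω).IsSymm) (n : ℕ) :
    (W ω ^ n).trace = pathSum (edgeVar W)
      (fun w : Fin (n + 1) → α => if w 0 = w (Fin.last n) then 1 else 0) ω := by
  rw [trace_pow_eq_sum, pathSum]
  simp only [pathEdge, edgeVar_mk hW]

end SymmetricFamily

/-! ### The centred adjacency matrix as a centred family. -/

section Adjacency

variable {Ω : Type*} [MeasurableSpace Ω] {P : Measure Ω} [IsProbabilityMeasure P]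
  {f : ℝ → ℝ → ℝ} {ε : ℝ} {N : ℕ} {A : Ω → Matrix (Fin N) (Fin N) ℝ}

omit [IsProbabilityMeasure P] in
theorem IsAdjacency.integral_eq (h : IsAdjacency P f ε A) {a b : Fin N} (hab : a ≤ b) :
    ∫ ω, A ω a b ∂P = ε * f (gridPoint N a) (gridPoint N b) := by
  obtain ⟨q, hq, hl⟩ := h.law a b hab
  rw [hl.integral_eq, integral_bernoulliMeasure (f := fun x => x), hq]
  simp

omit [IsProbabilityMeasure P] in
theorem IsAdjacency.centered_isSymm (h : IsAdjacency P f ε A) (ω : Ω) :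
    (centered P A ω).IsSymm := by
  ext a b
  have h1 : ∀ ω', A ω' b a = A ω' a b := fun ω' => (h.symm ω').apply a b
  simp [centered, h1]

omit [IsProbabilityMeasure P] in
/-- The centred entries of the adjacency matrix form a centred family. -/
theorem IsAdjacency.isCenteredFamily (h : IsAdjacency P f ε A) {p : ℝ}
    (hp : ∀ a b : Fin N, ε * f (gridPoint N a) (gridPoint N b) ≤ p) :
    IsCenteredFamily P p (edgeVar (centered P A)) := by
  have hval : ∀ s : Sym2 (Fin N), edgeVar (centered P A) s = fun ω =>
      A ω s.inf s.sup - ε * f (gridPoint N s.inf) (gridPoint N s.sup) := by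
    intro s
    ext ω
    simp [edgeVar, centered, h.integral_eq s.inf_le_sup]
  refine ⟨?_, ?_, ?_, ?_, ?_⟩
  -- Sorting identifies unordered pairs with entries on and above the diagonal, where independence
  -- is assumed.
  · have h1 := h.indep.precomp (Sym2.sortEquiv (α := Fin N)).injective
    have h2 := h1.comp (fun s x => x - ε * f (gridPoint N s.inf) (gridPoint N s.sup))
      (fun s => by fun_prop)
    convert h2 using 1
    ext s ω
    rw [hval s]
    simp
  · intro s
    obtain ⟨q, hq, hl⟩ := h.law _ _ s.inf_le_sup
    rw [hval s]
    exact hl.aemeasurable.sub_const _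
  · intro s
    obtain ⟨q, hq, hl⟩ := h.law _ _ s.inf_le_sup
    rw [hval s]
    have := hl.integral_comp (f := fun x => x - ε * f (gridPoint N s.inf) (gridPoint N s.sup))
      (by fun_prop)
    simp only [Function.comp_def] at this
    rw [this, integral_bernoulliMeasure, ← hq]
    simp only [smul_eq_mul]
    ring
  · intro s
    obtain ⟨q, hq, hl⟩ := h.law _ _ s.inf_le_sup
    rw [hval s]
    have hae : ∀ᵐ x ∂(bernoulliMeasure (1 : ℝ) 0 q), |x - (q : ℝ)| ≤ 1 := by
      have hms : MeasurableSet {x : ℝ | |x - (q : ℝ)| ≤ 1} :=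
        measurableSet_le (by fun_prop) measurable_const
      rw [ae_iff]
      have h0 := q.2.1
      have h1 := q.2.2
      rw [show {a : ℝ | ¬|a - (q : ℝ)| ≤ 1} = {x : ℝ | |x - (q : ℝ)| ≤ 1}ᶜ from rfl]
      refine bernoulliMeasure_apply_of_notMem_of_notMem q hms.compl ?_ ?_
      · simp [abs_le]; constructor <;> linarith
      · simp [abs_le]; constructor <;> linarith
    rw [← hl.map_eq] at hae
    have := ae_of_ae_map hl.aemeasurable hae
    rwa [hq] at this
  · intro s
    obtain ⟨q, hq, hl⟩ := h.law _ _ s.inf_le_sup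
    rw [hval s]
    have := hl.integral_comp
      (f := fun x => (x - ε * f (gridPoint N s.inf) (gridPoint N s.sup)) ^ 2)
      (by fun_prop)
    simp only [Function.comp_def] at this
    rw [this, integral_bernoulliMeasure, ← hq]
    have h2 := hp s.inf s.sup
    rw [← hq] at h2
    simp only [smul_eq_mul]
    -- The variance is q(1 - q) ≤ q ≤ p.
    have h0 := q.2.1
    have h1 := q.2.2
    nlinarith

end Adjacency

/-! ### The operator norm through the trace of the sixth power. -/

section Norm

variable {N : ℕ}

/-- The Euclidean norm of a vector. -/
noncomputable def l2 (x : Fin N → ℝ) : ℝ := ‖WithLp.toLp 2 x‖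

theorem l2_nonneg (x : Fin N → ℝ) : 0 ≤ l2 x := norm_nonneg _

theorem l2_sq (x : Fin N → ℝ) : l2 x ^ 2 = x ⬝ᵥ x := by
  rw [l2, EuclideanSpace.norm_sq_eq]
  simp [dotProduct, sq]

theorem abs_dotProduct_le (x y : Fin N → ℝ) : |x ⬝ᵥ y| ≤ l2 x * l2 y := by
  have := abs_real_inner_le_norm (WithLp.toLp 2 x) (WithLp.toLp 2 y)
  rwa [EuclideanSpace.inner_eq_star_dotProduct, star_trivial, dotProduct_comm] at this

theorem l2_add_le (x y : Fin N → ℝ) : l2 (x + y) ≤ l2 x + l2 y := norm_add_le _ _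

theorem l2_smul (c : ℝ) (x : Fin N → ℝ) : l2 (c • x) = |c| * l2 x :=
  norm_smul c (WithLp.toLp 2 x)

theorem l2_sum_le {J : Type*} (s : Finset J) (x : J → Fin N → ℝ) :
    l2 (∑ l ∈ s, x l) ≤ ∑ l ∈ s, l2 (x l) := by
  have := norm_sum_le s fun l => WithLp.toLp 2 (x l)
  rwa [← WithLp.toLp_sum] at this

theorem dotProduct_mulVec_comm {M : Matrix (Fin N) (Fin N) ℝ} (hM : M.IsSymm)
    (x y : Fin N → ℝ) : x ⬝ᵥ (M *ᵥ y) = (M *ᵥ x) ⬝ᵥ y := by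
  rw [dotProduct_mulVec, ← mulVec_transpose, hM.eq]

/-- The sixth moment of the spectrum bounds the operator norm. -/
theorem l2_mulVec_pow_six_le {M : Matrix (Fin N) (Fin N) ℝ} (hM : M.IsSymm) (x : Fin N → ℝ) :
    l2 (M *ᵥ x) ^ 6 ≤ (M ^ 6).trace * l2 x ^ 6 := by
  set a0 := l2 x
  set a1 := l2 (M *ᵥ x)
  set a2 := l2 (M *ᵥ (M *ᵥ x))
  set a3 := l2 (M ^ 3 *ᵥ x)
  have h0 : 0 ≤ a0 := l2_nonneg _
  have h1 : 0 ≤ a1 := l2_nonneg _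
  have h2 : 0 ≤ a2 := l2_nonneg _
  have h3 : 0 ≤ a3 := l2_nonneg _
  -- Cauchy–Schwarz and symmetry make m ↦ |M^m x| log-convex, so |Mx|³ ≤ |x|² |M³x|.
  have h11 : a1 ^ 2 ≤ a0 * a2 := by
    rw [l2_sq, ← dotProduct_mulVec_comm hM]
    exact (le_abs_self _).trans (abs_dotProduct_le _ _)
  have h22 : a2 ^ 2 ≤ a1 * a3 := by
    have hM3 : M ^ 3 *ᵥ x = M *ᵥ (M *ᵥ (M *ᵥ x)) := by
      simp only [mulVec_mulVec]; congr 1; noncomm_ring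
    rw [l2_sq, ← dotProduct_mulVec_comm hM]
    refine (le_abs_self _).trans ((abs_dotProduct_le _ _).trans ?_)
    rw [← hM3]
  -- tr M⁶ is the squared Hilbert–Schmidt norm of M³.
  have h33 : a3 ^ 2 ≤ (M ^ 6).trace * a0 ^ 2 := by
    rw [l2_sq, l2_sq]
    have htr : (M ^ 6).trace = ∑ a, ∑ b, (M ^ 3) a b ^ 2 := by
      have hs : (M ^ 3)ᵀ = M ^ 3 := by rw [transpose_pow, hM.eq]
      rw [show (6 : ℕ) = 3 + 3 from rfl, pow_add]
      have hs' : ∀ a b, (M ^ 3) b a = (M ^ 3) a b := fun a b => congrFun (congrFun hs a) b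
      simp only [trace, diag_apply, mul_apply, sq]
      exact Finset.sum_congr rfl fun a _ => Finset.sum_congr rfl fun b _ => by rw [hs' a b]
    rw [htr, Finset.sum_mul]
    simp only [dotProduct]
    refine Finset.sum_le_sum fun a _ => ?_
    have := Finset.sum_mul_sq_le_sq_mul_sq Finset.univ (fun b => (M ^ 3) a b) x
    simpa [mulVec, dotProduct, sq] using this
  have hc : a1 ^ 3 ≤ a0 ^ 2 * a3 := by
    rcases h1.eq_or_lt with h | h
    · rw [← h, zero_pow three_ne_zero]; positivity
    · have : a1 ^ 4 ≤ a0 ^ 2 * (a1 * a3) := by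
        calc a1 ^ 4 = (a1 ^ 2) ^ 2 := by ring
          _ ≤ (a0 * a2) ^ 2 := by gcongr
          _ = a0 ^ 2 * a2 ^ 2 := by ring
          _ ≤ _ := by gcongr
      refine le_of_mul_le_mul_left ?_ h
      linarith
  calc a1 ^ 6 = (a1 ^ 3) ^ 2 := by ring
    _ ≤ (a0 ^ 2 * a3) ^ 2 := by gcongr
    _ = a0 ^ 4 * a3 ^ 2 := by ring
    _ ≤ a0 ^ 4 * ((M ^ 6).trace * a0 ^ 2) := by gcongr
    _ = _ := by ring

end Norm

/-! ### Min-max bounds for ordered eigenvalues. -/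

section MinMax

variable {N : ℕ} {M : Matrix (Fin N) (Fin N) ℝ}

theorem eig_eq (hM : M.IsHermitian) {m : ℕ} (hm : m < N) :
    eig M m = hM.eigenvalues₀ ⟨m, by simpa using hm⟩ := by
  rw [eig, dif_pos ⟨hM, hm⟩]

theorem eig_anti (hM : M.IsHermitian) {m m' : ℕ} (h : m ≤ m') (hm : m' < N) :
    eig M m' ≤ eig M m := by
  rw [eig_eq hM hm, eig_eq hM (h.trans_lt hm)]
  exact hM.eigenvalues₀_antitone h

/-- An orthonormal eigenbasis ordered by decreasing eigenvalues. -/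
theorem exists_eigenbasis (hM : M.IsHermitian) :
    ∃ b : OrthonormalBasis (Fin N) ℝ (EuclideanSpace ℝ (Fin N)),
      ∀ q : Fin N, M *ᵥ (b q).ofLp = eig M q • (b q).ofLp := by
  let φ : Fin N ≃ Fin N := (Fintype.equivOfCardEq (Fintype.card_fin _)).symm.trans (finCongr (by simp))
  refine ⟨hM.eigenvectorBasis.reindex φ, fun q => ?_⟩
  rw [OrthonormalBasis.reindex_apply, hM.mulVec_eigenvectorBasis, eig_eq hM q.2]
  congr 1
  simp [IsHermitian.eigenvalues, φ, finCongr_symm, finCongr_apply, Fin.cast]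

theorem dotProduct_self_eq_sum (b : OrthonormalBasis (Fin N) ℝ (EuclideanSpace ℝ (Fin N)))
    (x : Fin N → ℝ) : x ⬝ᵥ x = ∑ q, ((b q).ofLp ⬝ᵥ x) ^ 2 := by
  rw [← l2_sq, l2, ← b.sum_sq_norm_inner_right]
  refine Finset.sum_congr rfl fun q _ => ?_
  rw [EuclideanSpace.inner_eq_star_dotProduct, star_trivial, dotProduct_comm, Real.norm_eq_abs,
    sq_abs]

theorem dotProduct_mulVec_eq_sum (hM : M.IsSymm)
    (b : OrthonormalBasis (Fin N) ℝ (EuclideanSpace ℝ (Fin N)))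
    (hb : ∀ q : Fin N, M *ᵥ (b q).ofLp = eig M q • (b q).ofLp)
    (x : Fin N → ℝ) : x ⬝ᵥ (M *ᵥ x) = ∑ q : Fin N, eig M q * ((b q).ofLp ⬝ᵥ x) ^ 2 := by
  have := b.sum_inner_mul_inner (WithLp.toLp 2 x) (WithLp.toLp 2 (M *ᵥ x))
  simp only [EuclideanSpace.inner_eq_star_dotProduct, star_trivial] at this
  rw [dotProduct_comm, ← this]
  refine Finset.sum_congr rfl fun q _ => ?_
  rw [dotProduct_comm (M *ᵥ x), dotProduct_mulVec_comm hM, hb, smul_dotProduct, smul_eq_mul]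
  ring

/-- One half of the min-max principle. -/
theorem le_eig {J : Type*} [Fintype J] (hM : M.IsSymm) {m : ℕ}
    (hJ : m < Fintype.card J) (T : (J → ℝ) →ₗ[ℝ] (Fin N → ℝ)) (hT : ∀ a, T a = 0 → a = 0) {c : ℝ}
    (hc : ∀ a, c * (T a ⬝ᵥ T a) ≤ T a ⬝ᵥ (M *ᵥ T a)) : c ≤ eig M m := by
  have hH : M.IsHermitian := by rw [IsHermitian, conjTranspose_eq_transpose_of_trivial]; exact hM
  obtain ⟨b, hb⟩ := exists_eigenbasis hH
  let S : (J → ℝ) →ₗ[ℝ] ({q : Fin N // (q : ℕ) < m} → ℝ) :=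
    LinearMap.pi fun q => (dotProductBilin ℝ ℝ (b q.1).ofLp).comp T
  have hcard : Fintype.card {q : Fin N // (q : ℕ) < m} ≤ m := by
    rw [Fintype.card_subtype]
    refine (Finset.card_le_card_of_injOn (t := Finset.range m) (fun q : Fin N => (q : ℕ))
      (by intro q; simp) (fun _ _ _ _ h => Fin.ext h)).trans (by simp)
  -- More than m parameters against orthogonality to the first m eigenvectors: some test vector sees
  -- only eigenvalues of index at least m.
  have hker : LinearMap.ker S ≠ ⊥ := by
    apply LinearMap.ker_ne_bot_of_finrank_lt
    simp only [Module.finrank_fintype_fun_eq_card]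
    omega
  obtain ⟨a, ha, ha0⟩ := (Submodule.ne_bot_iff _).1 hker
  have hS : ∀ q : Fin N, (q : ℕ) < m → (b q).ofLp ⬝ᵥ T a = 0 := by
    intro q hq
    exact congrFun (LinearMap.mem_ker.1 ha) ⟨q, hq⟩
  have h1 := hc a
  have hpos : 0 < T a ⬝ᵥ T a := by
    have := dotProduct_self_star_pos_iff.2 fun h => ha0 (hT a h)
    rwa [star_trivial] at this
  have h2 : T a ⬝ᵥ (M *ᵥ T a) ≤ eig M m * (T a ⬝ᵥ T a) := by
    rw [dotProduct_mulVec_eq_sum hM b hb, dotProduct_self_eq_sum b, Finset.mul_sum]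
    refine Finset.sum_le_sum fun q _ => ?_
    by_cases hq : (q : ℕ) < m
    · simp [hS q hq]
    · exact mul_le_mul_of_nonneg_right (eig_anti hH (by omega) q.2) (sq_nonneg _)
  exact le_of_mul_le_mul_right (h1.trans h2) hpos

/-- The other half of the min-max principle. -/
theorem eig_le {J : Type*} [Fintype J] (hM : M.IsSymm) {m : ℕ} (hm : m < N)
    (hJ : Fintype.card J ≤ m) (e : J → Fin N → ℝ) {c : ℝ}
    (hc : ∀ x, (∀ l, e l ⬝ᵥ x = 0) → x ⬝ᵥ (M *ᵥ x) ≤ c * (x ⬝ᵥ x)) : eig M m ≤ c := by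
  have hH : M.IsHermitian := by rw [IsHermitian, conjTranspose_eq_transpose_of_trivial]; exact hM
  obtain ⟨b, hb⟩ := exists_eigenbasis hH
  let S : (Fin N → ℝ) →ₗ[ℝ] (J ⊕ {q : Fin N // m < (q : ℕ)} → ℝ) :=
    LinearMap.pi (Sum.elim (fun l => dotProductBilin ℝ ℝ (e l))
      fun q => dotProductBilin ℝ ℝ (b q.1).ofLp)
  have hcard : Fintype.card {q : Fin N // m < (q : ℕ)} < N - m := by
    rw [Fintype.card_subtype]
    refine (Finset.card_le_card_of_injOn (t := Finset.Ioo m N) (fun q : Fin N => (q : ℕ))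
      (by intro q; simp) (fun _ _ _ _ h => Fin.ext h)).trans_lt ?_
    simp
    omega
  -- At most m constraints from `e`, plus N - m - 1 from the eigenvectors of index above m, leave a
  -- non-zero vector in dimension N.
  have hker : LinearMap.ker S ≠ ⊥ := by
    apply LinearMap.ker_ne_bot_of_finrank_lt
    simp only [Module.finrank_fintype_fun_eq_card, Fintype.card_sum, Fintype.card_fin]
    omega
  obtain ⟨x, hx, hx0⟩ := (Submodule.ne_bot_iff _).1 hker
  have hSe : ∀ l, e l ⬝ᵥ x = 0 := fun l => congrFun (LinearMap.mem_ker.1 hx) (Sum.inl l)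
  have hS : ∀ q : Fin N, m < (q : ℕ) → (b q).ofLp ⬝ᵥ x = 0 :=
    fun q hq => congrFun (LinearMap.mem_ker.1 hx) (Sum.inr ⟨q, hq⟩)
  have h1 := hc x hSe
  have hpos : 0 < x ⬝ᵥ x := by
    have := dotProduct_self_star_pos_iff.2 hx0
    rwa [star_trivial] at this
  have h2 : eig M m * (x ⬝ᵥ x) ≤ x ⬝ᵥ (M *ᵥ x) := by
    rw [dotProduct_mulVec_eq_sum hM b hb, dotProduct_self_eq_sum b, Finset.mul_sum]
    refine Finset.sum_le_sum fun q _ => ?_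
    by_cases hq : m < (q : ℕ)
    · simp [hS q hq]
    · exact mul_le_mul_of_nonneg_right (eig_anti hH (by omega) hm) (sq_nonneg _)
  exact le_of_mul_le_mul_right (h2.trans h1) hpos

/-- The ordered eigenvalues have eigenvectors. -/
theorem exists_eigenvector (hM : M.IsSymm) {m : ℕ} (hm : m < N) :
    ∃ v, M *ᵥ v = eig M m • v ∧ v ⬝ᵥ v = 1 := by
  have hH : M.IsHermitian := by rw [IsHermitian, conjTranspose_eq_transpose_of_trivial]; exact hM
  obtain ⟨b, hb⟩ := exists_eigenbasis hH
  refine ⟨_, hb ⟨m, hm⟩, ?_⟩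
  rw [← l2_sq, l2]
  simp

end MinMax

/-! ### Asymptotic algebra of the overlap equations. -/

section Asymptotic

variable {ι : Type*} {F : Filter ι} {f g h : ι → ℝ} {k : ℕ}

theorem isBigO_bdd_mul (hf : f =O[F] fun _ => (1 : ℝ)) (hg : g =O[F] h) :
    (fun c => f c * g c) =O[F] h := by
  simpa using hf.mul hg

theorem isBigO_mul_bdd (hf : f =O[F] h) (hg : g =O[F] fun _ => (1 : ℝ)) :
    (fun c => f c * g c) =O[F] h := by
  simpa using hf.mul hg

theorem isBigO_const_one (a : ℝ) : (fun _ : ι => a) =O[F] fun _ => (1 : ℝ) :=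
  isBigO_const_const a one_ne_zero F

theorem isBigO_weighted_sum (θ : Fin k → ℝ) (S : Finset (Fin k)) {u x : Fin k → ι → ℝ}
    (hux : ∀ l ∈ S, (fun c => u l c * x l c) =O[F] h) :
    (fun c => ∑ l ∈ S, θ l * u l c * x l c) =O[F] h := by
  refine IsBigO.fun_sum fun l hl => ?_
  simp only [mul_assoc]
  exact isBigO_bdd_mul (isBigO_const_one _) (hux l hl)

variable (θ : Fin k → ℝ) (i : Fin k) {s q d R1 : ι → ℝ} {u R2 R4 : Fin k → ι → ℝ}
  {w0 w1 w2 w3 : Fin k → Fin k → ι → ℝ}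

/-- The eigenvector equation after removing the diagonal part of the Gram matrix. -/
theorem one_sub_mul_eq {q u r : ℝ} {j : Fin k} {U w : Fin k → ℝ} (hu : U j = u)
    (h : u = q * ∑ l, θ l * U l * w l + r) :
    (1 - q * θ j) * u = q * ∑ l, θ l * U l * (w l - if j = l then 1 else 0) + r := by
  have h1 : ∑ l, θ l * U l * (w l - if j = l then 1 else 0) =
      ∑ l, θ l * U l * w l - θ j * u := by
    simp only [mul_sub, Finset.sum_sub_distrib, mul_ite, mul_one, mul_zero,
      Finset.sum_ite_eq, Finset.mem_univ, if_true, hu]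
  rw [h1]
  linear_combination h

/-- First order estimates for the overlaps. -/
theorem overlap_first_order (hq : q =O[F] fun _ => (1 : ℝ))
    (hd : d =O[F] s) (hu : ∀ l, u l =O[F] fun _ => (1 : ℝ))
    (hw0 : ∀ j l, (fun c => w0 j l c - if j = l then 1 else 0) =O[F] d)
    (hw1 : ∀ j l, w1 j l =O[F] fun _ => (1 : ℝ)) (hR2 : ∀ j, R2 j =O[F] s)
    (heq : ∀ j c, u j c = q c * ∑ l, θ l * u l c * w0 j l c +
      (s c * (q c * (q c * ∑ l, θ l * u l c * w1 j l c)) + R2 j c)) (j : Fin k) :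
    (fun c => (1 - q c * θ j) * u j c) =O[F] s := by
  have h1 : ∀ c, (1 - q c * θ j) * u j c =
      q c * ∑ l, θ l * u l c * (w0 j l c - if j = l then 1 else 0) +
      (s c * (q c * (q c * ∑ l, θ l * u l c * w1 j l c)) + R2 j c) :=
    fun c => one_sub_mul_eq θ rfl (heq j c)
  simp only [h1]
  refine IsBigO.add (isBigO_bdd_mul hq ?_) (IsBigO.add (isBigO_mul_bdd (isBigO_refl _ _) ?_) (hR2 j))
  · exact isBigO_weighted_sum θ _ fun l _ => isBigO_bdd_mul (hu l) ((hw0 j l).trans hd)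
  · refine isBigO_bdd_mul hq (isBigO_bdd_mul hq ?_)
    exact isBigO_weighted_sum θ _ fun l _ => isBigO_bdd_mul (hu l) (hw1 j l)

theorem overlap_off_diagonal {j : Fin k}
    (hj : (fun c => (1 - q c * θ j)⁻¹) =O[F] fun _ => (1 : ℝ)) (hj0 : ∀ c, 1 - q c * θ j ≠ 0)
    (h : (fun c => (1 - q c * θ j) * u j c) =O[F] s) : u j =O[F] s := by
  have : u j = fun c => (1 - q c * θ j)⁻¹ * ((1 - q c * θ j) * u j c) := by
    ext c
    have := hj0 c
    field_simp
  rw [this]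
  exact isBigO_bdd_mul hj h

/-- The squared overlap with the unperturbed eigenvector. -/
theorem overlap_sq (hs : s =O[F] fun _ => (1 : ℝ)) (hq : q =O[F] fun _ => (1 : ℝ))
    (hu : ∀ j, j ≠ i → u j =O[F] s) (hR1 : R1 =O[F] fun _ => (1 : ℝ))
    (heq : ∀ c, 1 = q c * ∑ l, θ l * u l c * u l c + s c * (q c * R1 c)) :
    (fun c => q c * θ i * (u i c * u i c) - 1) =O[F] s := by
  have h1 : ∀ c, q c * θ i * (u i c * u i c) - 1 =
      -(q c * ∑ l ∈ Finset.univ.erase i, θ l * u l c * u l c + s c * (q c * R1 c)) := by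
    intro c
    have h2 := Finset.add_sum_erase Finset.univ (fun l => θ l * u l c * u l c) (Finset.mem_univ i)
    have h3 := heq c
    rw [← h2] at h3
    linear_combination -h3
  simp only [h1]
  refine (IsBigO.add (isBigO_bdd_mul hq ?_)
    (isBigO_mul_bdd (isBigO_refl _ _) (isBigO_bdd_mul hq hR1))).neg_left
  exact isBigO_weighted_sum θ _ fun l hl =>
    isBigO_mul_bdd (hu l (Finset.ne_of_mem_erase hl)) ((hu l (Finset.ne_of_mem_erase hl)).trans hs)

/-- The second order expansion of the overlaps. -/
theorem overlap_second_order (hθi : θ i ≠ 0) {j : Fin k} (hθj : θ i - θ j ≠ 0) (hji : j ≠ i)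
    (hs : s =O[F] fun _ => (1 : ℝ)) (hq : q =O[F] fun _ => (1 : ℝ))
    (hu : ∀ j, j ≠ i → u j =O[F] s) (hui : ∀ c, 1 / 2 ≤ u i c)
    (hui1 : u i =O[F] fun _ => (1 : ℝ))
    (hqi : (fun c => (1 - q c * θ i) * u i c) =O[F] s)
    (husq : (fun c => q c * θ i * (u i c * u i c) - 1) =O[F] s)
    (hw0 : ∀ l, (fun c => w0 j l c - if j = l then 1 else 0) =O[F] d)
    (hw1 : ∀ l, w1 j l =O[F] fun _ => (1 : ℝ))
    (hw2 : ∀ l, w2 j l =O[F] fun _ => (1 : ℝ))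
    (hw3 : ∀ l, w3 j l =O[F] fun _ => (1 : ℝ)) (hR4 : R4 j =O[F] fun c => s c ^ 2)
    (hd0 : ∀ c, 0 ≤ d c)
    (heq : ∀ c, u j c = q c * ∑ l, θ l * u l c * w0 j l c +
      (s c * (q c ^ 2 * ∑ l, θ l * u l c * w1 j l c) +
       s c * (q c ^ 3 * ∑ l, θ l * u l c * w2 j l c) +
       s c ^ 2 * (q c ^ 4 * ∑ l, θ l * u l c * w3 j l c) + R4 j c)) :
    (fun c => u j c - 1 / (θ i - θ j) *
        (θ i * (q c * s c) * w1 j i c + s c * w2 j i c * (1 / θ i))) =O[F]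
      fun c => s c ^ 2 + d c := by
  have hs2 : (fun c => s c ^ 2) =O[F] fun c => s c ^ 2 + d c := by
    refine IsBigO.of_bound 1 (Eventually.of_forall fun c => ?_)
    have := hd0 c
    rw [one_mul, Real.norm_eq_abs, Real.norm_eq_abs, abs_of_nonneg (by positivity),
      abs_of_nonneg (by positivity)]
    linarith
  have hdd : d =O[F] fun c => s c ^ 2 + d c := by
    refine IsBigO.of_bound 1 (Eventually.of_forall fun c => ?_)
    have := hd0 c
    rw [one_mul, Real.norm_eq_abs, Real.norm_eq_abs, abs_of_nonneg (by positivity),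
      abs_of_nonneg (by positivity)]
    linarith [sq_nonneg (s c)]
  have hss : ∀ {f g : ι → ℝ}, f =O[F] s → g =O[F] s →
      (fun c => f c * g c) =O[F] fun c => s c ^ 2 + d c := by
    intro f g hf hg
    refine IsBigO.trans ?_ hs2
    simpa [sq] using hf.mul hg
  have hinv : (fun c => (u i c)⁻¹) =O[F] fun _ => (1 : ℝ) := by
    refine IsBigO.of_bound 2 (Eventually.of_forall fun c => ?_)
    have := hui c
    rw [Real.norm_eq_abs, abs_of_nonneg (by positivity)]
    simp
    rw [inv_le_comm₀ (by linarith) (by norm_num)]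
    linarith
  have hinv' : (fun c => (1 + u i c)⁻¹) =O[F] fun _ => (1 : ℝ) := by
    refine IsBigO.of_bound 1 (Eventually.of_forall fun c => ?_)
    have := hui c
    rw [Real.norm_eq_abs, abs_of_nonneg (by positivity)]
    simp
    exact inv_le_one_of_one_le₀ (by linarith)
  have hq1 : (fun c => 1 - q c * θ i) =O[F] s := by
    have : (fun c => 1 - q c * θ i) = fun c => (u i c)⁻¹ * ((1 - q c * θ i) * u i c) := by
      ext c
      have : u i c ≠ 0 := by linarith [hui c]
      field_simp
    rw [this]
    exact isBigO_bdd_mul hinv hqi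
  have hqt : (fun c => q c - 1 / θ i) =O[F] s := by
    have : (fun c => q c - 1 / θ i) = fun c => (-1 / θ i) * (1 - q c * θ i) := by
      ext c
      field_simp
      ring
    rw [this]
    exact isBigO_bdd_mul (isBigO_const_one _) hq1
  -- The lower bound on u_i fixes the sign, so u_i² = 1 + O(s) can be divided by 1 + u_i.
  have hu1 : (fun c => u i c - 1) =O[F] s := by
    have : (fun c => u i c - 1) = fun c => (1 + u i c)⁻¹ *
        ((q c * θ i * (u i c * u i c) - 1) + (1 - q c * θ i) * (u i c * u i c)) := by
      ext c
      have : 1 + u i c ≠ 0 := by linarith [hui c]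
      field_simp
      ring
    rw [this]
    exact isBigO_bdd_mul hinv' (husq.add (isBigO_mul_bdd hq1 (isBigO_bdd_mul hui1 hui1)))
  have hqu : (fun c => q c * θ i * u i c - 1) =O[F] s := by
    have : (fun c => q c * θ i * u i c - 1) = fun c => (u i c - 1) + -((1 - q c * θ i) * u i c) := by
      ext c
      ring
    rw [this]
    exact hu1.add hqi.neg_left
  have hqpow : ∀ n : ℕ, (fun c => q c ^ n) =O[F] fun _ => (1 : ℝ) := by
    intro n
    simpa using hq.pow n
  -- This is the coefficient of the W² term for l = i, where q may be replaced by 1/θ_i. In the W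
  -- term only q θ_i u_i is replaced by 1: one factor q stays and becomes the 1/λ of the final
  -- formula.
  have hcube : (fun c => q c ^ 3 * θ i * u i c - 1 / θ i ^ 2) =O[F] s := by
    have : (fun c => q c ^ 3 * θ i * u i c - 1 / θ i ^ 2) = fun c =>
        q c ^ 2 * (q c * θ i * u i c - 1) + (q c - 1 / θ i) * (q c + 1 / θ i) := by
      ext c
      field_simp
      ring
    rw [this]
    exact (isBigO_bdd_mul (hqpow 2) hqu).add
      (isBigO_mul_bdd hqt (hq.add (isBigO_const_one _)))
  set E1 : ι → ℝ := fun c => ∑ l ∈ Finset.univ.erase i, θ l * u l c * w1 j l c with hE1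
  set E2 : ι → ℝ := fun c => ∑ l ∈ Finset.univ.erase i, θ l * u l c * w2 j l c with hE2
  have hE1O : E1 =O[F] s := isBigO_weighted_sum θ _ fun l hl =>
    isBigO_mul_bdd (hu l (Finset.ne_of_mem_erase hl)) (hw1 l)
  have hE2O : E2 =O[F] s := isBigO_weighted_sum θ _ fun l hl =>
    isBigO_mul_bdd (hu l (Finset.ne_of_mem_erase hl)) (hw2 l)
  have hul : ∀ l, u l =O[F] fun _ => (1 : ℝ) := by
    intro l
    by_cases hl : l = i
    · rw [hl]; exact hui1
    · exact (hu l hl).trans hs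
  -- The terms with l = i of the W and W² sums give the main part; everything left over is a product
  -- of two O(s) factors, or O(d), or carries s² explicitly.
  have key : (fun c => u j c - 1 / (θ i - θ j) *
        (θ i * (q c * s c) * w1 j i c + s c * w2 j i c * (1 / θ i))) = fun c =>
      (θ i / (θ i - θ j)) * (θ j * ((q c - 1 / θ i) * u j c) +
        q c * ∑ l, θ l * u l c * (w0 j l c - if j = l then 1 else 0) +
        s c * (q c ^ 2 * E1 c) + s c * (q c * (w1 j i c * (q c * θ i * u i c - 1))) +
        s c * (q c ^ 3 * E2 c) + s c * (w2 j i c * (q c ^ 3 * θ i * u i c - 1 / θ i ^ 2)) +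
        s c ^ 2 * (q c ^ 4 * ∑ l, θ l * u l c * w3 j l c) + R4 j c) := by
    ext c
    have h1 := one_sub_mul_eq θ (U := fun l => u l c) (w := fun l => w0 j l c) rfl (heq c)
    have h2 := Finset.add_sum_erase Finset.univ (fun l => θ l * u l c * w1 j l c)
      (Finset.mem_univ i)
    have h3 := Finset.add_sum_erase Finset.univ (fun l => θ l * u l c * w2 j l c)
      (Finset.mem_univ i)
    rw [← h2, ← h3] at h1
    have h4 : (1 - θ j / θ i) * u j c = θ j * ((q c - 1 / θ i) * u j c) +
        (1 - q c * θ j) * u j c := by ring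
    rw [h1] at h4
    have h5 : u j c - 1 / (θ i - θ j) *
        (θ i * (q c * s c) * w1 j i c + s c * w2 j i c * (1 / θ i)) =
        (θ i / (θ i - θ j)) * ((1 - θ j / θ i) * u j c - q c * s c * w1 j i c -
          s c * w2 j i c * (1 / θ i ^ 2)) := by
      field_simp
      ring
    rw [h5, h4]
    simp only [hE1, hE2]
    congr 1
    ring
  rw [key]
  refine isBigO_bdd_mul (isBigO_const_one _) ?_
  have t1 := isBigO_bdd_mul (isBigO_const_one (F := F) (θ j)) (hss hqt (hu j hji))
  have t2 : (fun c => q c * ∑ l, θ l * u l c * (w0 j l c - if j = l then 1 else 0)) =O[F]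
      fun c => s c ^ 2 + d c :=
    isBigO_bdd_mul hq (isBigO_weighted_sum θ _ fun l _ =>
      isBigO_bdd_mul (hul l) ((hw0 l).trans hdd))
  have t3 := hss (isBigO_refl s F) (isBigO_bdd_mul (hqpow 2) hE1O)
  have t4 := hss (isBigO_refl s F) (isBigO_bdd_mul hq (isBigO_bdd_mul (hw1 i) hqu))
  have t5 := hss (isBigO_refl s F) (isBigO_bdd_mul (hqpow 3) hE2O)
  have t6 := hss (isBigO_refl s F) (isBigO_bdd_mul (hw2 i) hcube)
  have t7 : (fun c => s c ^ 2 * (q c ^ 4 * ∑ l, θ l * u l c * w3 j l c)) =O[F]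
      fun c => s c ^ 2 + d c :=
    isBigO_mul_bdd hs2 (isBigO_bdd_mul (hqpow 4) (isBigO_weighted_sum θ _ fun l _ =>
      isBigO_bdd_mul (hul l) (hw3 l)))
  exact ((((((t1.add t2).add t3).add t4).add t5).add t6).add t7).add (hR4.trans hs2)

end Asymptotic

/-! ### Localization of the eigenvalue of a finite rank matrix plus noise. -/

section Config

variable {k : ℕ} {θ : Fin k → ℝ} {i : Fin k} {γ K : ℝ}

/-- Parameters of a finite rank matrix and conditions on a spectral gap. -/
structure IsGap (θ : Fin k → ℝ) (i : Fin k) (γ K : ℝ) : Prop where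
  pos : ∀ l, 0 < θ l
  anti : Antitone θ
  gap_pos : 0 < γ
  gap_le : γ ≤ θ i
  gap : ∀ j, j ≠ i → γ ≤ |θ i - θ j|
  one_le : 1 ≤ K

/-- A small symmetric perturbation `W` of the matrix `L ∑ θ_l e_l e_l'` with almost orthonormal
`e_l`. -/
structure PerturbConfig (θ : Fin k → ℝ) (i : Fin k) (γ K : ℝ) where
  N : ℕ
  L : ℝ
  d : ℝ
  W : Matrix (Fin N) (Fin N) ℝ
  e : Fin k → Fin N → ℝ
  lt : (i : ℕ) < N
  one_le_L : 1 ≤ L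
  d_nonneg : 0 ≤ d
  d_le : d ≤ K * L⁻¹
  d_le_gap : θ i * (k * d) ≤ γ / 8
  d_le_half : k * d ≤ 1 / 2
  symm : W.IsSymm
  gram : ∀ j l, |e j ⬝ᵥ e l - if j = l then 1 else 0| ≤ d
  form1 : ∀ j l, |e j ⬝ᵥ (W *ᵥ e l)| ≤ K
  form2 : ∀ j l, |e j ⬝ᵥ (W ^ 2 *ᵥ e l)| ≤ K * L
  form3 : ∀ j l, |e j ⬝ᵥ (W ^ 3 *ᵥ e l)| ≤ K * L
  norm2 : ∀ l, l2 (W ^ 2 *ᵥ e l) ≤ K * L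
  norm : ∀ x, l2 (W *ᵥ x) ≤ γ / 8 * L * l2 x

/-- The perturbed matrix. -/
def perturbed {k N : ℕ} (θ : Fin k → ℝ) (L : ℝ) (W : Matrix (Fin N) (Fin N) ℝ)
    (e : Fin k → Fin N → ℝ) : Matrix (Fin N) (Fin N) ℝ :=
  W + Matrix.of fun a b => L * ∑ l, θ l * e l a * e l b

theorem perturbed_mulVec {N : ℕ} (θ : Fin k → ℝ) (L : ℝ) (W : Matrix (Fin N) (Fin N) ℝ)
    (e : Fin k → Fin N → ℝ) (x : Fin N → ℝ) :
    perturbed θ L W e *ᵥ x = W *ᵥ x + L • ∑ l, (θ l * (e l ⬝ᵥ x)) • e l := by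
  rw [perturbed, add_mulVec]
  congr 1
  ext a
  simp only [mulVec, dotProduct, of_apply, Finset.sum_mul, Finset.mul_sum, Pi.smul_apply,
    Finset.sum_apply, smul_eq_mul]
  rw [Finset.sum_comm]
  exact Finset.sum_congr rfl fun l _ => Finset.sum_congr rfl fun b _ => by ring

theorem perturbed_isSymm {N : ℕ} (θ : Fin k → ℝ) (L : ℝ) {W : Matrix (Fin N) (Fin N) ℝ}
    (hW : W.IsSymm) (e : Fin k → Fin N → ℝ) : (perturbed θ L W e).IsSymm := by
  refine hW.add ?_
  ext a b
  simp only [transpose_apply, of_apply]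
  congr 1
  exact Finset.sum_congr rfl fun l _ => by ring

theorem dotProduct_perturbed {N : ℕ} (θ : Fin k → ℝ) (L : ℝ) (W : Matrix (Fin N) (Fin N) ℝ)
    (e : Fin k → Fin N → ℝ) (x : Fin N → ℝ) :
    x ⬝ᵥ (perturbed θ L W e *ᵥ x) = x ⬝ᵥ (W *ᵥ x) + L * ∑ l, θ l * (e l ⬝ᵥ x) ^ 2 := by
  rw [perturbed_mulVec, dotProduct_add, dotProduct_smul, dotProduct_sum, smul_eq_mul]
  congr 2
  refine Finset.sum_congr rfl fun l _ => ?_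
  rw [dotProduct_smul, smul_eq_mul, dotProduct_comm x]
  ring

/-- A linear combination of almost orthonormal vectors. -/
theorem abs_sum_gram_sub_le {N : ℕ} {d : ℝ} {e : Fin k → Fin N → ℝ}
    (h : ∀ j l, |e j ⬝ᵥ e l - if j = l then 1 else 0| ≤ d) (a : Fin k → ℝ) :
    |(∑ l, a l • e l) ⬝ᵥ (∑ l, a l • e l) - ∑ l, a l ^ 2| ≤ k * d * ∑ l, a l ^ 2 := by
  have h1 : (∑ l, a l • e l) ⬝ᵥ (∑ l, a l • e l) - ∑ l, a l ^ 2 =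
      ∑ j, ∑ l, a j * a l * (e j ⬝ᵥ e l - if j = l then 1 else 0) := by
    simp only [sum_dotProduct, dotProduct_sum, smul_dotProduct, dotProduct_smul, smul_eq_mul,
      mul_sub, Finset.sum_sub_distrib, mul_ite, mul_one, mul_zero, Finset.sum_ite_eq,
      Finset.mem_univ, if_true]
    congr 1
    · refine Finset.sum_congr rfl fun j _ => ?_
      rw [Finset.mul_sum]
      refine Finset.sum_congr rfl fun l _ => ?_
      rw [dotProduct_comm]
      ring
    · exact Finset.sum_congr rfl fun j _ => sq _
  rw [h1]
  calc _ ≤ ∑ j, ∑ l, |a j * a l * (e j ⬝ᵥ e l - if j = l then 1 else 0)| :=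
        (Finset.abs_sum_le_sum_abs _ _).trans
          (Finset.sum_le_sum fun j _ => Finset.abs_sum_le_sum_abs _ _)
    _ ≤ ∑ j : Fin k, ∑ l : Fin k, (a j ^ 2 + a l ^ 2) / 2 * d := by
        refine Finset.sum_le_sum fun j _ => Finset.sum_le_sum fun l _ => ?_
        rw [abs_mul]
        refine mul_le_mul ?_ (h j l) (abs_nonneg _) (by positivity)
        rw [abs_le]
        constructor <;> nlinarith [sq_nonneg (a j + a l), sq_nonneg (a j - a l)]
    _ = _ := by
        simp only [← Finset.sum_mul, ← Finset.sum_div, Finset.sum_add_distrib, Finset.sum_const,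
          Finset.card_univ, Fintype.card_fin, nsmul_eq_mul, ← Finset.mul_sum]
        ring

/-- An almost Bessel inequality. -/
theorem sum_sq_dotProduct_le {N : ℕ} {d : ℝ} {e : Fin k → Fin N → ℝ} (hd : 0 ≤ d)
    (h : ∀ j l, |e j ⬝ᵥ e l - if j = l then 1 else 0| ≤ d) (x : Fin N → ℝ) :
    ∑ l, (e l ⬝ᵥ x) ^ 2 ≤ (1 + k * d) * (x ⬝ᵥ x) := by
  set S := ∑ l, (e l ⬝ᵥ x) ^ 2 with hS
  set y := ∑ l, (e l ⬝ᵥ x) • e l with hy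
  have h0 : 0 ≤ S := Finset.sum_nonneg fun _ _ => sq_nonneg _
  have h1 : x ⬝ᵥ y = S := by
    rw [hy, hS, dotProduct_sum]
    refine Finset.sum_congr rfl fun l _ => ?_
    rw [dotProduct_smul, smul_eq_mul, dotProduct_comm x, sq]
  have h2 : y ⬝ᵥ y ≤ (1 + k * d) * S := by
    have := (abs_le.1 (abs_sum_gram_sub_le h fun l => e l ⬝ᵥ x)).2
    linarith
  have h3 : S ^ 2 ≤ (x ⬝ᵥ x) * (y ⬝ᵥ y) := by
    rw [← h1, ← l2_sq, ← l2_sq, ← mul_pow, ← sq_abs]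
    exact pow_le_pow_left₀ (abs_nonneg _) (abs_dotProduct_le _ _) 2
  have hx : 0 ≤ x ⬝ᵥ x := by rw [← l2_sq]; positivity
  rcases h0.eq_or_lt with h | h
  · rw [← h]; positivity
  · refine le_of_mul_le_mul_right ?_ h
    calc S * S = S ^ 2 := by ring
      _ ≤ (x ⬝ᵥ x) * ((1 + k * d) * S) := h3.trans (by gcongr)
      _ = _ := by ring

theorem PerturbConfig.abs_form_le (c : PerturbConfig θ i γ K) (x : Fin c.N → ℝ) :
    |x ⬝ᵥ (c.W *ᵥ x)| ≤ γ / 8 * c.L * (x ⬝ᵥ x) := by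
  refine (abs_dotProduct_le _ _).trans ?_
  rw [← l2_sq]
  calc _ ≤ l2 x * (γ / 8 * c.L * l2 x) :=
        mul_le_mul_of_nonneg_left (c.norm x) (l2_nonneg _)
    _ = _ := by ring

/-- Localization of the perturbed eigenvalue. -/
theorem PerturbConfig.abs_eig_sub_le (h : IsGap θ i γ K) (c : PerturbConfig θ i γ K) :
    |eig (perturbed θ c.L c.W c.e) i - θ i * c.L| ≤ γ / 4 * c.L := by
  have hsymm := perturbed_isSymm θ c.L c.symm c.e
  have hL : 0 < c.L := by linarith [c.one_le_L]
  have hd := c.d_nonneg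
  have hdg := c.d_le_gap
  have hdh := c.d_le_half
  have hθi := h.pos i
  -- Test vectors orthogonal to e_l for l < i: only coefficients at most θ_i survive. The noise and
  -- the Gram error each cost γL/8, hence γL/4 in total.
  have up : eig (perturbed θ c.L c.W c.e) i ≤ c.L * (θ i * (1 + k * c.d)) + γ / 8 * c.L := by
    refine eig_le (J := {l : Fin k // l < i}) hsymm c.lt ?_ (fun l => c.e l.1) ?_
    · rw [Fintype.card_subtype, show Finset.univ.filter (fun l => l < i) = Finset.Iio i by ext; simp,
        Fin.card_Iio]
    · intro x hx
      rw [dotProduct_perturbed]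
      have h1 := (abs_le.1 (c.abs_form_le x)).2
      have h2 : ∑ l, θ l * (c.e l ⬝ᵥ x) ^ 2 ≤ θ i * ((1 + k * c.d) * (x ⬝ᵥ x)) := by
        refine le_trans ?_
          (mul_le_mul_of_nonneg_left (sum_sq_dotProduct_le hd c.gram x) hθi.le)
        rw [Finset.mul_sum]
        refine Finset.sum_le_sum fun l _ => ?_
        by_cases hl : l < i
        · rw [hx ⟨l, hl⟩]; simp
        · exact mul_le_mul_of_nonneg_right (h.anti (not_lt.1 hl)) (sq_nonneg _)
      have h3 := mul_le_mul_of_nonneg_left h2 hL.le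
      linarith
  -- Test vectors in the span of e_l for l ≤ i, parametrised by coefficients padded with zeros;
  -- almost orthonormality makes the parametrisation injective.
  have low : c.L * (θ i * (1 - k * c.d)) - γ / 8 * c.L ≤ eig (perturbed θ c.L c.W c.e) i := by
    let pad : ({l : Fin k // l ≤ i} → ℝ) → Fin k → ℝ := fun a l =>
      if hl : l ≤ i then a ⟨l, hl⟩ else 0
    let T : ({l : Fin k // l ≤ i} → ℝ) →ₗ[ℝ] (Fin c.N → ℝ) :=
      ∑ l : {l : Fin k // l ≤ i}, (LinearMap.proj l).smulRight (c.e l.1)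
    have hT : ∀ a, T a = ∑ l, pad a l • c.e l := by
      intro a
      have : ∑ l, pad a l • c.e l = ∑ l ∈ Finset.univ.filter (fun l => l ≤ i), pad a l • c.e l := by
        rw [Finset.sum_filter]
        refine Finset.sum_congr rfl fun l _ => ?_
        split_ifs with hl
        · rfl
        · simp [pad, hl]
      rw [this, Finset.sum_subtype _ (p := fun l => l ≤ i) (by simp)]
      simp only [T, LinearMap.sum_apply, LinearMap.smulRight_apply, LinearMap.proj_apply]
      refine Finset.sum_congr rfl fun l _ => ?_
      simp [pad, l.2]
    have hs : ∀ a, (1 - k * c.d) * ∑ l, pad a l ^ 2 ≤ T a ⬝ᵥ T a := by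
      intro a
      have := (abs_le.1 (abs_sum_gram_sub_le c.gram (pad a))).1
      rw [hT]
      linarith
    refine le_eig hsymm (J := {l : Fin k // l ≤ i}) ?_ T ?_ ?_
    · rw [Fintype.card_subtype, show Finset.univ.filter (fun l => l ≤ i) = Finset.Iic i by ext; simp,
        Fin.card_Iic]
      exact Nat.lt_succ_self _
    · intro a ha
      have h1 := hs a
      rw [ha, zero_dotProduct] at h1
      have h2 : 0 ≤ ∑ l, pad a l ^ 2 := Finset.sum_nonneg fun _ _ => sq_nonneg _
      have h3 : ∑ l, pad a l ^ 2 = 0 := by nlinarith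
      ext l
      have := (Finset.sum_eq_zero_iff_of_nonneg fun _ _ => sq_nonneg _).1 h3 l.1 (Finset.mem_univ _)
      simpa [pad, l.2] using this
    · intro a
      rw [dotProduct_perturbed]
      set x := T a
      set s := ∑ l, pad a l ^ 2
      set S := ∑ l ∈ Finset.univ.filter (fun l => l ≤ i), (c.e l ⬝ᵥ x) ^ 2
      have hs0 : 0 ≤ s := Finset.sum_nonneg fun _ _ => sq_nonneg _
      have hS0 : 0 ≤ S := Finset.sum_nonneg fun _ _ => sq_nonneg _
      have hxx : 0 ≤ x ⬝ᵥ x := by rw [← l2_sq]; positivity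
      have h1 := (abs_le.1 (c.abs_form_le x)).1
      have h2 : θ i * S ≤ ∑ l, θ l * (c.e l ⬝ᵥ x) ^ 2 := by
        rw [Finset.mul_sum]
        refine le_trans (Finset.sum_le_sum fun l hl => ?_)
          (Finset.sum_le_sum_of_subset_of_nonneg (Finset.subset_univ _) fun l _ _ =>
            mul_nonneg (h.pos l).le (sq_nonneg _))
        exact mul_le_mul_of_nonneg_right (h.anti (Finset.mem_filter.1 hl).2) (sq_nonneg _)
      have h3 : (x ⬝ᵥ x) ^ 2 ≤ s * S := by
        have h4 : x ⬝ᵥ x = ∑ l ∈ Finset.univ.filter (fun l => l ≤ i), pad a l * (c.e l ⬝ᵥ x) := by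
          have hx : x = ∑ l, pad a l • c.e l := hT a
          nth_rw 1 [hx]
          rw [sum_dotProduct, Finset.sum_filter]
          refine Finset.sum_congr rfl fun l _ => ?_
          split_ifs with hl
          · simp
          · simp [pad, hl]
        rw [h4]
        refine (Finset.sum_mul_sq_le_sq_mul_sq _ _ _).trans ?_
        refine mul_le_mul_of_nonneg_right ?_ hS0
        exact Finset.sum_le_sum_of_subset_of_nonneg (Finset.subset_univ _) fun _ _ _ => sq_nonneg _
      have h5 : (1 - k * c.d) * (x ⬝ᵥ x) ≤ S := by
        have h6 := hs a
        rcases hs0.eq_or_lt with h0 | h0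
        · have : (x ⬝ᵥ x) ^ 2 ≤ 0 := by rw [← h0] at h3; linarith
          have : x ⬝ᵥ x = 0 := by nlinarith
          rw [this, mul_zero]; exact hS0
        · refine le_of_mul_le_mul_left ?_ h0
          calc s * ((1 - k * c.d) * (x ⬝ᵥ x)) = ((1 - k * c.d) * s) * (x ⬝ᵥ x) := by ring
            _ ≤ (x ⬝ᵥ x) * (x ⬝ᵥ x) := by gcongr
            _ ≤ _ := by linarith
      have h7 := mul_le_mul_of_nonneg_left h5 hθi.le
      have h8 := mul_le_mul_of_nonneg_left (h7.trans h2) hL.le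
      linarith
  rw [abs_le]
  have h9 : c.L * (θ i * (k * c.d)) ≤ c.L * (γ / 8) := by gcongr
  constructor <;> nlinarith

end Config

/-! ### The eigenvector equation and a priori bounds. -/

section Eigen

variable {k : ℕ} {θ : Fin k → ℝ} {i : Fin k} {γ K : ℝ}

/-- A perturbed matrix with a unit eigenvector for an eigenvalue close to the `i`-th one. -/
structure EigenConfig (θ : Fin k → ℝ) (i : Fin k) (γ K : ℝ) extends PerturbConfig θ i γ K where
  lam : ℝ
  v : Fin N → ℝ
  near : |lam - θ i * L| ≤ γ / 4 * L
  eigen : perturbed θ L W e *ᵥ v = lam • v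
  unit : v ⬝ᵥ v = 1

namespace EigenConfig

variable (c : EigenConfig θ i γ K)

/-- The inverse of the scale of the unperturbed eigenvalues. -/
noncomputable def s : ℝ := c.L⁻¹

/-- The ratio of the scale and the eigenvalue. -/
noncomputable def q : ℝ := c.L / c.lam

/-- The overlap of the eigenvector with `e_l`. -/
def u (l : Fin k) : ℝ := c.e l ⬝ᵥ c.v

theorem L_pos : 0 < c.L := by linarith [c.one_le_L]

theorem s_pos : 0 < c.s := inv_pos.2 c.L_pos

theorem s_mul_L : c.s * c.L = 1 := inv_mul_cancel₀ c.L_pos.ne'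

theorem s_le_one : c.s ≤ 1 := inv_le_one_of_one_le₀ c.one_le_L

theorem lam_ge (h : IsGap θ i γ K) : 3 / 4 * γ * c.L ≤ c.lam := by
  have h1 := (abs_le.1 c.near).1
  have h2 := mul_le_mul_of_nonneg_right h.gap_le c.L_pos.le
  linarith

theorem lam_pos (h : IsGap θ i γ K) : 0 < c.lam := by
  refine lt_of_lt_of_le ?_ (c.lam_ge h)
  have := c.L_pos
  have := h.gap_pos
  positivity

theorem q_pos (h : IsGap θ i γ K) : 0 < c.q := div_pos c.L_pos (c.lam_pos h)

theorem q_le (h : IsGap θ i γ K) : c.q ≤ 4 / (3 * γ) := by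
  have h1 := c.lam_ge h
  have h2 := h.gap_pos
  rw [q, div_le_div_iff₀ (c.lam_pos h) (by positivity)]
  linarith

theorem q_mul_le (h : IsGap θ i γ K) : c.q * θ i ≤ 4 / 3 := by
  have h1 := (abs_le.1 c.near).1
  have h2 := mul_le_mul_of_nonneg_right h.gap_le c.L_pos.le
  rw [q, div_mul_eq_mul_div, div_le_div_iff₀ (c.lam_pos h) (by norm_num)]
  linarith

theorem inv_lam (h : IsGap θ i γ K) : 1 / c.lam = c.q * c.s := by
  have := c.lam_pos h
  have := c.L_pos
  rw [q, s]
  field_simp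

/-- 1 - qθ_j = (λ - Lθ_j)/λ. Since λ is within γL/4 of θ_i L, it stays 3γL/4 away from θ_j L, while
λ ≤ 2θ_i L. -/
theorem one_sub_ne_zero_and_inv_le (h : IsGap θ i γ K) {j : Fin k} (hj : j ≠ i) :
    1 - c.q * θ j ≠ 0 ∧ |(1 - c.q * θ j)⁻¹| ≤ 2 * θ i / (3 / 4 * γ) := by
  have hlam := c.lam_pos h
  have hL := c.L_pos
  have hγ := h.gap_pos
  have h1 : 1 - c.q * θ j = (c.lam - c.L * θ j) / c.lam := by
    rw [q]; field_simp
  have h2 : 3 / 4 * γ * c.L ≤ |c.lam - c.L * θ j| := by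
    have h3 : |θ i - θ j| * c.L ≤ |c.lam - c.L * θ j| + |c.lam - θ i * c.L| := by
      have : (θ i - θ j) * c.L = (c.lam - c.L * θ j) - (c.lam - θ i * c.L) := by ring
      rw [← abs_of_pos hL, ← abs_mul, abs_of_pos hL, this]
      exact norm_sub_le (c.lam - c.L * θ j) _
    have h4 := mul_le_mul_of_nonneg_right (h.gap j hj) hL.le
    linarith [c.near]
  have h5 : 0 < 3 / 4 * γ * c.L := by positivity
  have h6 : 0 < |c.lam - c.L * θ j| := h5.trans_le h2
  refine ⟨?_, ?_⟩
  · rw [h1]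
    exact div_ne_zero (abs_pos.1 h6) hlam.ne'
  · rw [h1, inv_div, abs_div, abs_of_pos hlam, div_le_div_iff₀ h6 (by positivity)]
    have h7 : c.lam ≤ 2 * θ i * c.L := by
      have h8 := (abs_le.1 c.near).2
      have h9 := mul_le_mul_of_nonneg_right h.gap_le hL.le
      nlinarith
    calc c.lam * (3 / 4 * γ) ≤ 2 * θ i * c.L * (3 / 4 * γ) := by gcongr
      _ = 2 * θ i * (3 / 4 * γ * c.L) := by ring
      _ ≤ _ := mul_le_mul_of_nonneg_left h2 (by linarith [h.pos i])

/-- The eigenvalue equation divided by λ, in a form that can be substituted into itself. -/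
theorem v_eq (h : IsGap θ i γ K) :
    c.v = ∑ l, (c.q * (θ l * c.u l)) • c.e l + (c.q * c.s) • (c.W *ᵥ c.v) := by
  have hlam := c.lam_pos h
  have h1 : c.v = (1 / c.lam) • (perturbed θ c.L c.W c.e *ᵥ c.v) := by
    rw [c.eigen, smul_smul, one_div_mul_cancel hlam.ne', one_smul]
  have h2 : (1 / c.lam) * c.L = c.q := by rw [q]; ring
  nth_rw 1 [h1]
  rw [perturbed_mulVec, smul_add, ← c.inv_lam h, smul_smul, h2, add_comm]
  congr 1
  rw [Finset.smul_sum]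
  exact Finset.sum_congr rfl fun l _ => by rw [smul_smul]; rfl

theorem dotProduct_v (h : IsGap θ i γ K) (y : Fin c.N → ℝ) :
    y ⬝ᵥ c.v = c.q * ∑ l, θ l * c.u l * (y ⬝ᵥ c.e l) + c.q * c.s * (y ⬝ᵥ (c.W *ᵥ c.v)) := by
  nth_rw 1 [c.v_eq h]
  rw [dotProduct_add, dotProduct_sum, dotProduct_smul, Finset.mul_sum, smul_eq_mul]
  congr 1
  exact Finset.sum_congr rfl fun l _ => by rw [dotProduct_smul, smul_eq_mul]; ring

theorem pow_isSymm (m : ℕ) : (c.W ^ m).IsSymm := by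
  rw [IsSymm, transpose_pow, c.symm.eq]

theorem pow_mulVec_dotProduct_v (h : IsGap θ i γ K) (m : ℕ) (j : Fin k) :
    (c.W ^ m *ᵥ c.e j) ⬝ᵥ c.v =
      c.q * ∑ l, θ l * c.u l * (c.e j ⬝ᵥ (c.W ^ m *ᵥ c.e l)) +
        c.q * c.s * ((c.W ^ (m + 1) *ᵥ c.e j) ⬝ᵥ c.v) := by
  rw [c.dotProduct_v h, dotProduct_mulVec_comm c.symm, mulVec_mulVec, ← pow_succ']
  simp only [dotProduct_mulVec_comm (c.pow_isSymm m)]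

theorem l2_v : l2 c.v = 1 := by
  have : l2 c.v ^ 2 = 1 := by rw [l2_sq, c.unit]
  nlinarith [l2_nonneg c.v]

theorem l2_e_le (l : Fin k) : l2 (c.e l) ≤ 2 := by
  have h1 : l2 (c.e l) ^ 2 ≤ 1 + c.d := by
    have := (abs_le.1 (c.gram l l)).2
    rw [if_pos rfl] at this
    rw [l2_sq]
    linarith
  have h2 : c.d ≤ 1 / 2 := by
    have hk : (1 : ℝ) ≤ k := by exact_mod_cast (Nat.one_le_of_lt i.2)
    have := mul_le_mul_of_nonneg_right hk c.d_nonneg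
    linarith [c.d_le_half]
  nlinarith [l2_nonneg (c.e l)]

theorem abs_u_le (l : Fin k) : |c.u l| ≤ 2 := by
  refine (abs_dotProduct_le _ _).trans ?_
  rw [c.l2_v, mul_one]
  exact c.l2_e_le l

/-- Applying W^m to `v_eq` yields a combination of the W^m e_l plus q s W(W^m v). As ‖q s W‖ ≤ 1/2,
the last term is absorbed on the left, so W^m v is no larger than the W^m e_l up to a constant. -/
theorem l2_pow_mulVec_v_le (h : IsGap θ i γ K) (m : ℕ) {B : ℝ}
    (hB : ∀ l, l2 (c.W ^ m *ᵥ c.e l) ≤ B) :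
    l2 (c.W ^ m *ᵥ c.v) ≤ 2 * (4 / (3 * γ) * (2 * ∑ l, θ l) * B) := by
  have hγ := h.gap_pos
  have hL := c.L_pos
  have hB0 : 0 ≤ B := (l2_nonneg _).trans (hB i)
  have h1 : c.W ^ m *ᵥ c.v = ∑ l, (c.q * (θ l * c.u l)) • (c.W ^ m *ᵥ c.e l) +
      (c.q * c.s) • (c.W *ᵥ (c.W ^ m *ᵥ c.v)) := by
    nth_rw 1 [c.v_eq h]
    rw [mulVec_add, mulVec_smul, mulVec_mulVec, mulVec_mulVec, ← pow_succ, ← pow_succ']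
    congr 1
    rw [← mulVecLin_apply, map_sum]
    simp
  set a := l2 (c.W ^ m *ᵥ c.v) with ha
  have ha0 : 0 ≤ a := l2_nonneg _
  have h2 : a ≤ ∑ l, c.q * (θ l * 2) * B + c.q * c.s * (γ / 8 * c.L * a) := by
    rw [ha]
    nth_rw 1 [h1]
    refine (l2_add_le _ _).trans (add_le_add ?_ ?_)
    · refine (l2_sum_le _ _).trans (Finset.sum_le_sum fun l _ => ?_)
      rw [l2_smul, abs_mul, abs_mul, abs_of_pos (c.q_pos h), abs_of_pos (h.pos l)]
      have := (c.q_pos h).le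
      have := (h.pos l).le
      gcongr
      · exact l2_nonneg _
      · exact c.abs_u_le l
      · exact hB l
    · rw [l2_smul, abs_of_pos (mul_pos (c.q_pos h) c.s_pos)]
      exact mul_le_mul_of_nonneg_left (c.norm _) (mul_pos (c.q_pos h) c.s_pos).le
  have h3 : c.q * c.s * (γ / 8 * c.L * a) = c.q * (γ / 8) * a := by
    have := c.s_mul_L
    linear_combination c.q * γ / 8 * a * this
  have h4 : c.q * (γ / 8) ≤ 1 / 2 := by
    have := mul_le_mul_of_nonneg_right (c.q_le h) (by positivity : (0 : ℝ) ≤ γ / 8)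
    have h5 : 4 / (3 * γ) * (γ / 8) = 1 / 6 := by field_simp; norm_num
    linarith
  have h5 : ∑ l, c.q * (θ l * 2) * B ≤ 4 / (3 * γ) * (2 * ∑ l, θ l) * B := by
    rw [Finset.mul_sum, Finset.mul_sum, Finset.sum_mul]
    refine Finset.sum_le_sum fun l _ => ?_
    have := (h.pos l).le
    rw [mul_comm (θ l) 2]
    gcongr
    exact c.q_le h
  have h6 := mul_le_mul_of_nonneg_right h4 ha0
  linarith

theorem l2_mulVec_e_le (l : Fin k) :
    l2 (c.W ^ 1 *ᵥ c.e l) ≤ Real.sqrt (K * c.L) := by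
  apply Real.le_sqrt_of_sq_le
  rw [l2_sq, pow_one, ← dotProduct_mulVec_comm c.symm, mulVec_mulVec, ← sq]
  exact (le_abs_self _).trans (c.form2 l l)

end EigenConfig

end Eigen

/-! ### Uniform expansion of the overlaps. -/

section Expansion

variable {k : ℕ} {θ : Fin k → ℝ} {i : Fin k} {γ K : ℝ}

namespace EigenConfig

/-- The Gram matrix of the vectors `e_l`. -/
noncomputable def w0 (j l : Fin k) (c : EigenConfig θ i γ K) : ℝ := c.e j ⬝ᵥ c.e l

/-- The quadratic form of the perturbation. -/
noncomputable def w1 (j l : Fin k) (c : EigenConfig θ i γ K) : ℝ := c.e j ⬝ᵥ (c.W *ᵥ c.e l)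

/-- The normalised quadratic form of the square of the perturbation. -/
noncomputable def w2 (j l : Fin k) (c : EigenConfig θ i γ K) : ℝ :=
  c.s * (c.e j ⬝ᵥ (c.W ^ 2 *ᵥ c.e l))

/-- The normalised quadratic form of the cube of the perturbation. -/
noncomputable def w3 (j l : Fin k) (c : EigenConfig θ i γ K) : ℝ :=
  c.s * (c.e j ⬝ᵥ (c.W ^ 3 *ᵥ c.e l))

/-- Along the filter ⊤, O means one constant valid for every configuration, whatever its size `N`.
This gives constants uniform in the randomness. -/
theorem isBigO_of_abs_le {f g : EigenConfig θ i γ K → ℝ} (C : ℝ) (hg : ∀ c, 0 ≤ g c)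
    (h : ∀ c, |f c| ≤ C * g c) : f =O[⊤] g :=
  IsBigO.of_bound C (Eventually.of_forall fun c => by
    rw [Real.norm_eq_abs, Real.norm_eq_abs, abs_of_nonneg (hg c)]; exact h c)

theorem isBigO_one_of_abs_le {f : EigenConfig θ i γ K → ℝ} (C : ℝ)
    (h : ∀ c, |f c| ≤ C) : f =O[⊤] fun _ => (1 : ℝ) :=
  isBigO_of_abs_le C (fun _ => zero_le_one) fun c => by rw [mul_one]; exact h c

theorem isBigO_s : (s : EigenConfig θ i γ K → ℝ) =O[⊤] fun _ => (1 : ℝ) :=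
  isBigO_one_of_abs_le 1 fun c => by rw [abs_of_pos c.s_pos]; exact c.s_le_one

theorem isBigO_q (h : IsGap θ i γ K) : (q : EigenConfig θ i γ K → ℝ) =O[⊤] fun _ => (1 : ℝ) :=
  isBigO_one_of_abs_le _ fun c => by rw [abs_of_pos (c.q_pos h)]; exact c.q_le h

theorem isBigO_u (l : Fin k) : (fun c : EigenConfig θ i γ K => c.u l) =O[⊤] fun _ => (1 : ℝ) :=
  isBigO_one_of_abs_le 2 fun c => c.abs_u_le l

theorem isBigO_d : (fun c : EigenConfig θ i γ K => c.d) =O[⊤] s :=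
  isBigO_of_abs_le K (fun c => c.s_pos.le) fun c => by
    rw [abs_of_nonneg c.d_nonneg]; exact c.d_le

theorem isBigO_w0 (j l : Fin k) :
    (fun c : EigenConfig θ i γ K => w0 j l c - if j = l then 1 else 0) =O[⊤] fun c => c.d :=
  isBigO_of_abs_le 1 (fun c => c.d_nonneg) fun c => by rw [one_mul]; exact c.gram j l

theorem isBigO_w1 (j l : Fin k) :
    (w1 j l : EigenConfig θ i γ K → ℝ) =O[⊤] fun _ => (1 : ℝ) :=
  isBigO_one_of_abs_le K fun c => c.form1 j l

theorem abs_s_mul_le (c : EigenConfig θ i γ K) {x B : ℝ} (hx : |x| ≤ B * c.L) :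
    |c.s * x| ≤ B := by
  rw [abs_mul, abs_of_pos c.s_pos]
  calc c.s * |x| ≤ c.s * (B * c.L) := mul_le_mul_of_nonneg_left hx c.s_pos.le
    _ = B := by linear_combination B * c.s_mul_L

theorem isBigO_w2 (j l : Fin k) :
    (w2 j l : EigenConfig θ i γ K → ℝ) =O[⊤] fun _ => (1 : ℝ) :=
  isBigO_one_of_abs_le K fun c => c.abs_s_mul_le (c.form2 j l)

theorem isBigO_w3 (j l : Fin k) :
    (w3 j l : EigenConfig θ i γ K → ℝ) =O[⊤] fun _ => (1 : ℝ) :=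
  isBigO_one_of_abs_le K fun c => c.abs_s_mul_le (c.form3 j l)

/-- The quadratic form `(W e_j)'(W v)`, normalised. -/
theorem isBigO_form_mulVec (h : IsGap θ i γ K) (j : Fin k) :
    (fun c : EigenConfig θ i γ K => c.s * ((c.W ^ 2 *ᵥ c.e j) ⬝ᵥ c.v)) =O[⊤]
      fun _ => (1 : ℝ) := by
  refine isBigO_one_of_abs_le (2 * (4 / (3 * γ) * (2 * ∑ l, θ l)) * K) fun c =>
    c.abs_s_mul_le ?_
  have h1 : (c.W ^ 2 *ᵥ c.e j) ⬝ᵥ c.v = (c.W ^ 1 *ᵥ c.e j) ⬝ᵥ (c.W ^ 1 *ᵥ c.v) := by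
    rw [dotProduct_mulVec_comm (c.pow_isSymm 1), mulVec_mulVec, ← pow_add]
  rw [h1]
  refine (abs_dotProduct_le _ _).trans ?_
  have hK : 0 ≤ K * c.L := mul_nonneg (by linarith [h.one_le]) c.L_pos.le
  have h2 := Real.mul_self_sqrt hK
  calc _ ≤ Real.sqrt (K * c.L) * (2 * (4 / (3 * γ) * (2 * ∑ l, θ l) * Real.sqrt (K * c.L))) :=
        mul_le_mul (c.l2_mulVec_e_le j) (c.l2_pow_mulVec_v_le h 1 c.l2_mulVec_e_le)
          (l2_nonneg _) (Real.sqrt_nonneg _)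
    _ = _ := by linear_combination (2 * (4 / (3 * γ) * (2 * ∑ l, θ l))) * h2

/-- Splitting W⁴ symmetrically as (W²e_j)'(W²v) gives O(L²). Bounding by ‖W‖ alone would give only
L⁴, too weak for the remainder. -/
theorem isBigO_form_mulVec_two (h : IsGap θ i γ K) (j : Fin k) :
    (fun c : EigenConfig θ i γ K => c.s ^ 2 * ((c.W ^ 4 *ᵥ c.e j) ⬝ᵥ c.v)) =O[⊤]
      fun _ => (1 : ℝ) := by
  refine isBigO_one_of_abs_le (2 * (4 / (3 * γ) * (2 * ∑ l, θ l)) * K ^ 2) fun c => ?_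
  have h1 : (c.W ^ 4 *ᵥ c.e j) ⬝ᵥ c.v = (c.W ^ 2 *ᵥ c.e j) ⬝ᵥ (c.W ^ 2 *ᵥ c.v) := by
    rw [dotProduct_mulVec_comm (c.pow_isSymm 2), mulVec_mulVec, ← pow_add]
  have h2 : |(c.W ^ 4 *ᵥ c.e j) ⬝ᵥ c.v| ≤
      (K * c.L) * (2 * (4 / (3 * γ) * (2 * ∑ l, θ l) * (K * c.L))) := by
    rw [h1]
    refine (abs_dotProduct_le _ _).trans ?_
    exact mul_le_mul (c.norm2 j) (c.l2_pow_mulVec_v_le h 2 c.norm2)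
          (l2_nonneg _) (mul_nonneg (by linarith [h.one_le]) c.L_pos.le)
  rw [sq, mul_assoc]
  refine c.abs_s_mul_le ?_
  rw [abs_mul, abs_of_pos c.s_pos]
  calc _ ≤ c.s * ((K * c.L) * (2 * (4 / (3 * γ) * (2 * ∑ l, θ l) * (K * c.L)))) :=
        mul_le_mul_of_nonneg_left h2 c.s_pos.le
    _ = _ := by
        linear_combination (2 * (4 / (3 * γ) * (2 * ∑ l, θ l)) * K ^ 2) * c.L * c.s_mul_L

/-- Two substitutions suffice for first order: the remainder is s² times a form of size O(L). -/
theorem u_eq_two (h : IsGap θ i γ K) (j : Fin k) (c : EigenConfig θ i γ K) :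
    c.u j = c.q * ∑ l, θ l * c.u l * w0 j l c +
      (c.s * (c.q * (c.q * ∑ l, θ l * c.u l * w1 j l c)) +
        c.s * (c.q ^ 2 * (c.s * ((c.W ^ 2 *ᵥ c.e j) ⬝ᵥ c.v)))) := by
  have h0 := c.pow_mulVec_dotProduct_v h 0 j
  have h1 := c.pow_mulVec_dotProduct_v h 1 j
  simp only [pow_zero, one_mulVec, zero_add] at h0
  rw [h1] at h0
  simp only [pow_one] at h0
  change c.e j ⬝ᵥ c.v = _
  rw [h0]
  simp only [w0, w1]
  ring

/-- Four substitutions make the remainder s⁴ · O(L²) = O(s²), the accuracy needed at second order.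
-/
theorem u_eq_four (h : IsGap θ i γ K) (j : Fin k) (c : EigenConfig θ i γ K) :
    c.u j = c.q * ∑ l, θ l * c.u l * w0 j l c +
      (c.s * (c.q ^ 2 * ∑ l, θ l * c.u l * w1 j l c) +
       c.s * (c.q ^ 3 * ∑ l, θ l * c.u l * w2 j l c) +
       c.s ^ 2 * (c.q ^ 4 * ∑ l, θ l * c.u l * w3 j l c) +
       c.s ^ 2 * (c.q ^ 4 * (c.s ^ 2 * ((c.W ^ 4 *ᵥ c.e j) ⬝ᵥ c.v)))) := by
  have h0 := c.pow_mulVec_dotProduct_v h 0 j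
  have h1 := c.pow_mulVec_dotProduct_v h 1 j
  have h2 := c.pow_mulVec_dotProduct_v h 2 j
  have h3 := c.pow_mulVec_dotProduct_v h 3 j
  simp only [pow_zero, one_mulVec, zero_add] at h0
  rw [h1, h2, h3] at h0
  simp only [pow_one] at h0
  change c.e j ⬝ᵥ c.v = _
  have e2 : ∑ l, θ l * c.u l * w2 j l c =
      c.s * ∑ l, θ l * c.u l * (c.e j ⬝ᵥ (c.W ^ 2 *ᵥ c.e l)) := by
    rw [Finset.mul_sum]
    exact Finset.sum_congr rfl fun l _ => by rw [w2]; ring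
  have e3 : ∑ l, θ l * c.u l * w3 j l c =
      c.s * ∑ l, θ l * c.u l * (c.e j ⬝ᵥ (c.W ^ 3 *ᵥ c.e l)) := by
    rw [Finset.mul_sum]
    exact Finset.sum_congr rfl fun l _ => by rw [w3]; ring
  rw [h0, e2, e3]
  simp only [w0, w1]
  ring

theorem isBigO_one_sub_mul_u (h : IsGap θ i γ K) (j : Fin k) :
    (fun c : EigenConfig θ i γ K => (1 - c.q * θ j) * c.u j) =O[⊤] s :=
  overlap_first_order (u := fun l c => c.u l) (w0 := w0) (w1 := w1)
    (R2 := fun j c => c.s * (c.q ^ 2 * (c.s * ((c.W ^ 2 *ᵥ c.e j) ⬝ᵥ c.v))))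
    θ (isBigO_q h) isBigO_d isBigO_u isBigO_w0 isBigO_w1
    (fun j => isBigO_mul_bdd (f := s) (isBigO_refl _ _)
      (isBigO_bdd_mul (by simpa using (isBigO_q h).pow 2) (isBigO_form_mulVec h j)))
    (fun j c => c.u_eq_two h j) j

theorem isBigO_u_of_ne (h : IsGap θ i γ K) {j : Fin k} (hj : j ≠ i) :
    (fun c : EigenConfig θ i γ K => c.u j) =O[⊤] s :=
  overlap_off_diagonal (u := fun l c => c.u l) θ
    (isBigO_one_of_abs_le _ fun c => (c.one_sub_ne_zero_and_inv_le h hj).2)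
    (fun c => (c.one_sub_ne_zero_and_inv_le h hj).1) (isBigO_one_sub_mul_u h j)

/-- One substitution reduces v'Wv to the (We_l)'v, which are O(1), and s|Wv|², which is O(1) because
|Wv| = O(√L). -/
theorem isBigO_form_v (h : IsGap θ i γ K) :
    (fun c : EigenConfig θ i γ K => c.v ⬝ᵥ (c.W *ᵥ c.v)) =O[⊤] fun _ => (1 : ℝ) := by
  have h1 : ∀ l, (fun c : EigenConfig θ i γ K => (c.W ^ 1 *ᵥ c.e l) ⬝ᵥ c.v) =O[⊤]
      fun _ => (1 : ℝ) := by
    intro l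
    have : ∀ c : EigenConfig θ i γ K, (c.W ^ 1 *ᵥ c.e l) ⬝ᵥ c.v =
        c.q * ∑ m, θ m * c.u m * w1 l m c + c.q * (c.s * ((c.W ^ 2 *ᵥ c.e l) ⬝ᵥ c.v)) := by
      intro c
      rw [c.pow_mulVec_dotProduct_v h 1 l]
      simp only [w1, pow_one]
      ring
    simp only [this]
    exact (isBigO_bdd_mul (isBigO_q h) (isBigO_weighted_sum θ _ fun m _ =>
      isBigO_bdd_mul (isBigO_u m) (isBigO_w1 l m))).add
      (isBigO_bdd_mul (isBigO_q h) (isBigO_form_mulVec h l))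
  have h2 : (fun c : EigenConfig θ i γ K => c.s * ((c.W *ᵥ c.v) ⬝ᵥ (c.W *ᵥ c.v))) =O[⊤]
      fun _ => (1 : ℝ) := by
    refine isBigO_one_of_abs_le ((2 * (4 / (3 * γ) * (2 * ∑ l, θ l))) ^ 2 * K) fun c =>
      c.abs_s_mul_le ?_
    have hK : 0 ≤ K * c.L := mul_nonneg (by linarith [h.one_le]) c.L_pos.le
    have h3 := c.l2_pow_mulVec_v_le h 1 c.l2_mulVec_e_le
    rw [pow_one] at h3
    rw [← l2_sq, abs_of_nonneg (sq_nonneg _)]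
    refine (pow_le_pow_left₀ (l2_nonneg _) h3 2).trans (le_of_eq ?_)
    have h4 := Real.sq_sqrt hK
    linear_combination (2 * (4 / (3 * γ) * (2 * ∑ l, θ l))) ^ 2 * h4
  have h3 : ∀ c : EigenConfig θ i γ K, c.v ⬝ᵥ (c.W *ᵥ c.v) =
      c.q * ∑ l, θ l * c.u l * ((c.W ^ 1 *ᵥ c.e l) ⬝ᵥ c.v) +
        c.q * (c.s * ((c.W *ᵥ c.v) ⬝ᵥ (c.W *ᵥ c.v))) := by
    intro c
    rw [dotProduct_mulVec_comm c.symm, c.dotProduct_v h, mul_assoc]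
    congr 3
    ext l
    rw [← dotProduct_mulVec_comm c.symm, dotProduct_comm, pow_one]
  simp only [h3]
  exact (isBigO_bdd_mul (isBigO_q h) (isBigO_weighted_sum θ _ fun l _ =>
    isBigO_bdd_mul (isBigO_u l) (h1 l))).add (isBigO_bdd_mul (isBigO_q h) h2)

/-- Pairing `v_eq` with v itself and using |v| = 1; the overlaps with l ≠ i enter squared. -/
theorem isBigO_sq_u_sub (h : IsGap θ i γ K) :
    (fun c : EigenConfig θ i γ K => c.q * θ i * (c.u i * c.u i) - 1) =O[⊤] s := by
  refine overlap_sq (u := fun l c => c.u l) (R1 := fun c => c.v ⬝ᵥ (c.W *ᵥ c.v)) θ i isBigO_s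
    (isBigO_q h) (fun j hj => isBigO_u_of_ne h hj) (isBigO_form_v h) fun c => ?_
  have h1 := c.dotProduct_v h c.v
  rw [c.unit] at h1
  rw [h1]
  simp only [u, dotProduct_comm c.v]
  ring

/-- For large scales the eigenvector is not orthogonal to `e_i`. -/
theorem exists_quarter_le_sq_u (h : IsGap θ i γ K) :
    ∃ L₁ : ℝ, ∀ c : EigenConfig θ i γ K, L₁ ≤ c.L → 1 / 4 ≤ c.u i ^ 2 := by
  obtain ⟨C, hC⟩ := isBigO_top.1 (isBigO_sq_u_sub (K := K) h)
  -- L ≥ 3C makes the error at most 1/3; with qθ_i ≤ 4/3 this leaves u_i² ≥ 1/2.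
  refine ⟨3 * C, fun c hc => ?_⟩
  have h1 := hC c
  rw [Real.norm_eq_abs, Real.norm_eq_abs, abs_of_pos c.s_pos] at h1
  have h2 : C * c.s ≤ 1 / 3 := by
    have := mul_le_mul_of_nonneg_left hc c.s_pos.le
    rw [c.s_mul_L] at this
    linarith
  have h3 := (abs_le.1 h1).1
  have h4 := mul_le_mul_of_nonneg_right (c.q_mul_le h) (sq_nonneg (c.u i))
  nlinarith

/-- The expansion of the overlap with `e_j`. -/
theorem exists_abs_u_sub_le (h : IsGap θ i γ K) {j : Fin k} (hj : j ≠ i) :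
    ∃ L₁ C : ℝ, ∀ c : EigenConfig θ i γ K, L₁ ≤ c.L → 0 ≤ c.u i →
      |c.u j - 1 / (θ i - θ j) * (θ i * (1 / c.lam) * (c.e j ⬝ᵥ (c.W *ᵥ c.e i)) +
        (c.L ^ 2)⁻¹ * (1 / θ i) * (c.e j ⬝ᵥ (c.W ^ 2 *ᵥ c.e i)))| ≤
      C * ((c.L ^ 2)⁻¹ + c.d) := by
  obtain ⟨L₁, hL₁⟩ := exists_quarter_le_sq_u (K := K) h
  -- On this subtype u_i² ≥ 1/4 and the sign convention give u_i ≥ 1/2, while uniform bounds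
  -- restrict freely.
  let κ := {c : EigenConfig θ i γ K // L₁ ≤ c.L ∧ 0 ≤ c.u i}
  have tr : ∀ {f g : EigenConfig θ i γ K → ℝ}, f =O[⊤] g →
      (fun c : κ => f c.1) =O[⊤] fun c : κ => g c.1 :=
    fun hfg => hfg.comp_tendsto tendsto_top
  have hne : θ i - θ j ≠ 0 := by
    have := h.gap j hj
    have hγ := h.gap_pos
    intro h0
    rw [h0, abs_zero] at this
    linarith
  have hR4 : (fun c : EigenConfig θ i γ K =>
      c.s ^ 2 * (c.q ^ 4 * (c.s ^ 2 * ((c.W ^ 4 *ᵥ c.e j) ⬝ᵥ c.v)))) =O[⊤]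
      fun c => c.s ^ 2 :=
    isBigO_mul_bdd (isBigO_refl _ _)
      (isBigO_bdd_mul (by simpa using (isBigO_q h).pow 4) (isBigO_form_mulVec_two h j))
  have main := overlap_second_order (F := (⊤ : Filter κ)) θ i (s := fun c => c.1.s)
    (q := fun c => c.1.q) (d := fun c => c.1.d)
    (u := fun l c => c.1.u l) (w0 := fun j l c => w0 j l c.1) (w1 := fun j l c => w1 j l c.1)
    (w2 := fun j l c => w2 j l c.1) (w3 := fun j l c => w3 j l c.1)
    (R4 := fun j c => c.1.s ^ 2 *
      (c.1.q ^ 4 * (c.1.s ^ 2 * ((c.1.W ^ 4 *ᵥ c.1.e j) ⬝ᵥ c.1.v))))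
    (h.pos i).ne' hne hj (tr isBigO_s) (tr (isBigO_q h))
    (fun j hj => tr (isBigO_u_of_ne h hj))
    (fun c => by
      have h1 := hL₁ c.1 c.2.1
      have h2 := c.2.2
      nlinarith)
    (tr (isBigO_u i)) (tr (isBigO_one_sub_mul_u h i)) (tr (isBigO_sq_u_sub h))
    (fun l => tr (isBigO_w0 j l)) (fun l => tr (isBigO_w1 j l)) (fun l => tr (isBigO_w2 j l))
    (fun l => tr (isBigO_w3 j l)) (tr hR4) (fun c => c.1.d_nonneg)
    (fun c => c.1.u_eq_four h j)
  obtain ⟨C, hC⟩ := isBigO_top.1 main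
  refine ⟨L₁, C, fun c hc hu => ?_⟩
  have h1 := hC ⟨c, hc, hu⟩
  have hs2 : c.s ^ 2 = (c.L ^ 2)⁻¹ := by rw [s, inv_pow]
  have hpos : 0 ≤ c.s ^ 2 + c.d := add_nonneg (sq_nonneg _) c.d_nonneg
  simp only [Real.norm_eq_abs] at h1
  rw [abs_of_nonneg hpos, hs2, ← c.inv_lam h] at h1
  convert h1 using 5
  · rfl
  · rw [← hs2, w2]
    ring

end EigenConfig

/-- Simplicity of the perturbed eigenvalue and expansion of its eigenvector. -/
theorem exists_eigenvector_expansion (h : IsGap θ i γ K) {j : Fin k} (hj : j ≠ i) :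
    ∃ L₁ C : ℝ, ∀ c : PerturbConfig θ i γ K, L₁ ≤ c.L →
      IsSimpleEigenvalue (perturbed θ c.L c.W c.e) (eig (perturbed θ c.L c.W c.e) i) ∧
      ∀ v, IsUnitEigenvector (perturbed θ c.L c.W c.e) (eig (perturbed θ c.L c.W c.e) i)
          (c.e i) v →
        |c.e j ⬝ᵥ v - 1 / (θ i - θ j) * (θ i * (1 / eig (perturbed θ c.L c.W c.e) i) *
            (c.e i ⬝ᵥ (c.W *ᵥ c.e j)) +
          (c.L ^ 2)⁻¹ * (1 / θ i) * (c.e i ⬝ᵥ (c.W ^ 2 *ᵥ c.e j)))| ≤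
        C * ((c.L ^ 2)⁻¹ + c.d) := by
  obtain ⟨L₁, hL₁⟩ := EigenConfig.exists_quarter_le_sq_u (K := K) h
  obtain ⟨L₂, C, hC⟩ := EigenConfig.exists_abs_u_sub_le (K := K) h hj
  refine ⟨max L₁ L₂, C, fun c hc => ?_⟩
  set M := perturbed θ c.L c.W c.e with hM
  have hsymm : M.IsSymm := perturbed_isSymm θ c.L c.symm c.e
  refine ⟨?_, fun v hv => ?_⟩
  · set E := Module.End.eigenspace (Matrix.toLin' M) (eig M i) with hE
    have hmem : ∀ x, x ∈ E ↔ M *ᵥ x = eig M i • x := by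
      intro x
      rw [hE, Module.End.mem_eigenspace_iff, toLin'_apply]
    let φ : E →ₗ[ℝ] ℝ := (dotProductBilin ℝ ℝ (c.e i)).comp E.subtype
    -- An eigenvector orthogonal to e_i, once normalised, would contradict u_i² ≥ 1/4; so pairing
    -- with e_i embeds the eigenspace in ℝ.
    have hφ : Function.Injective φ := by
      rw [← LinearMap.ker_eq_bot, LinearMap.ker_eq_bot']
      intro x hx
      by_contra hx0
      have hx0' : (x : Fin c.N → ℝ) ≠ 0 := fun h0 => hx0 (Subtype.ext h0)
      have hpos : 0 < l2 (x : Fin c.N → ℝ) := by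
        have h1 := dotProduct_self_star_pos_iff.2 hx0'
        rw [star_trivial, ← l2_sq] at h1
        exact lt_of_le_of_ne (l2_nonneg _) fun h0 => by rw [← h0] at h1; simp at h1
      let c' : EigenConfig θ i γ K :=
        { c with
          lam := eig M i
          v := (l2 (x : Fin c.N → ℝ))⁻¹ • (x : Fin c.N → ℝ)
          near := c.abs_eig_sub_le h
          eigen := by
            rw [mulVec_smul, ← hM, (hmem x).1 x.2, smul_comm]
          unit := by
            rw [smul_dotProduct, dotProduct_smul, ← l2_sq]
            simp only [smul_eq_mul]
            field_simp }
      have h2 := hL₁ c' ((le_max_left _ _).trans hc)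
      have h3 : c'.u i = 0 := by
        change c.e i ⬝ᵥ ((l2 (x : Fin c.N → ℝ))⁻¹ • (x : Fin c.N → ℝ)) = 0
        have h4 : c.e i ⬝ᵥ (x : Fin c.N → ℝ) = 0 := hx
        rw [dotProduct_smul, h4, smul_zero]
      rw [h3] at h2
      norm_num at h2
    have hle : Module.finrank ℝ E ≤ 1 := by
      have := LinearMap.finrank_le_finrank_of_injective hφ
      simpa using this
    obtain ⟨v, hv1, hv2⟩ := exists_eigenvector hsymm c.lt
    have hge : 0 < Module.finrank ℝ E := by
      rw [Module.finrank_pos_iff_exists_ne_zero]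
      refine ⟨⟨v, (hmem v).2 hv1⟩, fun h0 => ?_⟩
      have : v = 0 := congrArg Subtype.val h0
      rw [this] at hv2
      simp at hv2
    exact le_antisymm hle hge
  · obtain ⟨h1, h2, h3⟩ := hv
    let c' : EigenConfig θ i γ K :=
      { c with
        lam := eig M i
        v := v
        near := c.abs_eig_sub_le h
        eigen := h1
        unit := by rw [← h2]; simp [dotProduct, sq] }
    have h4 := hC c' ((le_max_right _ _).trans hc) h3
    have h5 : c.e i ⬝ᵥ (c.W *ᵥ c.e j) = c.e j ⬝ᵥ (c.W *ᵥ c.e i) := by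
      rw [dotProduct_mulVec_comm c.symm, dotProduct_comm]
    have h6 : c.e i ⬝ᵥ (c.W ^ 2 *ᵥ c.e j) = c.e j ⬝ᵥ (c.W ^ 2 *ᵥ c.e i) := by
      rw [dotProduct_mulVec_comm (c'.pow_isSymm 2), dotProduct_comm]
    rw [h5, h6]
    exact h4

end Expansion

/-! ### Discretization of the kernel. -/

section Grid

theorem gridPoint_mem {N : ℕ} (a : Fin N) : gridPoint N a ∈ Set.Icc (0 : ℝ) 1 := by
  have hN : (0 : ℝ) < N := by exact_mod_cast (Nat.zero_lt_of_lt a.2)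
  refine ⟨by unfold gridPoint; positivity, ?_⟩
  rw [gridPoint, div_le_one hN]
  exact_mod_cast a.2

/-- Riemann sums of Lipschitz functions. -/
theorem abs_riemann_sum_sub_le {g : ℝ → ℝ} {C : ℝ}
    (hg : ∀ x ∈ Set.Icc (0 : ℝ) 1, ∀ y ∈ Set.Icc (0 : ℝ) 1, |g x - g y| ≤ C * |x - y|)
    {N : ℕ} (hN : 1 ≤ N) :
    |∑ a : Fin N, (N : ℝ)⁻¹ * g (gridPoint N a) - ∫ x in (0 : ℝ)..1, g x| ≤ C / N := by
  have hN0 : (0 : ℝ) < N := by exact_mod_cast hN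
  have hC : 0 ≤ C := by
    have := (abs_nonneg _).trans (hg 0 (by simp) 1 (by simp))
    simpa using this
  have hcont : ContinuousOn g (Set.Icc 0 1) := by
    have : LipschitzOnWith C.toNNReal g (Set.Icc 0 1) := by
      refine LipschitzOnWith.of_dist_le_mul fun x hx y hy => ?_
      rw [Real.dist_eq, Real.dist_eq, Real.coe_toNNReal _ hC]
      exact hg x hx y hy
    exact this.continuousOn
  have hsub : ∀ n < N, Set.uIcc ((n : ℝ) / N) ((n + 1 : ℕ) / N) ⊆ Set.Icc 0 1 := by
    intro n hn
    rw [Set.uIcc_of_le (by push_cast; gcongr; linarith)]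
    refine Set.Icc_subset_Icc (by positivity) ?_
    rw [div_le_one hN0]
    exact_mod_cast hn
  have hint : ∀ n < N, IntervalIntegrable g volume ((n : ℝ) / N) ((n + 1 : ℕ) / N) :=
    fun n hn => (hcont.mono (hsub n hn)).intervalIntegrable
  have hsum := intervalIntegral.sum_integral_adjacent_intervals (a := fun n : ℕ => (n : ℝ) / N) hint
  simp only [Nat.cast_zero, zero_div, div_self hN0.ne'] at hsum
  rw [← hsum, Finset.sum_range, ← Finset.sum_sub_distrib]
  -- The grid point is the right end of its cell of length 1/N, so g varies by at most C/N there.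
  have hterm : ∀ a : Fin N, |(N : ℝ)⁻¹ * g (gridPoint N a) -
      ∫ x in ((a : ℕ) : ℝ) / N..((a : ℕ) + 1 : ℕ) / N, g x| ≤ C / N * (N : ℝ)⁻¹ := by
    intro a
    have hlen : (((a : ℕ) + 1 : ℕ) : ℝ) / N - ((a : ℕ) : ℝ) / N = (N : ℝ)⁻¹ := by
      push_cast; field_simp; ring
    have h1 : (N : ℝ)⁻¹ * g (gridPoint N a) -
        ∫ x in ((a : ℕ) : ℝ) / N..((a : ℕ) + 1 : ℕ) / N, g x =
        ∫ x in ((a : ℕ) : ℝ) / N..((a : ℕ) + 1 : ℕ) / N, (g (gridPoint N a) - g x) := by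
      rw [intervalIntegral.integral_sub intervalIntegrable_const (hint a a.2),
        intervalIntegral.integral_const, hlen, smul_eq_mul]
    rw [h1, ← Real.norm_eq_abs]
    refine (intervalIntegral.norm_integral_le_of_norm_le_const (C := C / N) fun x hx => ?_).trans ?_
    · rw [Real.norm_eq_abs]
      have hx' := Set.uIoc_subset_uIcc hx
      refine (hg _ (gridPoint_mem a) _ (hsub a a.2 hx')).trans ?_
      rw [div_eq_mul_inv]
      refine mul_le_mul_of_nonneg_left ?_ hC
      rw [Set.uIcc_of_le (by push_cast; gcongr; linarith)] at hx'
      have h2 : gridPoint N a = ((a : ℕ) + 1 : ℕ) / N := by simp [gridPoint]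
      rw [h2, abs_of_nonneg (by linarith [hx'.2]), ← hlen]
      linarith [hx'.1]
    · rw [hlen, abs_of_pos (by positivity)]
  calc _ ≤ ∑ a : Fin N, C / N * (N : ℝ)⁻¹ :=
        (Finset.abs_sum_le_sum_abs _ _).trans (Finset.sum_le_sum fun a _ => hterm a)
    _ = C / N := by
        rw [Finset.sum_const, Finset.card_univ, Fintype.card_fin, nsmul_eq_mul]
        field_simp

variable {k : ℕ} {f : ℝ → ℝ → ℝ} {θ : Fin k → ℝ} {r : Fin k → ℝ → ℝ}

/-- A common bound and Lipschitz constant. -/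
theorem AssumptionF2.exists_bound (h : AssumptionF2 r) : ∃ B : ℝ, 1 ≤ B ∧
    (∀ l, ∀ x ∈ Set.Icc (0 : ℝ) 1, |r l x| ≤ B) ∧
    ∀ l, ∀ x ∈ Set.Icc (0 : ℝ) 1, ∀ y ∈ Set.Icc (0 : ℝ) 1, |r l x - r l y| ≤ B * |x - y| := by
  choose C hC using h
  have hle : ∀ l, |C l| + |r l 0| ≤ ∑ l, (|C l| + |r l 0|) := fun l =>
    Finset.single_le_sum (f := fun l => |C l| + |r l 0|) (fun _ _ => by positivity)
      (Finset.mem_univ l)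
  refine ⟨1 + ∑ l, (|C l| + |r l 0|), ?_, fun l x hx => ?_, fun l x hx y hy => ?_⟩
  · have : 0 ≤ ∑ l, (|C l| + |r l 0|) := Finset.sum_nonneg fun _ _ => by positivity
    linarith
  · have h1 := hC l x hx 0 (by simp)
    have h2 : C l * |x - 0| ≤ |C l| := by
      refine (mul_le_mul_of_nonneg_right (le_abs_self _) (abs_nonneg _)).trans ?_
      rw [sub_zero, abs_of_nonneg hx.1]
      exact mul_le_of_le_one_right (abs_nonneg _) hx.2
    have h3 : |r l x| ≤ |r l x - r l 0| + |r l 0| := by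
      simpa using abs_add_le (r l x - r l 0) (r l 0)
    linarith [hle l]
  · refine (hC l x hx y hy).trans (mul_le_mul_of_nonneg_right ?_ (abs_nonneg _))
    linarith [hle l, le_abs_self (C l), abs_nonneg (r l 0)]

theorem discretize_dotProduct {N : ℕ} (g h : ℝ → ℝ) :
    discretize N g ⬝ᵥ discretize N h =
      ∑ a : Fin N, (N : ℝ)⁻¹ * (g (gridPoint N a) * h (gridPoint N a)) := by
  have hN : (Real.sqrt N)⁻¹ * (Real.sqrt N)⁻¹ = (N : ℝ)⁻¹ := by
    rw [← mul_inv, Real.mul_self_sqrt (Nat.cast_nonneg _)]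
  refine Finset.sum_congr rfl fun a _ => ?_
  rw [← hN, discretize, discretize]
  ring

theorem abs_gram_discretize_sub_le (hf : IsKernel f θ r) {B : ℝ}
    (hB : ∀ l, ∀ x ∈ Set.Icc (0 : ℝ) 1, |r l x| ≤ B)
    (hL : ∀ l, ∀ x ∈ Set.Icc (0 : ℝ) 1, ∀ y ∈ Set.Icc (0 : ℝ) 1, |r l x - r l y| ≤ B * |x - y|)
    {N : ℕ} (hN : 1 ≤ N) (j l : Fin k) :
    |discretize N (r j) ⬝ᵥ discretize N (r l) - if j = l then 1 else 0| ≤ 2 * B ^ 2 / N := by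
  rw [discretize_dotProduct, ← hf.orthonormal]
  refine abs_riemann_sum_sub_le (g := fun x => r j x * r l x) (fun x hx y hy => ?_) hN
  have h1 : r j x * r l x - r j y * r l y =
      r j x * (r l x - r l y) + (r j x - r j y) * r l y := by ring
  have hB0 : 0 ≤ B := (abs_nonneg _).trans (hB j x hx)
  have h2 : |r j x * (r l x - r l y)| ≤ B * (B * |x - y|) := by
    rw [abs_mul]
    exact mul_le_mul (hB j x hx) (hL l x hx y hy) (abs_nonneg _) hB0
  have h3 : |(r j x - r j y) * r l y| ≤ (B * |x - y|) * B := by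
    rw [abs_mul]
    exact mul_le_mul (hL j x hx y hy) (hB l y hy) (abs_nonneg _) (by positivity)
  rw [h1]
  refine (abs_add_le _ _).trans ?_
  linarith

theorem abs_discretize_mul_le {B : ℝ} (hB : ∀ l, ∀ x ∈ Set.Icc (0 : ℝ) 1, |r l x| ≤ B)
    {N : ℕ} (j l : Fin k) (a b : Fin N) :
    |discretize N (r j) a * discretize N (r l) b| ≤ B ^ 2 / N := by
  have hN : (Real.sqrt N)⁻¹ * (Real.sqrt N)⁻¹ = (N : ℝ)⁻¹ := by
    rw [← mul_inv, Real.mul_self_sqrt (Nat.cast_nonneg _)]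
  have h1 : discretize N (r j) a * discretize N (r l) b =
      (N : ℝ)⁻¹ * (r j (gridPoint N a) * r l (gridPoint N b)) := by
    rw [← hN, discretize, discretize]; ring
  have hB0 : 0 ≤ B := (abs_nonneg _).trans (hB j _ (gridPoint_mem a))
  rw [h1, abs_mul, abs_mul, abs_of_nonneg (by positivity : (0 : ℝ) ≤ (N : ℝ)⁻¹), div_eq_inv_mul, sq]
  gcongr
  · exact hB j _ (gridPoint_mem a)
  · exact hB l _ (gridPoint_mem b)

theorem IsKernel.le_of_bound (hf : IsKernel f θ r) {B : ℝ}
    (hB : ∀ l, ∀ x ∈ Set.Icc (0 : ℝ) 1, |r l x| ≤ B) {x y : ℝ}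
    (hx : x ∈ Set.Icc (0 : ℝ) 1) (hy : y ∈ Set.Icc (0 : ℝ) 1) :
    f x y ≤ 1 + (∑ l, θ l) * B ^ 2 := by
  rw [hf.decomp x hx y hy, Finset.sum_mul]
  have : ∑ l, θ l * r l x * r l y ≤ ∑ l, θ l * B ^ 2 := by
    refine Finset.sum_le_sum fun l _ => ?_
    rw [mul_assoc]
    refine mul_le_mul_of_nonneg_left ?_ (hf.pos l).le
    refine (le_abs_self _).trans ?_
    rw [abs_mul, sq]
    exact mul_le_mul (hB l x hx) (hB l y hy) (abs_nonneg _) ((abs_nonneg _).trans (hB l x hx))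
  linarith

theorem IsKernel.symm (hf : IsKernel f θ r) {x y : ℝ}
    (hx : x ∈ Set.Icc (0 : ℝ) 1) (hy : y ∈ Set.Icc (0 : ℝ) 1) : f x y = f y x := by
  rw [hf.decomp x hx y hy, hf.decomp y hy x hx]
  exact Finset.sum_congr rfl fun l _ => by ring

/-- Each product e_l(a) e_l(b) carries a factor 1/N, which the scale Nε compensates; the
decomposition of f then makes the mean matrix exactly of finite rank. -/
theorem IsAdjacency.eq_perturbed {Ω : Type*} [MeasurableSpace Ω] {P : Measure Ω}
    {ε : ℝ} {N : ℕ} {A : Ω → Matrix (Fin N) (Fin N) ℝ} (hf : IsKernel f θ r)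
    (h : IsAdjacency P f ε A) (ω : Ω) :
    A ω = perturbed θ (N * ε) (centered P A ω) (fun l => discretize N (r l)) := by
  have hint : ∀ a b, ∫ ω', A ω' a b ∂P = ε * f (gridPoint N a) (gridPoint N b) := by
    intro a b
    rcases le_total a b with hab | hab
    · exact h.integral_eq hab
    · rw [hf.symm (gridPoint_mem a) (gridPoint_mem b), ← h.integral_eq hab]
      congr 1
      ext ω'
      exact (h.symm ω').apply b a
  ext a b
  have hN0 : (0 : ℝ) < N := by exact_mod_cast (Nat.zero_lt_of_lt a.2)
  have hN : (Real.sqrt N)⁻¹ * (Real.sqrt N)⁻¹ = (N : ℝ)⁻¹ := by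
    rw [← mul_inv, Real.mul_self_sqrt (Nat.cast_nonneg _)]
  simp only [perturbed, centered, Matrix.add_apply, Matrix.sub_apply, of_apply, hint]
  rw [hf.decomp _ (gridPoint_mem a) _ (gridPoint_mem b)]
  have : ∑ l, θ l * discretize N (r l) a * discretize N (r l) b =
      (N : ℝ)⁻¹ * ∑ l, θ l * r l (gridPoint N a) * r l (gridPoint N b) := by
    rw [Finset.mul_sum]
    refine Finset.sum_congr rfl fun l _ => ?_
    rw [← hN, discretize, discretize]
    ring
  rw [this]
  field_simp
  ring

end Grid

/-! ### Integrability of squared path sums. -/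

section Square

variable {Ω : Type*} [MeasurableSpace Ω] {P : Measure Ω} [IsProbabilityMeasure P]
  {α : Type*} [Fintype α] {p : ℝ} {X : Sym2 α → Ω → ℝ}

theorem integrable_sq_pathSum_sub (h : IsCenteredFamily P p X) {n : ℕ}
    (c : (Fin (n + 1) → α) → ℝ) (m : ℝ) : Integrable (fun ω => (pathSum X c ω - m) ^ 2) P := by
  have h1 : Integrable (fun ω => pathSum X c ω ^ 2) P := by
    have : ∀ ω, pathSum X c ω ^ 2 =
        ∑ w, ∑ w', c w * c w' * ((∏ t, X (pathEdge w t) ω) * ∏ t, X (pathEdge w' t) ω) := by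
      intro ω
      rw [sq, pathSum, Finset.sum_mul_sum]
      exact Finset.sum_congr rfl fun w _ => Finset.sum_congr rfl fun w' _ => by ring
    simp only [this]
    refine integrable_finsetSum _ fun w _ => integrable_finsetSum _ fun w' _ => ?_
    have := h.integrable_prod (Sum.elim (pathEdge w) (pathEdge w'))
    simp only [Fintype.prod_sum_type] at this
    exact this.const_mul _
  have : ∀ ω, (pathSum X c ω - m) ^ 2 = pathSum X c ω ^ 2 - 2 * m * pathSum X c ω + m ^ 2 :=
    fun ω => by ring
  simp only [this]
  exact (h1.sub ((integrable_pathSum h c).const_mul _)).add (integrable_const _)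

end Square

/-! ### Quadratic forms of the noise and the good event. -/

section Forms

variable {k : ℕ} {f : ℝ → ℝ → ℝ} {θ : Fin k → ℝ} {r : Fin k → ℝ → ℝ} {B F ε : ℝ}
  {Ω : Type*} [MeasurableSpace Ω] {P : Measure Ω} {N : ℕ}
  {A : Ω → Matrix (Fin N) (Fin N) ℝ}

/-- The quadratic form of a power of the centred adjacency matrix. -/
noncomputable def form (P : Measure Ω) (A : Ω → Matrix (Fin N) (Fin N) ℝ) (r : Fin k → ℝ → ℝ)
    (n : ℕ) (j l : Fin k) (ω : Ω) : ℝ :=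
  discretize N (r j) ⬝ᵥ (centered P A ω ^ n *ᵥ discretize N (r l))

/-- The normalised fluctuations of the quadratic forms. -/
noncomputable def fluctuation (P : Measure Ω) (A : Ω → Matrix (Fin N) (Fin N) ℝ)
    (r : Fin k → ℝ → ℝ) (ε : ℝ) (ω : Ω) : ℝ :=
  ∑ j, ∑ l, ∑ n ∈ Finset.range 5, (N / (N * ε) ^ n) *
    (form P A r n j l ω - ∫ ω', form P A r n j l ω' ∂P) ^ 2

/-- The constant controlling the expectations of the quadratic forms. -/
noncomputable def meanConst (B F : ℝ) : ℝ :=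
  ∑ n ∈ Finset.range 5, B ^ 2 * pathConst (n + 1) * F ^ n

/-- Standing assumptions for the moment bounds at a fixed size. -/
structure IsRegime (P : Measure Ω) (f : ℝ → ℝ → ℝ) (r : Fin k → ℝ → ℝ) (B F ε : ℝ)
    (A : Ω → Matrix (Fin N) (Fin N) ℝ) : Prop where
  adj : IsAdjacency P f ε A
  bound : ∀ l, ∀ x ∈ Set.Icc (0 : ℝ) 1, |r l x| ≤ B
  kernel : ∀ x ∈ Set.Icc (0 : ℝ) 1, ∀ y ∈ Set.Icc (0 : ℝ) 1, f x y ≤ F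
  one_le_F : 1 ≤ F
  ε_pos : 0 < ε
  F_mul_le : F * ε ≤ 1
  one_le : 1 ≤ N * ε

namespace IsRegime

theorem N_pos (h : IsRegime P f r B F ε A) : 0 < N := by
  rcases Nat.eq_zero_or_pos N with h0 | h0
  · have := h.one_le
    rw [h0] at this
    norm_num at this
  · exact h0

theorem centeredFamily (h : IsRegime P f r B F ε A) :
    IsCenteredFamily P (F * ε) (edgeVar (centered P A)) := by
  refine h.adj.isCenteredFamily fun a b => ?_
  rw [mul_comm F]
  exact mul_le_mul_of_nonneg_left (h.kernel _ (gridPoint_mem a) _ (gridPoint_mem b)) h.ε_pos.le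

theorem form_eq (h : IsRegime P f r B F ε A) (n : ℕ) (j l : Fin k) :
    form P A r n j l = pathSum (edgeVar (centered P A)) (fun w : Fin (n + 1) → Fin N =>
      discretize N (r j) (w 0) * discretize N (r l) (w (Fin.last n))) := by
  ext ω
  exact dotProduct_pow_mulVec_eq_pathSum (h.adj.centered_isSymm ω) n _ _

theorem one_le_card (h : IsRegime P f r B F ε A) :
    1 ≤ (Fintype.card (Fin N) : ℝ) * (F * ε) := by
  rw [Fintype.card_fin]
  have := mul_le_mul_of_nonneg_left h.one_le (by linarith [h.one_le_F] : (0 : ℝ) ≤ F)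
  linarith [h.one_le_F]

variable [IsProbabilityMeasure P]

theorem abs_integral_form_le (h : IsRegime P f r B F ε A) (n : ℕ) (j l : Fin k) :
    |∫ ω, form P A r n j l ω ∂P| ≤ B ^ 2 * pathConst (n + 1) * F ^ n * (N * ε) ^ (n / 2) := by
  have hN : Nonempty (Fin N) := ⟨⟨0, h.N_pos⟩⟩
  have hN0 : (0 : ℝ) < N := by exact_mod_cast h.N_pos
  rw [h.form_eq]
  refine (abs_integral_pathSum_le h.centeredFamily h.one_le_card _ (B := B ^ 2 / N)
    (by positivity) fun w => abs_discretize_mul_le h.bound _ _ _ _).trans ?_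
  rw [Fintype.card_fin]
  have hF : F ^ (n / 2) ≤ F ^ n := pow_le_pow_right₀ h.one_le_F (Nat.div_le_self _ _)
  have hpc := pathConst_nonneg (n + 1)
  have hL : 0 ≤ N * ε := by linarith [h.one_le]
  calc _ = B ^ 2 * pathConst (n + 1) * F ^ (n / 2) * (N * ε) ^ (n / 2) := by
        rw [mul_left_comm (N : ℝ) F ε, mul_pow]
        field_simp
    _ ≤ _ := by gcongr

/-- Path coefficients are at most B²/N; their square against the single N of the path count gives
L^n/N. The weights in `fluctuation` normalise exactly this. -/
theorem integral_sq_form_sub_le (h : IsRegime P f r B F ε A) (n : ℕ) (j l : Fin k) :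
    ∫ ω, (form P A r n j l ω - ∫ ω', form P A r n j l ω' ∂P) ^ 2 ∂P ≤
      2 * B ^ 4 * pathConst (2 * (n + 1)) * F ^ n * ((N * ε) ^ n / N) := by
  have hN : Nonempty (Fin N) := ⟨⟨0, h.N_pos⟩⟩
  have hN0 : (0 : ℝ) < N := by exact_mod_cast h.N_pos
  rw [h.form_eq]
  refine (integral_sq_pathSum_sub_le h.centeredFamily
    (mul_nonneg (by linarith [h.one_le_F]) h.ε_pos.le) h.F_mul_le h.one_le_card _
    (B := B ^ 2 / N) (by positivity) fun w => abs_discretize_mul_le h.bound _ _ _ _).trans ?_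
  rw [Fintype.card_fin]
  refine le_of_eq ?_
  rw [mul_left_comm (N : ℝ) F ε, mul_pow]
  field_simp

theorem integrable_sq_form_sub (h : IsRegime P f r B F ε A) (n : ℕ) (j l : Fin k) (m : ℝ) :
    Integrable (fun ω => (form P A r n j l ω - m) ^ 2) P := by
  rw [h.form_eq]
  exact integrable_sq_pathSum_sub h.centeredFamily _ _

theorem integrable_fluctuation (h : IsRegime P f r B F ε A) :
    Integrable (fluctuation P A r ε) P :=
  integrable_finsetSum _ fun _ _ => integrable_finsetSum _ fun _ _ =>
    integrable_finsetSum _ fun _ _ => (h.integrable_sq_form_sub _ _ _ _).const_mul _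

theorem integral_fluctuation_le (h : IsRegime P f r B F ε A) :
    ∫ ω, fluctuation P A r ε ω ∂P ≤
      ∑ _j : Fin k, ∑ _l : Fin k, ∑ n ∈ Finset.range 5,
        2 * B ^ 4 * pathConst (2 * (n + 1)) * F ^ n := by
  unfold fluctuation
  have hi := fun n j l => h.integrable_sq_form_sub n j l (∫ ω', form P A r n j l ω' ∂P)
  rw [integral_finsetSum _ fun j _ => integrable_finsetSum _ fun l _ =>
    integrable_finsetSum _ fun n _ => (hi n j l).const_mul _]
  refine Finset.sum_le_sum fun j _ => ?_
  rw [integral_finsetSum _ fun l _ =>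
    integrable_finsetSum _ fun n _ => (hi n j l).const_mul _]
  refine Finset.sum_le_sum fun l _ => ?_
  rw [integral_finsetSum _ fun n _ => (hi n j l).const_mul _]
  refine Finset.sum_le_sum fun n _ => ?_
  rw [integral_const_mul]
  have hN0 : (0 : ℝ) < N := by exact_mod_cast h.N_pos
  have hL : 0 < N * ε := by linarith [h.one_le]
  refine (mul_le_mul_of_nonneg_left (h.integral_sq_form_sub_le n j l) (by positivity)).trans
    (le_of_eq ?_)
  field_simp

omit [IsProbabilityMeasure P] in
theorem fluctuation_nonneg (h : IsRegime P f r B F ε A) (ω : Ω) :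
    0 ≤ fluctuation P A r ε ω := by
  have hL : 0 < N * ε := by linarith [h.one_le]
  refine Finset.sum_nonneg fun _ _ => Finset.sum_nonneg fun _ _ => Finset.sum_nonneg fun _ _ => ?_
  positivity

omit [IsProbabilityMeasure P] in
/-- Control of the quadratic forms by the total fluctuation. -/
theorem sq_form_sub_le (h : IsRegime P f r B F ε A) {n : ℕ} (hn : n < 5) (j l : Fin k) (ω : Ω) :
    (form P A r n j l ω - ∫ ω', form P A r n j l ω' ∂P) ^ 2 ≤
      fluctuation P A r ε ω * ((N * ε) ^ n / N) := by
  have hL : 0 < N * ε := by linarith [h.one_le]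
  have hN0 : (0 : ℝ) < N := by exact_mod_cast h.N_pos
  have h1 : (N / (N * ε) ^ n) * (form P A r n j l ω - ∫ ω', form P A r n j l ω' ∂P) ^ 2 ≤
      fluctuation P A r ε ω := by
    refine le_trans ?_ (Finset.single_le_sum (fun _ _ => Finset.sum_nonneg fun _ _ =>
      Finset.sum_nonneg fun _ _ => by positivity) (Finset.mem_univ j))
    refine le_trans ?_ (Finset.single_le_sum (fun _ _ =>
      Finset.sum_nonneg fun _ _ => by positivity) (Finset.mem_univ l))
    exact Finset.single_le_sum (f := fun n => (N / (N * ε) ^ n) *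
      (form P A r n j l ω - ∫ ω', form P A r n j l ω' ∂P) ^ 2) (fun _ _ => by positivity)
      (Finset.mem_range.2 hn)
  calc _ = (N / (N * ε) ^ n) * (form P A r n j l ω - ∫ ω', form P A r n j l ω' ∂P) ^ 2 *
        ((N * ε) ^ n / N) := by field_simp
    _ ≤ _ := by gcongr

omit [IsProbabilityMeasure P] in
theorem trace_nonneg (h : IsRegime P f r B F ε A) (ω : Ω) : 0 ≤ (centered P A ω ^ 6).trace := by
  have h1 := h.adj.centered_isSymm ω
  have h2 : centered P A ω ^ 6 = (centered P A ω ^ 3)ᴴ * (centered P A ω ^ 3) := by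
    rw [conjTranspose_eq_transpose_of_trivial, transpose_pow, h1.eq, ← pow_add]
  rw [h2]
  exact (posSemidef_conjTranspose_mul_self _).trace_nonneg

theorem integrable_trace (h : IsRegime P f r B F ε A) :
    Integrable (fun ω => (centered P A ω ^ 6).trace) P := by
  simp only [fun ω => trace_pow_eq_pathSum (h.adj.centered_isSymm ω) 6]
  exact integrable_pathSum h.centeredFamily _

theorem integral_trace_le (h : IsRegime P f r B F ε A) :
    ∫ ω, (centered P A ω ^ 6).trace ∂P ≤ pathConst 7 * F ^ 3 * (N * (N * ε) ^ 3) := by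
  have hN : Nonempty (Fin N) := ⟨⟨0, h.N_pos⟩⟩
  simp only [fun ω => trace_pow_eq_pathSum (h.adj.centered_isSymm ω) 6]
  refine (le_abs_self _).trans ((abs_integral_pathSum_le h.centeredFamily h.one_le_card _
    (B := 1) zero_le_one fun w => ?_).trans (le_of_eq ?_))
  · split_ifs <;> simp
  · rw [Fintype.card_fin, mul_left_comm (N : ℝ) F ε]
    norm_num
    ring

omit [IsProbabilityMeasure P] in
theorem le_meanConst (h : IsRegime P f r B F ε A) {n : ℕ} (hn : n < 5) :
    B ^ 2 * pathConst (n + 1) * F ^ n ≤ meanConst B F := by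
  refine Finset.single_le_sum (f := fun n => B ^ 2 * pathConst (n + 1) * F ^ n)
    (fun n _ => ?_) (Finset.mem_range.2 hn)
  have := pathConst_nonneg (n + 1)
  have := h.one_le_F
  positivity

omit [IsProbabilityMeasure P] in
theorem meanConst_nonneg (h : IsRegime P f r B F ε A) : 0 ≤ meanConst B F := by
  refine le_trans ?_ (h.le_meanConst (n := 0) (by norm_num))
  have := pathConst_nonneg 1
  positivity

omit [IsProbabilityMeasure P] in
theorem ε_le_one (h : IsRegime P f r B F ε A) : ε ≤ 1 := by
  have := mul_le_mul_of_nonneg_right h.one_le_F h.ε_pos.le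
  linarith [h.F_mul_le]

theorem abs_form_le (h : IsRegime P f r B F ε A) {R : ℝ} (hR : 0 ≤ R) {ω : Ω}
    (hfl : fluctuation P A r ε ω ≤ R) {n : ℕ} (hn1 : 1 ≤ n) (hn5 : n < 5) (j l : Fin k) :
    |form P A r n j l ω| ≤ (meanConst B F + Real.sqrt R) * (N * ε) ^ (n / 2) := by
  have hN0 : (0 : ℝ) < N := by exact_mod_cast h.N_pos
  have hL1 := h.one_le
  have hL0 : 0 < N * ε := by linarith
  have h1 := h.abs_integral_form_le n j l
  have h2 := h.sq_form_sub_le hn5 j l ω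
  -- For n ≥ 1 the division by N turns one factor Nε into ε ≤ 1, and n - 1 ≤ 2⌊n/2⌋ also for odd n.
  have h3 : (N * ε) ^ n / N ≤ ((N * ε) ^ (n / 2)) ^ 2 := by
    obtain ⟨m, rfl⟩ : ∃ m, n = m + 1 := ⟨n - 1, by omega⟩
    calc (N * ε) ^ (m + 1) / N = (N * ε) ^ m * ε := by
          rw [pow_succ]; field_simp
      _ ≤ (N * ε) ^ m * 1 := by gcongr; exact h.ε_le_one
      _ ≤ _ := by
          rw [mul_one, ← pow_mul]
          exact pow_le_pow_right₀ hL1 (by omega)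
  have h4 : |form P A r n j l ω - ∫ ω', form P A r n j l ω' ∂P| ≤
      Real.sqrt R * (N * ε) ^ (n / 2) := by
    refine abs_le_of_sq_le_sq (h2.trans ?_) (by positivity)
    rw [mul_pow (Real.sqrt R), Real.sq_sqrt hR]
    exact mul_le_mul hfl h3 (by positivity) hR
  have h5 := mul_le_mul_of_nonneg_right (h.le_meanConst hn5)
    (by positivity : 0 ≤ (N * ε) ^ (n / 2))
  have h6 : |form P A r n j l ω| ≤ |form P A r n j l ω - ∫ ω', form P A r n j l ω' ∂P| +
      |∫ ω', form P A r n j l ω' ∂P| := by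
    simpa using abs_add_le (form P A r n j l ω - ∫ ω', form P A r n j l ω' ∂P)
      (∫ ω', form P A r n j l ω' ∂P)
  linarith

/-- The spectral configuration on the event of small fluctuations and small trace. -/
noncomputable def perturbConfig (h : IsRegime P f r B F ε A) (hf : IsKernel f θ r)
    (hL : ∀ l, ∀ x ∈ Set.Icc (0 : ℝ) 1, ∀ y ∈ Set.Icc (0 : ℝ) 1, |r l x - r l y| ≤ B * |x - y|)
    {i : Fin k} (hi : (i : ℕ) < N) {γ R K : ℝ} (hγ : 0 < γ) (hR : 0 ≤ R)
    (hK : meanConst B F + Real.sqrt R + 1 + 2 * B ^ 2 ≤ K)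
    (hd1 : θ i * (k * (2 * B ^ 2 / N)) ≤ γ / 8) (hd2 : k * (2 * B ^ 2 / N) ≤ 1 / 2)
    {ω : Ω} (hfl : fluctuation P A r ε ω ≤ R)
    (htr : (centered P A ω ^ 6).trace ≤ (γ / 8 * (N * ε)) ^ 6) :
    PerturbConfig θ i γ K :=
  have hN0 : (0 : ℝ) < N := by exact_mod_cast h.N_pos
  have hL0 : 0 < N * ε := by linarith [h.one_le]
  have hform := fun {n : ℕ} hn1 hn5 => h.abs_form_le hR hfl (n := n) hn1 hn5
  have hsR := Real.sqrt_nonneg R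
  have hC0 := h.meanConst_nonneg
  have hK0 : meanConst B F + Real.sqrt R + 1 ≤ K := by nlinarith [sq_nonneg B]
  have hsymm := h.adj.centered_isSymm ω
  have hpow : ∀ m, (centered P A ω ^ m).IsSymm := fun m => by
    rw [IsSymm, transpose_pow, hsymm.eq]
  { N := N
    L := N * ε
    d := 2 * B ^ 2 / N
    W := centered P A ω
    e := fun l => discretize N (r l)
    lt := hi
    one_le_L := h.one_le
    d_nonneg := by positivity
    -- The summand 2B² of K serves here, since 1/N ≤ 1/(Nε).
    d_le := by
      rw [div_eq_inv_mul, show K * (N * ε)⁻¹ = (N : ℝ)⁻¹ * (K * ε⁻¹) by rw [mul_inv]; ring]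
      refine mul_le_mul_of_nonneg_left ?_ (by positivity)
      have : 1 ≤ ε⁻¹ := (one_le_inv₀ h.ε_pos).2 h.ε_le_one
      nlinarith [sq_nonneg B]
    d_le_gap := hd1
    d_le_half := hd2
    symm := hsymm
    gram := abs_gram_discretize_sub_le hf h.bound hL h.N_pos
    form1 := fun j l => by
      have := hform le_rfl (by norm_num) j l
      simp only [form, pow_one] at this
      norm_num at this
      linarith
    form2 := fun j l => by
      refine (hform (by norm_num : 1 ≤ 2) (by norm_num) j l).trans ?_
      norm_num
      gcongr
      linarith
    form3 := fun j l => by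
      refine (hform (by norm_num : 1 ≤ 3) (by norm_num) j l).trans ?_
      norm_num
      gcongr
      linarith
    -- |W²e_l|² is the form of W⁴, which is why fourth powers belong to the fluctuation; K ≥ 1 gives
    -- K ≤ K².
    norm2 := fun l => by
      have h4 := (le_abs_self _).trans (hform (by norm_num : 1 ≤ 4) (by norm_num) l l)
      have h5 : form P A r 4 l l ω = l2 (centered P A ω ^ 2 *ᵥ discretize N (r l)) ^ 2 := by
        rw [l2_sq, ← dotProduct_mulVec_comm (hpow 2), mulVec_mulVec, ← pow_add]
        rfl
      rw [h5] at h4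
      norm_num at h4
      refine (pow_le_pow_iff_left₀ (n := 2) (l2_nonneg _)
        (mul_nonneg (by linarith) hL0.le) (by norm_num)).1 (h4.trans ?_)
      rw [mul_pow K]
      refine mul_le_mul_of_nonneg_right ?_ (by positivity)
      nlinarith
    norm := fun x => by
      have h6 := l2_mulVec_pow_six_le hsymm x
      refine (pow_le_pow_iff_left₀ (n := 6) (l2_nonneg _)
        (mul_nonneg (by positivity) (l2_nonneg x)) (by norm_num)).1 (h6.trans ?_)
      rw [mul_pow (γ / 8 * (N * ε))]
      exact mul_le_mul_of_nonneg_right htr (pow_nonneg (l2_nonneg x) 6) }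

end IsRegime

/-- Markov's inequality. -/
theorem measure_le_of_integral_le [IsProbabilityMeasure P] {Y : Ω → ℝ} (h0 : ∀ ω, 0 ≤ Y ω)
    (hint : Integrable Y P) {C t : ℝ} (hC : ∫ ω, Y ω ∂P ≤ C) (ht : 0 < t) :
    P {ω | t ≤ Y ω} ≤ ENNReal.ofReal (C / t) := by
  have h1 := mul_meas_ge_le_integral_of_nonneg (ae_of_all _ h0) hint t
  rw [← ofReal_measureReal]
  refine ENNReal.ofReal_le_ofReal ?_
  rw [le_div_iff₀ ht, mul_comm]
  exact h1.trans hC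

end Forms

/-! ### Limits of the error scales. -/

section Limits

variable {ε : ℕ → ℝ}

theorem tendsto_inv_mul (hE : AssumptionE2 ε) (hpos : ∀ N, 1 ≤ N → 0 < ε N) :
    Tendsto (fun N : ℕ => ((N : ℝ) * ε N)⁻¹) atTop (𝓝 0) := by
  have h1 : Tendsto (fun N : ℕ => (N : ℝ) ^ (-(1 / 3) : ℝ)) atTop (𝓝 0) :=
    (tendsto_rpow_neg_atTop (by norm_num)).comp tendsto_natCast_atTop_atTop
  have h2 := hE.1.tendsto_div_nhds_zero.mul h1
  rw [mul_zero] at h2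
  refine h2.congr' ?_
  filter_upwards [eventually_ge_atTop 1] with N hN
  have hN0 : (0 : ℝ) < N := by exact_mod_cast hN
  have hε := hpos N hN
  have h3 : (N : ℝ) ^ (-(2 / 3) + -(1 / 3) : ℝ) = (N : ℝ)⁻¹ := by
    rw [← Real.rpow_neg_one]
    norm_num
  rw [div_mul_eq_mul_div, ← Real.rpow_add hN0, h3, mul_inv, div_eq_mul_inv]

/-- The quotient is the cube of N^(-2/3)/ε; it governs both the failure probability for ‖W‖ and, via
its square root, the second order error. -/
theorem tendsto_div_cube (hE : AssumptionE2 ε) (hpos : ∀ N, 1 ≤ N → 0 < ε N) :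
    Tendsto (fun N : ℕ => (N : ℝ) / ((N : ℝ) * ε N) ^ 3) atTop (𝓝 0) := by
  have h2 := hE.1.tendsto_div_nhds_zero.pow 3
  rw [zero_pow (by norm_num)] at h2
  refine h2.congr' ?_
  filter_upwards [eventually_ge_atTop 1] with N hN
  have hN0 : (0 : ℝ) < N := by exact_mod_cast hN
  have hε := hpos N hN
  have h3 : ((N : ℝ) ^ (-(2 / 3) : ℝ)) ^ 3 = ((N : ℝ) ^ 2)⁻¹ := by
    rw [← Real.rpow_natCast, ← Real.rpow_mul hN0.le, ← Real.rpow_natCast (N : ℝ) 2,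
      ← Real.rpow_neg hN0.le]
    norm_num
  rw [div_pow, h3]
  field_simp

theorem tendsto_second_order (hE : AssumptionE2 ε) (hpos : ∀ N, 1 ≤ N → 0 < ε N) :
    Tendsto (fun N : ℕ => (N : ℝ) * Real.sqrt (ε N) * (((N : ℝ) * ε N) ^ 2)⁻¹) atTop (𝓝 0) := by
  have h := (tendsto_div_cube hE hpos).sqrt
  rw [Real.sqrt_zero] at h
  refine h.congr' ?_
  filter_upwards [eventually_ge_atTop 1] with N hN
  have hN0 : (0 : ℝ) < N := by exact_mod_cast hN
  have hε := hpos N hN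
  have hs := Real.sq_sqrt hε.le
  have hs0 := Real.sqrt_pos.2 hε
  rw [Real.sqrt_eq_iff_mul_self_eq (by positivity) (by positivity)]
  rw [← sq, mul_pow ((N : ℝ) * Real.sqrt (ε N)), mul_pow (N : ℝ) (Real.sqrt (ε N)), hs]
  field_simp

theorem tendsto_sqrt_scale (hE : AssumptionE2 ε) :
    Tendsto (fun N : ℕ => Real.sqrt (ε N)) atTop (𝓝 0) := by
  have := ((isLittleO_one_iff ℝ).1 hE.2).sqrt
  rwa [Real.sqrt_zero] at this

theorem tendsto_fluctuation (hE : AssumptionE2 ε) (hpos : ∀ N, 1 ≤ N → 0 < ε N) :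
    Tendsto (fun N : ℕ => (N : ℝ) * Real.sqrt (ε N) *
      (((N : ℝ) * ε N) / Real.sqrt N * (((N : ℝ) * ε N) ^ 2)⁻¹)) atTop (𝓝 0) := by
  have h := (tendsto_inv_mul hE hpos).sqrt
  rw [Real.sqrt_zero] at h
  refine h.congr' ?_
  filter_upwards [eventually_ge_atTop 1] with N hN
  have hN0 : (0 : ℝ) < N := by exact_mod_cast hN
  have hε := hpos N hN
  have hs := Real.sq_sqrt hε.le
  have hs' := Real.sq_sqrt hN0.le
  have hs0 := Real.sqrt_pos.2 hε
  have hs0' := Real.sqrt_pos.2 hN0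
  have key : ∀ a b : ℝ, 0 < a → 0 < b →
      (a * b)⁻¹ = a ^ 2 * b * ((a ^ 2 * b ^ 2) / a * ((a ^ 2 * b ^ 2) ^ 2)⁻¹) := by
    intro a b ha hb
    field_simp
  have h3 := key _ _ hs0' hs0
  rw [hs, hs'] at h3
  rw [Real.sqrt_inv, Real.sqrt_mul hN0.le, h3]

end Limits

theorem IsIsolated.ne {k : ℕ} {θ : Fin k → ℝ} {i : Fin k} (hi : IsIsolated θ i)
    (hθ : Antitone θ) {j : Fin k} (hj : j ≠ i) : θ i ≠ θ j := by
  rcases lt_or_gt_of_ne hj with h | h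
  · have hlt : (i : ℕ) - 1 < k := by omega
    have hji : (j : ℕ) < i := h
    have h1 := hi.1 ⟨i - 1, hlt⟩ (by simp; omega)
    have h2 : θ ⟨i - 1, hlt⟩ ≤ θ j := hθ (by rw [Fin.le_def]; simp; omega)
    exact (h1.trans_le h2).ne
  · have hij : (i : ℕ) < j := h
    have hlt : (i : ℕ) + 1 < k := by omega
    have h1 := hi.2 ⟨i + 1, hlt⟩ (by simp)
    have h2 : θ j ≤ θ ⟨i + 1, hlt⟩ := hθ (by rw [Fin.le_def]; simp; omega)
    exact (h2.trans_lt h1).ne'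

theorem IsIsolated.exists_gap {k : ℕ} {θ : Fin k → ℝ} {i : Fin k} (hi : IsIsolated θ i)
    (hpos : ∀ l, 0 < θ l) (hθ : Antitone θ) :
    ∃ γ : ℝ, ∀ K, 1 ≤ K → IsGap θ i γ K := by
  -- Including θ_i in the minimum keeps λ_i bounded below by a multiple of L.
  let g : Fin k → ℝ := fun j => if j = i then θ i else |θ i - θ j|
  have hne : (Finset.univ : Finset (Fin k)).Nonempty := ⟨i, Finset.mem_univ _⟩
  refine ⟨Finset.univ.inf' hne g, fun K hK => ⟨hpos, hθ, ?_, ?_, fun j hj => ?_, hK⟩⟩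
  · rw [Finset.lt_inf'_iff]
    intro j _
    by_cases hj : j = i
    · simp only [g, if_pos hj]; exact hpos i
    · simp only [g, if_neg hj]; exact abs_pos.2 (sub_ne_zero.2 (hi.ne hθ hj))
  · exact (Finset.inf'_le _ (Finset.mem_univ i)).trans (by simp [g])
  · exact (Finset.inf'_le _ (Finset.mem_univ j)).trans (by simp [g, hj])

end InhomER

/-! ### Assembly: good event, error comparison, failure probability. -/

open InhomER

theorem mainTheorem6 {k : ℕ} (hk : 2 ≤ k)
    (f : ℝ → ℝ → ℝ) (θ : Fin k → ℝ) (r : Fin k → ℝ → ℝ) (hf : InhomER.IsKernel f θ r)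
    (hF2 : InhomER.AssumptionF2 r)
    (ε : ℕ → ℝ) (hε : InhomER.AdmissibleScale f ε) (hE2 : InhomER.AssumptionE2 ε)
    {Ω : ℕ → Type*} [∀ N, MeasurableSpace (Ω N)] (P : ∀ N, Measure (Ω N))
    [∀ N, IsProbabilityMeasure (P N)]
    (A : ∀ N, Ω N → Matrix (Fin N) (Fin N) ℝ)
    (hA : ∀ N, 1 ≤ N → InhomER.IsAdjacency (P N) f (ε N) (A N))
    (i : Fin k) (hi : InhomER.IsIsolated θ i)
    (v : ∀ N, Ω N → Fin N → ℝ)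
    (hv : ∀ N, (i : ℕ) < N → ∀ ω,
      InhomER.IsSimpleEigenvalue (A N ω) (InhomER.eig (A N ω) i) →
        InhomER.IsUnitEigenvector (A N ω) (InhomER.eig (A N ω) i)
          (InhomER.discretize N (r i)) (v N ω))
    (j : Fin k) (hj : j ≠ i) :
    InhomER.IsLittleOp P
      (fun N ω =>
        InhomER.discretize N (r j) ⬝ᵥ v N ω -
          (1 / (θ i - θ j)) *
            (θ i * (1 / InhomER.eig (A N ω) i) *
                (InhomER.discretize N (r i) ⬝ᵥ
                  (InhomER.centered (P N) (A N) ω *ᵥ InhomER.discretize N (r j))) +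
              ((N : ℝ) * ε N) ^ (-2 : ℤ) * (1 / θ i) *
                ∫ ω', InhomER.discretize N (r i) ⬝ᵥ
                  ((InhomER.centered (P N) (A N) ω' ^ 2) *ᵥ InhomER.discretize N (r j)) ∂(P N)))
      (fun N _ => 1 / ((N : ℝ) * Real.sqrt (ε N))) := by
  intro δ hδ
  have hpos : ∀ N, 1 ≤ N → 0 < ε N := fun N hN => (hε N hN).1
  obtain ⟨γ, hγ⟩ := hi.exists_gap hf.pos hf.antitone
  have hγ0 : 0 < γ := (hγ 1 le_rfl).gap_pos
  obtain ⟨B, hB1, hB, hBL⟩ := hF2.exists_bound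
  set F : ℝ := 1 + (∑ l, θ l) * B ^ 2 with hF
  have hF1 : 1 ≤ F := by
    have : 0 ≤ ∑ l, θ l := Finset.sum_nonneg fun l _ => (hf.pos l).le
    rw [hF]
    nlinarith [sq_nonneg B]
  set CS : ℝ := ∑ _j : Fin k, ∑ _l : Fin k, ∑ n ∈ Finset.range 5,
    2 * B ^ 4 * pathConst (2 * (n + 1)) * F ^ n with hCS
  have hCS0 : 0 ≤ CS := Finset.sum_nonneg fun _ _ => Finset.sum_nonneg fun _ _ =>
    Finset.sum_nonneg fun n _ => by
      have := pathConst_nonneg (2 * (n + 1))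
      positivity
  rw [ENNReal.tendsto_nhds_zero]
  intro η hη
  obtain ⟨η₀, hη₀, hηle⟩ : ∃ η₀ : ℝ, 0 < η₀ ∧ ENNReal.ofReal η₀ ≤ η := by
    refine ⟨(min η 1).toReal, ENNReal.toReal_pos (lt_min hη one_pos).ne' (by simp), ?_⟩
    rw [ENNReal.ofReal_toReal (by simp)]
    exact min_le_left _ _
  -- Chosen so that Markov's inequality gives failure probability at most η₀/2 for the fluctuation.
  -- The constants K, L₁, C then depend on η₀ but not on N.
  set R : ℝ := 2 * (CS + 1) / η₀ with hR
  have hR0 : 0 < R := by positivity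
  set K : ℝ := meanConst B F + Real.sqrt R + 1 + 2 * B ^ 2 with hK
  have hmean : 0 ≤ meanConst B F := Finset.sum_nonneg fun n _ => by
    have := pathConst_nonneg (n + 1)
    positivity
  have hK1 : 1 ≤ K := by
    rw [hK]
    nlinarith [Real.sqrt_nonneg R, sq_nonneg B]
  obtain ⟨L₁, C, hexp⟩ := exists_eigenvector_expansion (hγ K hK1) hj
  set D : ℝ := |1 / (θ i - θ j)| * (1 / θ i) * Real.sqrt R with hD
  have hε0 : Tendsto ε atTop (𝓝 0) := (isLittleO_one_iff ℝ).1 hE2.2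
  have hinv := tendsto_inv_mul hE2 hpos
  have hinvN : Tendsto (fun N : ℕ => 2 * B ^ 2 / (N : ℝ)) atTop (𝓝 0) :=
    tendsto_const_nhds.div_atTop tendsto_natCast_atTop_atTop
  have ev1 : ∀ᶠ N in atTop, F * ε N ≤ 1 := by
    have := hε0.const_mul F
    rw [mul_zero] at this
    exact this.eventually_le_const one_pos
  have ev2 : ∀ᶠ N : ℕ in atTop, ((N : ℝ) * ε N)⁻¹ ≤ (max 1 L₁)⁻¹ :=
    hinv.eventually_le_const (by positivity)
  have ev3 : ∀ᶠ N : ℕ in atTop, θ i * (k * (2 * B ^ 2 / (N : ℝ))) ≤ γ / 8 := by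
    have := (hinvN.const_mul (k : ℝ)).const_mul (θ i)
    rw [mul_zero, mul_zero] at this
    exact this.eventually_le_const (by positivity)
  have ev4 : ∀ᶠ N : ℕ in atTop, k * (2 * B ^ 2 / (N : ℝ)) ≤ 1 / 2 := by
    have := hinvN.const_mul (k : ℝ)
    rw [mul_zero] at this
    exact this.eventually_le_const (by norm_num)
  have ev5 : ∀ᶠ N : ℕ in atTop, pathConst 7 * F ^ 3 / (γ / 8) ^ 6 *
      ((N : ℝ) / ((N : ℝ) * ε N) ^ 3) ≤ η₀ / 2 := by
    have := (tendsto_div_cube hE2 hpos).const_mul (pathConst 7 * F ^ 3 / (γ / 8) ^ 6)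
    rw [mul_zero] at this
    exact this.eventually_le_const (by positivity)
  have ev6 : ∀ᶠ N : ℕ in atTop,
      C * ((N : ℝ) * Real.sqrt (ε N) * (((N : ℝ) * ε N) ^ 2)⁻¹) +
      C * (2 * B ^ 2) * Real.sqrt (ε N) + D * ((N : ℝ) * Real.sqrt (ε N) *
      (((N : ℝ) * ε N) / Real.sqrt N * (((N : ℝ) * ε N) ^ 2)⁻¹)) ≤ δ := by
    have := (((tendsto_second_order hE2 hpos).const_mul C).add
      ((tendsto_sqrt_scale hE2).const_mul (C * (2 * B ^ 2)))).add
      ((tendsto_fluctuation hE2 hpos).const_mul D)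
    simp only [mul_zero, add_zero] at this
    exact this.eventually_le_const hδ
  filter_upwards [ev1, ev2, ev3, ev4, ev5, ev6, eventually_gt_atTop (i : ℕ),
    eventually_ge_atTop 1] with N h1 h2 h3 h4 h5 h6 hiN hN
  have hN0 : (0 : ℝ) < N := by exact_mod_cast hN
  have hεN := hpos N hN
  have hL0 : 0 < (N : ℝ) * ε N := by positivity
  have hL : max 1 L₁ ≤ (N : ℝ) * ε N := (inv_le_inv₀ hL0 (by positivity)).1 h2
  have hreg : IsRegime (P N) f r B F (ε N) (A N) :=
    { adj := hA N hN
      bound := hB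
      kernel := fun x hx y hy => hf.le_of_bound hB hx hy
      one_le_F := hF1
      ε_pos := hεN
      F_mul_le := h1
      one_le := (le_max_left _ _).trans hL }
  -- Off the two exceptional events the deterministic expansion applies, so the error is too large
  -- only on their union. This inclusion needs no measurability of v.
  have hsub : {ω | δ * |1 / ((N : ℝ) * Real.sqrt (ε N))| <
      |discretize N (r j) ⬝ᵥ v N ω - (1 / (θ i - θ j)) *
            (θ i * (1 / eig (A N ω) i) *
                (discretize N (r i) ⬝ᵥ (centered (P N) (A N) ω *ᵥ discretize N (r j))) +
              ((N : ℝ) * ε N) ^ (-2 : ℤ) * (1 / θ i) *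
                ∫ ω', discretize N (r i) ⬝ᵥ
                  ((centered (P N) (A N) ω' ^ 2) *ᵥ discretize N (r j)) ∂(P N))|} ⊆
      {ω | R ≤ fluctuation (P N) (A N) r (ε N) ω} ∪
        {ω | (γ / 8 * (N * ε N)) ^ 6 ≤ (centered (P N) (A N) ω ^ 6).trace} := by
    intro ω hω
    by_contra hnot
    simp only [Set.mem_union, Set.mem_ofPred_eq, not_or, not_le] at hnot hω
    refine absurd hω (not_lt.2 ?_)
    have hAeq := (hA N hN).eq_perturbed hf ω
    obtain ⟨hsimple, hbound⟩ := hexp (hreg.perturbConfig hf hBL hiN hγ0 hR0.le le_rfl h3 h4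
      hnot.1.le hnot.2.le) ((le_max_right _ _).trans hL)
    change IsSimpleEigenvalue (perturbed θ (N * ε N) (centered (P N) (A N) ω)
      (fun l => discretize N (r l))) (eig (perturbed θ (N * ε N) (centered (P N) (A N) ω)
      (fun l => discretize N (r l))) i) at hsimple
    rw [← hAeq] at hsimple
    have hvec := hv N hiN ω hsimple
    have hb := hbound (v N ω) (by
      change IsUnitEigenvector (perturbed θ (N * ε N) (centered (P N) (A N) ω)
        (fun l => discretize N (r l))) (eig (perturbed θ (N * ε N) (centered (P N) (A N) ω)
        (fun l => discretize N (r l))) i) (discretize N (r i)) (v N ω)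
      rw [← hAeq]
      exact hvec)
    change |discretize N (r j) ⬝ᵥ v N ω - 1 / (θ i - θ j) * (θ i *
      (1 / eig (perturbed θ (N * ε N) (centered (P N) (A N) ω)
        (fun l => discretize N (r l))) i) *
      (discretize N (r i) ⬝ᵥ (centered (P N) (A N) ω *ᵥ discretize N (r j))) +
      ((N * ε N) ^ 2)⁻¹ * (1 / θ i) * form (P N) (A N) r 2 i j ω)| ≤
      C * (((N * ε N) ^ 2)⁻¹ + 2 * B ^ 2 / N) at hb
    rw [← hAeq] at hb
    change |discretize N (r j) ⬝ᵥ v N ω - (1 / (θ i - θ j)) *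
            (θ i * (1 / eig (A N ω) i) *
                (discretize N (r i) ⬝ᵥ (centered (P N) (A N) ω *ᵥ discretize N (r j))) +
              ((N : ℝ) * ε N) ^ (-2 : ℤ) * (1 / θ i) *
                ∫ ω', form (P N) (A N) r 2 i j ω' ∂(P N))| ≤ _
    set m := ∫ ω', form (P N) (A N) r 2 i j ω' ∂(P N)
    have hz : ((N : ℝ) * ε N) ^ (-2 : ℤ) = (((N : ℝ) * ε N) ^ 2)⁻¹ := by
      rw [_root_.zpow_neg]; norm_cast
    rw [hz]
    have hsN := Real.sqrt_pos.2 hN0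
    have hsε := Real.sqrt_pos.2 hεN
    have hfl : |form (P N) (A N) r 2 i j ω - m| ≤
        Real.sqrt R * (((N : ℝ) * ε N) / Real.sqrt N) := by
      refine abs_le_of_sq_le_sq ((hreg.sq_form_sub_le (by norm_num) i j ω).trans ?_)
        (by positivity)
      rw [mul_pow (Real.sqrt R), Real.sq_sqrt hR0.le, div_pow, Real.sq_sqrt hN0.le]
      exact mul_le_mul_of_nonneg_right hnot.1.le (by positivity)
    have hθi := hf.pos i
    -- The cost of replacing e_i'W²e_j by its expectation.
    have herr : |1 / (θ i - θ j) * ((((N : ℝ) * ε N) ^ 2)⁻¹ * (1 / θ i) *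
        (form (P N) (A N) r 2 i j ω - m))| ≤
        D * (((N : ℝ) * ε N) / Real.sqrt N * (((N : ℝ) * ε N) ^ 2)⁻¹) := by
      rw [abs_mul, abs_mul, abs_of_nonneg
        (by positivity : 0 ≤ (((N : ℝ) * ε N) ^ 2)⁻¹ * (1 / θ i))]
      calc _ ≤ |1 / (θ i - θ j)| * ((((N : ℝ) * ε N) ^ 2)⁻¹ * (1 / θ i) *
            (Real.sqrt R * (((N : ℝ) * ε N) / Real.sqrt N))) := by gcongr
        _ = _ := by rw [hD]; ring
    have htot := (abs_add_le _ _).trans (add_le_add hb herr)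
    have hfin : C * ((((N : ℝ) * ε N) ^ 2)⁻¹ + 2 * B ^ 2 / N) +
        D * (((N : ℝ) * ε N) / Real.sqrt N * (((N : ℝ) * ε N) ^ 2)⁻¹) ≤
        δ * |1 / ((N : ℝ) * Real.sqrt (ε N))| := by
      rw [abs_of_pos (by positivity), mul_one_div, le_div_iff₀ (by positivity)]
      refine le_trans (le_of_eq ?_) h6
      field_simp
    refine le_trans (le_of_eq ?_) (htot.trans hfin)
    congr 1
    ring
  refine (measure_mono hsub).trans ((measure_union_le _ _).trans ?_)
  have m1 := measure_le_of_integral_le hreg.fluctuation_nonneg hreg.integrable_fluctuation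
    hreg.integral_fluctuation_le hR0
  have m2 := measure_le_of_integral_le hreg.trace_nonneg hreg.integrable_trace
    hreg.integral_trace_le (by positivity : 0 < (γ / 8 * (N * ε N)) ^ 6)
  refine (add_le_add m1 m2).trans (le_trans ?_ hηle)
  have hp7 := pathConst_nonneg 7
  rw [← ENNReal.ofReal_add (by positivity) (by positivity)]
  refine ENNReal.ofReal_le_ofReal ?_
  have e1 : CS / R ≤ η₀ / 2 := by
    rw [hR, div_div_eq_mul_div, div_le_div_iff₀ (by positivity) (by norm_num)]
    nlinarith
  have e2 : pathConst 7 * F ^ 3 * (N * (N * ε N) ^ 3) / (γ / 8 * (N * ε N)) ^ 6 ≤ η₀ / 2 := by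
    refine le_trans (le_of_eq ?_) h5
    field_simp
  linarith
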